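/- **Setting.** Let $n$ items have distinct unknown real values $\theta_1,\dots,\theta_n$, ordered by the permutation $\pi$ with $\theta_{\pi(1)}<\dots<\theta_{\pi(n)}$. Let $0\le p<1/2$. At time $k$ an agent queries a pair $i\ne j$ and receives $Y_k=\mathbb 1\{\theta_i<\theta_j\}\oplus Z_k$ with $Z_k$ i.i.d. $\mathrm{Bern}(p)$. An $(R,n)$ noisy sorting code is an adaptive, possibly randomized querying strategy with a stopping time $M$ (depending on the past queries, the responses and the agent's private randomness) and an estimate $\hat\Pi$ of $\pi$ computed at time $M$, such that $E[M]=\frac{n\log_2 n}{R}$ for every true order. A rate $R>0$ is *achievable* if there are $(R,n)$ codes, $n=0,1,2,\dots$, with $\lim_{n\to\infty}\max_\pi P(\hat\Pi\ne\pi)=0$. The capacity $C(p)$ is the supremum of the achievable rates. Let $H(p)=-p\log_2p-(1-p)\log_2(1-p)$. **The algorithm $A_n$** (for $0<p<1/2$). Rename the items by a uniformly random permutation. Start with the list consisting of item $n$, and insert the items $n-1,n-2,\dots,1$ one after another into the current list $(\tilde\theta_1,\dots,\tilde\theta_{m-1})$; put $\tilde\theta_0=-\infty$ and $\tilde\theta_m=\infty$.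 The position of an item $\tilde\theta$ is estimated by the variable-length Burnashev–Zigangirov search with target error $\varepsilon=\frac1{n\log_2n}$, as follows. Keep a posterior $q$ on the $m$ gaps $1,\dots,m$ of the list (gap $i$ lies between $\tilde\theta_{i-1}$ and $\tilde\theta_i$), initially uniform. Let $j$ be the gap with $\sum_{i<j}q(i)\le\frac12<\sum_{i\le j}q(i)$, and put $\tau_1=2\sum_{i\ge j}q(i)-1$, $\tau_2=2\sum_{i\le j}q(i)-1$, $\rho(x)=(1-p)\log_2(1+(1-2p)x)+p\log_2(1-(1-2p)x)$ and $\pi_1=\frac{\rho(\tau_2)-\rho(-\tau_2)}{\rho(\tau_1)-\rho(-\tau_1)+\rho(\tau_2)-\rho(-\tau_2)}$. Compare $\tilde\theta$ with $\tilde\theta_{j-1}$ with probability $\pi_1$ and with $\tilde\theta_j$ otherwise (if one of these two is infinite, compare with the other one), and update $q$ by Bayes' rule for crossover probability $p$. Stop as soon as $\log_2\frac{q(i)}{1-q(i)}\ge-\log_2\varepsilon$ for some $i$, and insert the item into the gap of largest posterior. Output the final list. **Theorem.** Let $0\le p<\frac12$. 1. Every rate $0<R<\frac12(1-H(p))$ is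 achievable. 2. Consequently $C(p)\ge\frac12(1-H(p))$. 3. Let $0<p<\frac12$. The algorithm $A_n$ attains these rates in the following sense. (a) The worst-case error probability of $A_n$ tends to $0$ as $n\to\infty$. (b) For every $0<R<\frac12(1-H(p))$ and all sufficiently large $n$, the number $M$ of queries of $A_n$ satisfies $E\big[M\,\mathbb 1\{\hat\Pi=\pi\}\big]\le\frac{n\log_2n}R$ for every true order $\pi$. (c) There are caps $N_n\in\mathbb N$, independent of $R$, such that $A_n$, stopped after at most $N_n$ queries, still has worst-case error probability tending to $0$ and, for every $0<R<\frac12(1-H(p))$ and all sufficiently large $n$, its expected number of queries is at most $\frac{n\log_2n}R$ for every true order. -/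

import Mathlib

open MeasureTheory ProbabilityTheory Filter Topology
open scoped ENNReal

namespace NoisySorting

/-! ### Noisy sorting codes -/

/-- A query: an ordered pair `(i, j)` of distinct item indices, asking whether `θ i < θ j`. -/
abbrev Query (n : ℕ) : Type := {q : Fin n × Fin n // q.1 ≠ q.2}

/-- The past queries together with their noisy responses, the most recent one first. -/
abbrev History (n : ℕ) : Type := List (Query n × Bool)

/-- A (randomized, variable-length, adaptive) noisy sorting code for `n` items.  The private
randomness of the agent is a seed drawn once from an arbitrary probability space.  Given the seed
and the past queries and responses, `next` is either the next query (`some q`) or the decision to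
stop (`none`), and `estimate` is the output if the agent has stopped. -/
structure SortingCode (n : ℕ) where
  Seed : Type
  [measurableSpaceSeed : MeasurableSpace Seed]
  law : Measure Seed
  [isProbabilityMeasure_law : IsProbabilityMeasure law]
  next : Seed → History n → Option (Query n)
  estimate : Seed → History n → Equiv.Perm (Fin n)
  measurableSet_next : ∀ h a, MeasurableSet {s | next s h = a}
  measurableSet_estimate : ∀ h e, MeasurableSet {s | estimate s h = e}

attribute [instance] SortingCode.measurableSpaceSeed SortingCode.isProbabilityMeasure_law

/-- The law of the i.i.d. `Bern(p)` noise bits (`true` means that the response is flipped). -/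
noncomputable def noiseLaw (p : unitInterval) : Measure (ℕ → Bool) :=
  Measure.infinitePi fun _ => bernoulliMeasure true false p

namespace SortingCode

variable {n : ℕ}

/-- The queries and responses during the first `k` time steps, when the items have the values `θ`,
the seed is `s` and the noise bits are `z`.  Once the code has stopped, nothing changes. -/
noncomputable def history (c : SortingCode n) (θ : Fin n → ℝ) (s : c.Seed) (z : ℕ → Bool) :
    ℕ → History n
  | 0 => []
  | k + 1 =>
    match c.next s (history c θ s z k) with
    | none => history c θ s z k
    | some q => (q, xor (decide (θ q.1.1 < θ q.1.2)) (z k)) :: history c θ s z k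

/-- The joint law of the seed and the noise, which are independent. -/
noncomputable def runLaw (p : unitInterval) (c : SortingCode n) : Measure (c.Seed × (ℕ → Bool)) :=
  c.law.prod (noiseLaw p)

/-- The stopping time `M`: the number of queries made (infinite if the code never stops). -/
noncomputable def queryCount (c : SortingCode n) (θ : Fin n → ℝ) (ω : c.Seed × (ℕ → Bool)) : ℕ∞ :=
  ⨅ (k : ℕ) (_ : c.next ω.1 (c.history θ ω.1 ω.2 k) = none), (k : ℕ∞)

/-- The expected number of queries `E[M]`. -/
noncomputable def expectedQueries (p : unitInterval) (c : SortingCode n) (θ : Fin n → ℝ) : ℝ≥0∞ :=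
  ∫⁻ ω, (c.queryCount θ ω : ℝ≥0∞) ∂(c.runLaw p)

/-- The event that the code stops and outputs `π`. -/
def outputs (c : SortingCode n) (θ : Fin n → ℝ) (π : Equiv.Perm (Fin n)) :
    Set (c.Seed × (ℕ → Bool)) :=
  {ω | ∃ k, c.next ω.1 (c.history θ ω.1 ω.2 k) = none ∧
    c.estimate ω.1 (c.history θ ω.1 ω.2 k) = π}

/-- The worst-case error probability: the supremum, over all items `θ` and all permutations `π`
with `θ (π 0) < θ (π 1) < ⋯`, of the probability that the code does not output `π`. -/
noncomputable def maxError (p : unitInterval) (c : SortingCode n) : ℝ≥0∞ :=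
  ⨆ (θ : Fin n → ℝ) (π : Equiv.Perm (Fin n)) (_ : StrictMono (θ ∘ π)),
    c.runLaw p (c.outputs θ π)ᶜ

/-- The code has sorting rate `R`, i.e. `E[M] = n log₂ n / R` whatever the true order is. -/
def HasRate (p : unitInterval) (R : ℝ) (c : SortingCode n) : Prop :=
  ∀ θ : Fin n → ℝ, Function.Injective θ →
    c.expectedQueries p θ = ENNReal.ofReal (n * Real.logb 2 n / R)

/-- The code that runs `c` but stops after at most `N` queries. -/
noncomputable def truncate (N : ℕ) (c : SortingCode n) : SortingCode n where
  Seed := c.Seed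
  law := c.law
  next s h := if h.length < N then c.next s h else none
  estimate := c.estimate
  measurableSet_next h a := by
    by_cases hN : h.length < N
    · simpa [hN] using c.measurableSet_next h a
    · simp [hN]
  measurableSet_estimate := c.measurableSet_estimate

end SortingCode

/-- The sorting rate `R` is achievable when the observation noise is i.i.d. `Bern(p)`. -/
def Achievable (p : unitInterval) (R : ℝ) : Prop :=
  0 < R ∧ ∃ c : (n : ℕ) → SortingCode n,
    (∀ n, (c n).HasRate p R) ∧ Tendsto (fun n => (c n).maxError p) atTop (𝓝 0)

/-- The noisy sorting capacity, as an extended real number. -/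
noncomputable def capacity (p : unitInterval) : EReal :=
  ⨆ (R : ℝ) (_ : Achievable p R), (R : EReal)

/-- The binary entropy function, in bits. -/
noncomputable def entropy (p : ℝ) : ℝ := Real.binEntropy p / Real.log 2

/-! ### Variable-length Burnashev–Zigangirov search

A sorted list of `m - 1` elements cuts the line into `m` intervals `0, …, m - 1`; the list element
of index `a` (counted from `0`) separates the intervals `0, …, a` from `a + 1, …, m - 1`.
A posterior is a function `q : ℕ → ℝ` of which only the values at `0, …, m - 1` matter. -/

/-- The uniform prior on `m` intervals. -/
noncomputable def uniformPrior (m : ℕ) : ℕ → ℝ := fun _ => 1 / m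

/-- `ρ(x) = (1-p) log₂ (1 + (1-2p) x) + p log₂ (1 - (1-2p) x)`. -/
noncomputable def rho (p x : ℝ) : ℝ :=
  (1 - p) * Real.logb 2 (1 + (1 - 2 * p) * x) + p * Real.logb 2 (1 - (1 - 2 * p) * x)

/-- The interval that contains the median of the posterior. -/
noncomputable def medianIndex (q : ℕ → ℝ) : ℕ :=
  sInf {j | 1 / 2 < ∑ i ∈ Finset.range (j + 1), q i}

noncomputable def tauOne (m : ℕ) (q : ℕ → ℝ) : ℝ :=
  2 * ∑ i ∈ Finset.Ico (medianIndex q) m, q i - 1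

noncomputable def tauTwo (q : ℕ → ℝ) : ℝ :=
  2 * ∑ i ∈ Finset.range (medianIndex q + 1), q i - 1

/-- The probability `π₁` of querying the left endpoint of the median interval. -/
noncomputable def leftProb (p : ℝ) (m : ℕ) (q : ℕ → ℝ) : ℝ :=
  (rho p (tauTwo q) - rho p (-tauTwo q)) /
    (rho p (tauOne m q) - rho p (-tauOne m q) + (rho p (tauTwo q) - rho p (-tauTwo q)))

open Classical in
/-- The index of the list element that is queried, where `u` is uniform on `[0, 1]`: the left
endpoint of the median interval with probability `π₁`, and otherwise the right one.  If one of the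
endpoints is infinite, the other one is queried (the comparison with `±∞` has a known answer, is
not a query of the sorting problem, and would leave the posterior unchanged). -/
noncomputable def queryIndex (p : ℝ) (m : ℕ) (q : ℕ → ℝ) (u : ℝ) : ℕ :=
  if medianIndex q ≠ 0 ∧ (medianIndex q + 1 = m ∨ u < leftProb p m q) then medianIndex q - 1
  else medianIndex q

/-- Bayes' rule: the posterior after the response `y` to the question whether the list element of
index `a` is smaller than the target. -/
noncomputable def bayesUpdate (p : ℝ) (q : ℕ → ℝ) (a : ℕ) (y : Bool) : ℕ → ℝ := fun i =>
  (if y = decide (a < i) then 2 * (1 - p) else 2 * p) * q i /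
    (1 + (if y then -1 else 1) * (1 - 2 * p) * (2 * ∑ l ∈ Finset.range (a + 1), q l - 1))

/-- The stopping rule for the target error `ε`: some interval has log-odds at least `-log₂ ε`. -/
def SearchDone (m : ℕ) (ε : ℝ) (q : ℕ → ℝ) : Prop :=
  ∃ i < m, -Real.logb 2 ε ≤ Real.logb 2 (q i / (1 - q i))

/-- The (first) interval of largest posterior. -/
noncomputable def argmaxIndex (m : ℕ) (q : ℕ → ℝ) : ℕ :=
  sInf {i | i < m ∧ ∀ j < m, q j ≤ q i}

/-! ### Insertion sort based on this search -/

/-- The state of the sorting algorithm: the list sorted so far, the items still to be inserted (the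
first one is being inserted), and the posterior of the current search. -/
structure InsertionState (n : ℕ) where
  sorted : List (Fin n)
  pending : List (Fin n)
  posterior : ℕ → ℝ

namespace InsertionState

variable {n : ℕ}

/-- The start: the items are renamed by `r`; the last one forms the sorted list, and the others are
to be inserted from the last but one down to the first. -/
noncomputable def init (r : Equiv.Perm (Fin n)) : InsertionState n :=
  let l := (List.finRange n).reverse.map r
  ⟨l.take 1, l.drop 1, uniformPrior 2⟩

open Classical in
/-- Take a query of the list element `o.1.1.1` with response `o.2` into account.  If the search is
done, insert the item at the estimated position and start the next search. -/
noncomputable def step (p ε : ℝ) (S : InsertionState n) (o : Query n × Bool) : InsertionState n :=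
  let m := S.sorted.length + 1
  let q := bayesUpdate p S.posterior (S.sorted.idxOf o.1.1.1) o.2
  match S.pending with
  | [] => S
  | t :: rest =>
    if SearchDone m ε q then
      ⟨S.sorted.insertIdx (argmaxIndex m q) t, rest, uniformPrior (m + 1)⟩
    else ⟨S.sorted, t :: rest, q⟩

/-- The state after a given history. -/
noncomputable def after (p ε : ℝ) (r : Equiv.Perm (Fin n)) : History n → InsertionState n
  | [] => init r
  | o :: h => step p ε (after p ε r h) o

/-- The next query: a list element against the item being inserted. -/
noncomputable def nextQuery (p : ℝ) (S : InsertionState n) (u : ℝ) : Option (Query n) :=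
  match S.pending with
  | [] => none
  | t :: _ =>
    match S.sorted[queryIndex p (S.sorted.length + 1) S.posterior u]? with
    | none => none
    | some x => if h : x ≠ t then some ⟨(x, t), h⟩ else none

open Classical in
/-- The sorted list, read as a permutation (the identity if it is not yet complete). -/
noncomputable def toPerm (S : InsertionState n) : Equiv.Perm (Fin n) :=
  if h : ∃ e : Equiv.Perm (Fin n), List.ofFn e = S.sorted then h.choose else 1

end InsertionState

instance instMeasurableSpacePermFin (n : ℕ) : MeasurableSpace (Equiv.Perm (Fin n)) := ⊤

/-- The variable-length noisy sorting code: the items are renamed by a uniformly random permutation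
`s.1` and then sorted by insertion, where every insertion is a variable-length
Burnashev–Zigangirov search with target error `1 / (n log₂ n)`.  The `k`-th query uses the
independent uniform variable `s.2 k`. -/
noncomputable def vlbzSort (p : ℝ) (n : ℕ) : SortingCode n where
  Seed := Equiv.Perm (Fin n) × (ℕ → unitInterval)
  law := (PMF.uniformOfFintype (Equiv.Perm (Fin n))).toMeasure.prod
    (Measure.infinitePi fun _ => (volume : Measure unitInterval))
  next s h := (InsertionState.after p (1 / (n * Real.logb 2 n)) s.1 h).nextQuery p (s.2 h.length)
  estimate s h := (InsertionState.after p (1 / (n * Real.logb 2 n)) s.1 h).toPerm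
  measurableSet_next h a := by
    let _ : MeasurableSpace (Option (Query n)) := ⊤
    suffices H : Measurable fun s : Equiv.Perm (Fin n) × (ℕ → unitInterval) =>
        (InsertionState.after p (1 / (n * Real.logb 2 n)) s.1 h).nextQuery p (s.2 h.length) from
      H (t := {a}) trivial
    refine measurable_from_prod_countable_right fun r => ?_
    have hindex : Measurable fun u : ℕ → unitInterval =>
        queryIndex p ((InsertionState.after p (1 / (n * Real.logb 2 n)) r h).sorted.length + 1)
          (InsertionState.after p (1 / (n * Real.logb 2 n)) r h).posterior (u h.length) := by
      unfold queryIndex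
      refine Measurable.ite ?_ measurable_const measurable_const
      refine MeasurableSet.inter (MeasurableSet.const _) (MeasurableSet.union
        (MeasurableSet.const _) ?_)
      have hu : Measurable fun u : ℕ → unitInterval => u h.length := measurable_pi_apply h.length
      exact measurableSet_lt (measurable_subtype_coe.comp hu) measurable_const
    unfold InsertionState.nextQuery
    exact (measurable_from_top (f := fun k : ℕ =>
      match (InsertionState.after p (1 / (n * Real.logb 2 n)) r h).pending with
      | [] => (none : Option (Query n))
      | t :: _ =>
        match (InsertionState.after p (1 / (n * Real.logb 2 n)) r h).sorted[k]? with
        | none => none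
        | some x => if h : x ≠ t then some ⟨(x, t), h⟩ else none)).comp hindex
  measurableSet_estimate h e :=
    measurable_fst (t := {r : Equiv.Perm (Fin n) |
      (InsertionState.after p (1 / (n * Real.logb 2 n)) r h).toPerm = e}) trivial

end NoisySorting

namespace NoisySorting

/-! ### The function `rho` -/

section Rho

variable {p : ℝ}

/-! One search. Follow the log-odds of the true gap. A query multiplies the odds by a likelihood
ratio, and the mean increment of the log-odds is `1 - H(p) - rho(-x)`, where `x` is the imbalance of
the query relative to the posterior on the other gaps (`IsPosterior.responseMean_logOdds`). A single
endpoint of the median gap may have `rho(-x) > 0`, but the weight `π₁` is chosen so that the mean of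
`rho(-x)` over the two endpoints is nonpositive whichever gap is the true one
(`IsPosterior.queryMean_rho_nonpos`). So the drift is at least `1 - H(p)` per query
(`IsPosterior.logOdds_drift`). The log-odds start no lower than `-log₂ n` and end no higher than
`log₂ (1/ε) + log₂ ((1-p)/p)`. With `ε = 1/(n log₂ n)` a search therefore takes at most `(2 log₂ n +
log₂ log₂ n + O(1))/(1 - H(p))` queries on average. One `log₂ n` pays for locating the item and one
for reliability, whence the factor `1/2` in the rate.

Errors. When a search stops, the posterior mass outside the reported gap is at most `ε`. By Bayes'
rule the search errs with probability at most `ε` if the true gap is drawn from the prior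
(`IsPosterior.sum_mul_searchError_le`). The random renaming makes the rank of every inserted item
uniform among its predecessors (`sum_perm_insertionRank`), which is exactly the uniform prior. A
union bound over the insertions gives `n ε = 1 / log₂ n → 0`.

Both estimates are potential arguments for the Markov chain of histories (`stepMean_timePotential`,
`stepMean_errorPotential`). After a wrong insertion the responses need not be consistent with any
gap of the list and the drift is lost, so the time potential is set to zero there and only queries
before the first error are counted. This bounds `E[M; correct]`. A cap at `N ≈ n log₂ n √(log₂ n)`
controls the rest: it is large compared with that mean, so by Markov's inequality it rarely matters,
while `N · P(error) = o(n log₂ n)`.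

Achievability asks for an exact mean, the same for all orders. Wrapping a code by
`SortingCode.simulate` averages it over renamings, which equalizes the mean over the orders, and a
random number of dummy queries fills the remaining gap (`SortingCode.exists_expectedQueries_eq`).
The wrapper may also add artificial noise. This settles `p = 0`: simulate a channel with small `p' >
0` and use the continuity of the entropy. -/

lemma one_add_mul_pos (h0 : 0 < p) (h1 : p < 1 / 2) {x : ℝ} (hx : -1 ≤ x) :
    0 < 1 + (1 - 2 * p) * x := by
  nlinarith

lemma one_sub_mul_pos (h0 : 0 < p) (h1 : p < 1 / 2) {x : ℝ} (hx : x ≤ 1) :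
    0 < 1 - (1 - 2 * p) * x := by
  nlinarith

lemma log_sub_log_le {a b : ℝ} (ha : 0 < a) (hb : 0 < b) :
    Real.log a - Real.log b ≤ (a - b) / b := by
  have := Real.log_le_sub_one_of_pos (div_pos ha hb)
  rw [Real.log_div ha.ne' hb.ne'] at this
  rwa [sub_div, div_self hb.ne']

/-- `rho` is concave with derivative `(1-2p)² (1-y) / ((1+(1-2p)y)(1-(1-2p)y))`, up to the factor
`log 2`. This is nonnegative for `y ≤ 1`, so the tangent at `y` lies below `rho p y` to the left of
`y`. -/
lemma rho_mono (h0 : 0 < p) (h1 : p < 1 / 2) {x y : ℝ} (hx : -1 ≤ x) (hxy : x ≤ y) (hy : y ≤ 1) :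
    rho p x ≤ rho p y := by
  have hx1 := one_add_mul_pos h0 h1 hx
  have hx2 := one_sub_mul_pos h0 h1 (hxy.trans hy)
  have hy1 := one_add_mul_pos h0 h1 (hx.trans hxy)
  have hy2 := one_sub_mul_pos h0 h1 hy
  have e1 := log_sub_log_le hx1 hy1
  have e2 := log_sub_log_le hx2 hy2
  have hl : (0 : ℝ) < Real.log 2 := Real.log_pos one_lt_two
  -- The tangent bounds `e1`, `e2` leave the derivative at `y` times `x - y`, whose sign is visible
  -- after clearing denominators.
  have key : (1 - p) * ((1 + (1 - 2 * p) * x - (1 + (1 - 2 * p) * y)) / (1 + (1 - 2 * p) * y)) +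
      p * ((1 - (1 - 2 * p) * x - (1 - (1 - 2 * p) * y)) / (1 - (1 - 2 * p) * y)) ≤ 0 := by
    have : (1 - p) * ((1 + (1 - 2 * p) * x - (1 + (1 - 2 * p) * y)) / (1 + (1 - 2 * p) * y)) +
      p * ((1 - (1 - 2 * p) * x - (1 - (1 - 2 * p) * y)) / (1 - (1 - 2 * p) * y)) =
      -((1 - 2 * p) ^ 2 * (y - x) * (1 - y)) /
        ((1 + (1 - 2 * p) * y) * (1 - (1 - 2 * p) * y)) := by
      rw [← mul_div_assoc, ← mul_div_assoc, div_add_div _ _ hy1.ne' hy2.ne']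
      congr 1
      ring
    rw [this]
    apply div_nonpos_of_nonpos_of_nonneg _ (mul_pos hy1 hy2).le
    have : 0 ≤ (1 - 2 * p) ^ 2 * (y - x) * (1 - y) :=
      mul_nonneg (mul_nonneg (sq_nonneg _) (by linarith)) (by linarith)
    linarith
  have e3 := mul_le_mul_of_nonneg_left e1 (by linarith : 0 ≤ 1 - p)
  have e4 := mul_le_mul_of_nonneg_left e2 h0.le
  unfold rho Real.logb
  rw [← sub_nonneg]
  have : (1 - p) * (Real.log (1 + (1 - 2 * p) * y) / Real.log 2) +
      p * (Real.log (1 - (1 - 2 * p) * y) / Real.log 2) -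
      ((1 - p) * (Real.log (1 + (1 - 2 * p) * x) / Real.log 2) +
      p * (Real.log (1 - (1 - 2 * p) * x) / Real.log 2)) =
      -((1 - p) * (Real.log (1 + (1 - 2 * p) * x) - Real.log (1 + (1 - 2 * p) * y)) +
        p * (Real.log (1 - (1 - 2 * p) * x) - Real.log (1 - (1 - 2 * p) * y))) / Real.log 2 := by
    field_simp
    ring
  rw [this]
  exact div_nonneg (by linarith) hl.le

@[simp] lemma rho_zero : rho p 0 = 0 := by simp [rho]

lemma rho_nonneg (h0 : 0 < p) (h1 : p < 1 / 2) {x : ℝ} (hx : 0 ≤ x) (hx' : x ≤ 1) :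
    0 ≤ rho p x := by
  simpa using rho_mono h0 h1 (by norm_num) hx hx'

lemma rho_nonpos (h0 : 0 < p) (h1 : p < 1 / 2) {x : ℝ} (hx : -1 ≤ x) (hx' : x ≤ 0) :
    rho p x ≤ 0 := by
  simpa using rho_mono h0 h1 hx hx' (by norm_num)

/-- The weights `1-p` and `p` add up to one, so the sum is `log₂ (1 - (1-2p)² x²)`. -/
lemma rho_add_rho_neg_nonpos (h0 : 0 < p) (h1 : p < 1 / 2) {x : ℝ} (hx : -1 ≤ x) (hx' : x ≤ 1) :
    rho p x + rho p (-x) ≤ 0 := by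
  have e1 := one_add_mul_pos h0 h1 hx
  have e2 := one_sub_mul_pos h0 h1 hx'
  have : rho p x + rho p (-x) = Real.logb 2 ((1 + (1 - 2 * p) * x) * (1 - (1 - 2 * p) * x)) := by
    rw [Real.logb_mul e1.ne' e2.ne']
    simp only [rho, mul_neg, sub_neg_eq_add, ← sub_eq_add_neg]
    ring
  rw [this]
  apply Real.logb_nonpos one_lt_two (mul_pos e1 e2).le
  nlinarith [sq_nonneg ((1 - 2 * p) * x)]

lemma rho_sub_rho_neg_pos (h0 : 0 < p) (h1 : p < 1 / 2) {x : ℝ} (hx : 0 < x) (hx' : x ≤ 1) :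
    0 < rho p x - rho p (-x) := by
  have e2 := one_sub_mul_pos h0 h1 hx'
  have : rho p x - rho p (-x) = (1 - 2 * p) *
      (Real.logb 2 (1 + (1 - 2 * p) * x) - Real.logb 2 (1 - (1 - 2 * p) * x)) := by
    simp only [rho, mul_neg, sub_neg_eq_add, ← sub_eq_add_neg]
    ring
  rw [this]
  refine mul_pos (by linarith) (sub_pos.2 (Real.logb_lt_logb one_lt_two e2 ?_))
  nlinarith

lemma rho_sub_rho_neg_mono (h0 : 0 < p) (h1 : p < 1 / 2) {x y : ℝ} (hx : 0 ≤ x) (hxy : x ≤ y)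
    (hy : y ≤ 1) : rho p x - rho p (-x) ≤ rho p y - rho p (-y) :=
  sub_le_sub (rho_mono h0 h1 (by linarith) hxy hy)
    (rho_mono h0 h1 (by linarith) (by linarith) (by linarith))

/-- The choice of `π₁` balances the two neighbouring queries. -/
lemma rho_mix_nonpos (h0 : 0 < p) (h1 : p < 1 / 2) {s t : ℝ} (hs : 0 ≤ s) (hs' : s ≤ 1)
    (ht : 0 ≤ t) (ht' : t ≤ 1) :
    (rho p t - rho p (-t)) * rho p s + (rho p s - rho p (-s)) * rho p (-t) ≤ 0 := by
  have a1 := rho_nonneg h0 h1 hs hs'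
  have a2 := rho_nonneg h0 h1 ht ht'
  have b1 := rho_add_rho_neg_nonpos h0 h1 (by linarith : -1 ≤ s) hs'
  have b2 := rho_add_rho_neg_nonpos h0 h1 (by linarith : -1 ≤ t) ht'
  -- The cross terms cancel: the left side is `rho t * rho s - rho (-s) * rho (-t)`, and `0 ≤ rho ≤
  -- -rho ∘ neg` on `[0, 1]`.
  nlinarith [mul_le_mul (by linarith : rho p s ≤ -rho p (-s)) (by linarith : rho p t ≤ -rho p (-t))
    a2 (by linarith)]

end Rho

/-! ### Posteriors and Bayes' rule -/

/-- `q` is a positive probability vector on `0, …, m - 1`. -/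
structure IsPosterior (m : ℕ) (q : ℕ → ℝ) : Prop where
  pos : ∀ i, 0 < q i
  sum_eq : ∑ i ∈ Finset.range m, q i = 1

/-- The log-odds of the interval `g`. -/
noncomputable def logOdds (q : ℕ → ℝ) (g : ℕ) : ℝ := Real.logb 2 (q g / (1 - q g))

/-- Twice the probability of the response `y` to the query `a`, under the posterior `q`. -/
noncomputable def bayesNorm (p : ℝ) (q : ℕ → ℝ) (a : ℕ) (y : Bool) : ℝ :=
  1 + (if y then -1 else 1) * (1 - 2 * p) * (2 * ∑ l ∈ Finset.range (a + 1), q l - 1)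

/-- The probability that is on the wrong side of the query `a` when `g` is the truth. -/
noncomputable def oppositeMass (q : ℕ → ℝ) (g a : ℕ) : ℝ :=
  if a < g then ∑ i ∈ Finset.range (a + 1), q i else 1 - ∑ i ∈ Finset.range (a + 1), q i

/-- The normalized imbalance of the query `a` between the two sides, without the true interval. -/
noncomputable def imbalance (q : ℕ → ℝ) (g a : ℕ) : ℝ :=
  (2 * oppositeMass q g a - 1 + q g) / (1 - q g)

section Bayes

variable {p : ℝ} {m : ℕ} {q : ℕ → ℝ} {g a : ℕ}

lemma isPosterior_uniformPrior (hm : 0 < m) : IsPosterior m (uniformPrior m) := by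
  have : (0 : ℝ) < m := by exact_mod_cast hm
  refine ⟨fun i => by simpa [uniformPrior] using this, ?_⟩
  simp [uniformPrior, this.ne']

namespace IsPosterior

lemma sum_le_one (hq : IsPosterior m q) {s : Finset ℕ} (hs : s ⊆ Finset.range m) :
    ∑ i ∈ s, q i ≤ 1 :=
  hq.sum_eq ▸ Finset.sum_le_sum_of_subset_of_nonneg hs fun i _ _ => (hq.pos i).le

lemma lt_one (hq : IsPosterior m q) (hm : 2 ≤ m) (hg : g < m) : q g < 1 := by
  obtain ⟨i, hi, hne⟩ : ∃ i < m, i ≠ g := by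
    rcases Nat.eq_zero_or_pos g with rfl | h
    · exact ⟨1, by omega, by omega⟩
    · exact ⟨0, by omega, by omega⟩
  have := hq.sum_le_one (s := {i, g}) (by
    intro x hx
    simp only [Finset.mem_insert, Finset.mem_singleton] at hx
    rcases hx with rfl | rfl <;> simpa)
  rw [Finset.sum_pair hne] at this
  linarith [hq.pos i]

lemma sum_nonneg (hq : IsPosterior m q) (s : Finset ℕ) : 0 ≤ ∑ i ∈ s, q i :=
  Finset.sum_nonneg fun i _ => (hq.pos i).le

lemma oppositeMass_nonneg (hq : IsPosterior m q) (ha : a < m) : 0 ≤ oppositeMass q g a := by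
  unfold oppositeMass
  split_ifs
  · exact hq.sum_nonneg _
  · have := hq.sum_le_one (s := Finset.range (a + 1)) (by simpa using ha)
    linarith

lemma oppositeMass_le (hq : IsPosterior m q) (hg : g < m) : oppositeMass q g a ≤ 1 - q g := by
  unfold oppositeMass
  split_ifs with h
  · have := hq.sum_le_one (s := insert g (Finset.range (a + 1))) (by
      intro x hx
      simp only [Finset.mem_insert, Finset.mem_range] at hx ⊢
      omega)
    rw [Finset.sum_insert (by simp; omega)] at this
    linarith
  · have := Finset.single_le_sum (f := q) (s := Finset.range (a + 1)) (a := g)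
      (fun i _ => (hq.pos i).le) (by simp; omega)
    linarith

lemma neg_one_le_imbalance (hq : IsPosterior m q) (hm : 2 ≤ m) (hg : g < m) (ha : a < m) :
    -1 ≤ imbalance q g a := by
  have h1 := hq.lt_one hm hg
  rw [imbalance, le_div_iff₀ (by linarith)]
  linarith [hq.oppositeMass_nonneg (g := g) ha]

lemma imbalance_le_one (hq : IsPosterior m q) (hm : 2 ≤ m) (hg : g < m) :
    imbalance q g a ≤ 1 := by
  have h1 := hq.lt_one hm hg
  rw [imbalance, div_le_iff₀ (by linarith)]
  linarith [hq.oppositeMass_le (a := a) hg]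

/-- The imbalance equals `2 * oppositeMass / (1 - q g) - 1`, and removing the true interval can only
enlarge the share of the opposite side. -/
lemma le_imbalance (hq : IsPosterior m q) (hm : 2 ≤ m) (hg : g < m) (ha : a < m) :
    2 * oppositeMass q g a - 1 ≤ imbalance q g a := by
  have h1 := hq.lt_one hm hg
  rw [imbalance, le_div_iff₀ (by linarith)]
  nlinarith [hq.oppositeMass_nonneg (g := g) ha, hq.pos g]

lemma bayesNorm_pos (h0 : 0 < p) (h1 : p < 1 / 2) (hq : IsPosterior m q) (ha : a < m) (y : Bool) :
    0 < bayesNorm p q a y := by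
  have e1 := hq.sum_nonneg (Finset.range (a + 1))
  have e2 := hq.sum_le_one (s := Finset.range (a + 1)) (by simpa using ha)
  have d1 := one_add_mul_pos h0 h1 (x := 2 * ∑ l ∈ Finset.range (a + 1), q l - 1)
    (by linarith)
  have d2 := one_sub_mul_pos h0 h1 (x := 2 * ∑ l ∈ Finset.range (a + 1), q l - 1)
    (by linarith)
  cases y <;> simp [bayesNorm] <;> linarith

lemma bayesUpdate_mul (h0 : 0 < p) (h1 : p < 1 / 2) (hq : IsPosterior m q) (ha : a < m) (y : Bool)
    (i : ℕ) : bayesUpdate p q a y i * bayesNorm p q a y =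
      (if y = decide (a < i) then 2 * (1 - p) else 2 * p) * q i :=
  div_mul_cancel₀ _ (hq.bayesNorm_pos h0 h1 ha y).ne'

lemma bayes (h0 : 0 < p) (h1 : p < 1 / 2) (hq : IsPosterior m q) (ha : a < m) (y : Bool) :
    IsPosterior m (bayesUpdate p q a y) := by
  have hn := hq.bayesNorm_pos h0 h1 ha y
  refine ⟨fun i => ?_, ?_⟩
  · refine div_pos (mul_pos ?_ (hq.pos i)) hn
    split_ifs <;> linarith
  · rw [← mul_left_inj' hn.ne', Finset.sum_mul, one_mul]
    simp_rw [hq.bayesUpdate_mul h0 h1 ha]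
    have hs : ∑ i ∈ Finset.range m, q i =
        ∑ i ∈ Finset.range (a + 1), q i + ∑ i ∈ Finset.Ico (a + 1) m, q i :=
      (Finset.sum_range_add_sum_Ico _ ha).symm
    rw [← Finset.sum_range_add_sum_Ico _ (Nat.succ_le_of_lt ha)]
    have A : ∑ i ∈ Finset.range (a + 1), (if y = decide (a < i) then 2 * (1 - p) else 2 * p) * q i
        = (if y then 2 * p else 2 * (1 - p)) * ∑ i ∈ Finset.range (a + 1), q i := by
      rw [Finset.mul_sum]
      refine Finset.sum_congr rfl fun i hi => ?_
      have : ¬ a < i := by simp at hi; omega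
      cases y <;> simp [this]
    have B : ∑ i ∈ Finset.Ico (a + 1) m, (if y = decide (a < i) then 2 * (1 - p) else 2 * p) * q i
        = (if y then 2 * (1 - p) else 2 * p) * ∑ i ∈ Finset.Ico (a + 1) m, q i := by
      rw [Finset.mul_sum]
      refine Finset.sum_congr rfl fun i hi => ?_
      have : a < i := by simp at hi; omega
      cases y <;> simp [this]
    rw [Nat.succ_eq_add_one, A, B]
    have hB : ∑ i ∈ Finset.Ico (a + 1) m, q i = 1 - ∑ i ∈ Finset.range (a + 1), q i := by
      linarith [hq.sum_eq]
    rw [hB]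
    cases y <;> simp [bayesNorm] <;> ring

/-- The normalization cancels in the odds. What remains is the likelihood under `g` over the mean
likelihood under the other intervals. These put the share `(1+x)/2` on the opposite side, `x` being
the imbalance, so doubling this mean gives `1 - (1-2p)x` for a correct response and `1 + (1-2p)x`
for a wrong one. -/
lemma odds_bayesUpdate (h0 : 0 < p) (h1 : p < 1 / 2) (hq : IsPosterior m q) (hm : 2 ≤ m)
    (hg : g < m) (ha : a < m) (y : Bool) :
    bayesUpdate p q a y g / (1 - bayesUpdate p q a y g) =
      q g / (1 - q g) * (if y = decide (a < g) then
        2 * (1 - p) / (1 - (1 - 2 * p) * imbalance q g a) else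
        2 * p / (1 + (1 - 2 * p) * imbalance q g a)) := by
  have hn := hq.bayesNorm_pos h0 h1 ha y
  have hlt := hq.lt_one hm hg
  have hx := hq.neg_one_le_imbalance hm hg ha
  have hx' := hq.imbalance_le_one (a := a) hm hg
  have e1 := one_add_mul_pos h0 h1 hx
  have e2 := one_sub_mul_pos h0 h1 hx'
  have hb := hq.bayesUpdate_mul h0 h1 ha y g
  have hxe : imbalance q g a * (1 - q g) = 2 * oppositeMass q g a - 1 + q g :=
    div_mul_cancel₀ _ (by linarith : (1 - q g) ≠ 0)
  have h3 : (1 - q g) ≠ 0 := by linarith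
  rw [← mul_div_mul_right _ _ hn.ne', sub_mul, hb, one_mul]
  split_ifs with hy
  · have : bayesNorm p q a y - 2 * (1 - p) * q g =
        (1 - q g) * (1 - (1 - 2 * p) * imbalance q g a) := by
      have : (1 - q g) * (1 - (1 - 2 * p) * imbalance q g a) =
        (1 - q g) - (1 - 2 * p) * (2 * oppositeMass q g a - 1 + q g) := by
        rw [← hxe]; ring
      rw [this, hy, bayesNorm, oppositeMass]
      by_cases h : a < g <;> simp [h] <;> ring
    rw [this]
    field_simp
  · have : bayesNorm p q a y - 2 * p * q g =
        (1 - q g) * (1 + (1 - 2 * p) * imbalance q g a) := by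
      have : (1 - q g) * (1 + (1 - 2 * p) * imbalance q g a) =
        (1 - q g) + (1 - 2 * p) * (2 * oppositeMass q g a - 1 + q g) := by
        rw [← hxe]; ring
      have hy' : y = !decide (a < g) := by cases y <;> simp_all
      rw [this, hy', bayesNorm, oppositeMass]
      by_cases h : a < g <;> simp [h] <;> ring
    rw [this]
    field_simp

lemma logOdds_bayesUpdate (h0 : 0 < p) (h1 : p < 1 / 2) (hq : IsPosterior m q) (hm : 2 ≤ m)
    (hg : g < m) (ha : a < m) (y : Bool) :
    logOdds (bayesUpdate p q a y) g = logOdds q g + (if y = decide (a < g) then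
        Real.logb 2 (2 * (1 - p)) - Real.logb 2 (1 - (1 - 2 * p) * imbalance q g a) else
        Real.logb 2 (2 * p) - Real.logb 2 (1 + (1 - 2 * p) * imbalance q g a)) := by
  have hlt := hq.lt_one hm hg
  have hx := hq.neg_one_le_imbalance hm hg ha
  have hx' := hq.imbalance_le_one (a := a) hm hg
  have e1 := one_add_mul_pos h0 h1 hx
  have e2 := one_sub_mul_pos h0 h1 hx'
  have h4 : q g / (1 - q g) ≠ 0 := (div_pos (hq.pos g) (by linarith)).ne'
  have h5 : 2 * (1 - p) ≠ 0 := by linarith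
  rw [logOdds, hq.odds_bayesUpdate h0 h1 hm hg ha, logOdds]
  split_ifs
  · rw [Real.logb_mul h4 (div_ne_zero h5 e2.ne'), Real.logb_div h5 e2.ne']
  · rw [Real.logb_mul h4 (div_ne_zero (by linarith) e1.ne'), Real.logb_div (by linarith) e1.ne']

/-- A single step increases the log-odds by a bounded amount. -/
lemma logOdds_bayesUpdate_le (h0 : 0 < p) (h1 : p < 1 / 2) (hq : IsPosterior m q) (hm : 2 ≤ m)
    (hg : g < m) (ha : a < m) (y : Bool) :
    logOdds (bayesUpdate p q a y) g ≤ logOdds q g + Real.logb 2 ((1 - p) / p) := by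
  have hx := hq.neg_one_le_imbalance hm hg ha
  have hx' := hq.imbalance_le_one (a := a) hm hg
  have h2 : Real.logb 2 (2 * p) ≤ Real.logb 2 (1 - (1 - 2 * p) * imbalance q g a) :=
    Real.logb_le_logb_of_le one_lt_two (by linarith) (by nlinarith)
  have h2' : Real.logb 2 (2 * p) ≤ Real.logb 2 (1 + (1 - 2 * p) * imbalance q g a) :=
    Real.logb_le_logb_of_le one_lt_two (by linarith) (by nlinarith)
  have h3 : Real.logb 2 (2 * p) ≤ Real.logb 2 (2 * (1 - p)) :=
    Real.logb_le_logb_of_le one_lt_two (by linarith) (by linarith)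
  have h4 : Real.logb 2 ((1 - p) / p) = Real.logb 2 (2 * (1 - p)) - Real.logb 2 (2 * p) := by
    rw [← Real.logb_div (by linarith) (by linarith), mul_div_mul_left _ _ two_ne_zero]
  rw [hq.logOdds_bayesUpdate h0 h1 hm hg ha, h4]
  split_ifs <;> linarith

end IsPosterior

/-! ### The drift of the log-odds -/

/-- The mean over the response to a query with true answer `b`. -/
def responseMean (p : ℝ) (b : Bool) (F : Bool → ℝ) : ℝ := (1 - p) * F b + p * F (!b)

lemma one_sub_entropy_eq (h0 : 0 < p) (h1 : p < 1 / 2) :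
    1 - entropy p = (1 - p) * Real.logb 2 (2 * (1 - p)) + p * Real.logb 2 (2 * p) := by
  have hl : Real.log 2 ≠ 0 := (Real.log_pos one_lt_two).ne'
  rw [entropy, Real.binEntropy, Real.logb, Real.logb, Real.log_mul two_ne_zero (by linarith),
    Real.log_mul two_ne_zero (by linarith), Real.log_inv, Real.log_inv]
  field_simp
  ring

lemma one_sub_entropy_pos {p : ℝ} (h1 : p < 1 / 2) : 0 < 1 - entropy p := by
  have hl := Real.log_pos one_lt_two
  rw [entropy, sub_pos, div_lt_one hl]
  exact Real.binEntropy_lt_log_two.2 (by norm_num; linarith)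

/-- The constants `log₂ (2(1-p))` and `log₂ (2p)` average to the channel capacity, and the two
denominators average to `rho` at minus the imbalance. -/
lemma IsPosterior.responseMean_logOdds (h0 : 0 < p) (h1 : p < 1 / 2) (hq : IsPosterior m q)
    (hm : 2 ≤ m) (hg : g < m) (ha : a < m) :
    responseMean p (decide (a < g)) (fun y => logOdds (bayesUpdate p q a y) g) =
      logOdds q g + (1 - entropy p) - rho p (-imbalance q g a) := by
  simp only [responseMean, hq.logOdds_bayesUpdate h0 h1 hm hg ha, if_true]
  rw [if_neg (by simp), one_sub_entropy_eq h0 h1, rho]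
  simp only [mul_neg, sub_neg_eq_add, ← sub_eq_add_neg]
  ring

end Bayes

/-! ### The randomized median query and its drift -/

section Query

variable {p : ℝ} {m : ℕ} {q : ℕ → ℝ} {g a : ℕ}

lemma IsPosterior.medianIndex_spec (hq : IsPosterior m q) (hm : 0 < m) :
    medianIndex q < m ∧ ∑ i ∈ Finset.range (medianIndex q), q i ≤ 1 / 2 ∧
      1 / 2 < ∑ i ∈ Finset.range (medianIndex q + 1), q i := by
  have hmem : m - 1 ∈ {j | 1 / 2 < ∑ i ∈ Finset.range (j + 1), q i} := by
    simp only [Set.mem_ofPred_eq, Nat.sub_add_cancel hm, hq.sum_eq]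
    norm_num
  have hle : medianIndex q ≤ m - 1 := Nat.sInf_le hmem
  refine ⟨by omega, ?_, Nat.sInf_mem (s := {j | 1 / 2 < ∑ i ∈ Finset.range (j + 1), q i}) ⟨_, hmem⟩⟩
  rcases Nat.eq_zero_or_pos (medianIndex q) with h | h
  · simp [h]
  · have : medianIndex q - 1 ∉ {j | 1 / 2 < ∑ i ∈ Finset.range (j + 1), q i} :=
      Nat.notMem_of_lt_sInf (by change _ < medianIndex q; omega)
    simpa [Nat.sub_add_cancel h] using this

lemma IsPosterior.tauOne_eq (hq : IsPosterior m q) (hm : 0 < m) :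
    tauOne m q = 1 - 2 * ∑ i ∈ Finset.range (medianIndex q), q i := by
  have h := Finset.sum_range_add_sum_Ico q (hq.medianIndex_spec hm).1.le
  rw [hq.sum_eq] at h
  rw [tauOne]
  linarith

lemma IsPosterior.tauOne_mem (hq : IsPosterior m q) (hm : 0 < m) :
    0 ≤ tauOne m q ∧ tauOne m q ≤ 1 := by
  rw [hq.tauOne_eq hm]
  constructor <;> linarith [(hq.medianIndex_spec hm).2.1,
    hq.sum_nonneg (Finset.range (medianIndex q))]

lemma IsPosterior.tauTwo_mem (hq : IsPosterior m q) (hm : 0 < m) :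
    0 < tauTwo q ∧ tauTwo q ≤ 1 := by
  rw [tauTwo]
  have h := hq.medianIndex_spec hm
  have := hq.sum_le_one (s := Finset.range (medianIndex q + 1)) (by simpa using h.1)
  constructor <;> linarith

lemma IsPosterior.leftProb_denom_pos (h0 : 0 < p) (h1 : p < 1 / 2) (hq : IsPosterior m q)
    (hm : 0 < m) : 0 < rho p (tauOne m q) - rho p (-tauOne m q) +
      (rho p (tauTwo q) - rho p (-tauTwo q)) := by
  obtain ⟨hs, hs'⟩ := hq.tauOne_mem hm
  obtain ⟨ht, ht'⟩ := hq.tauTwo_mem hm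
  have := rho_sub_rho_neg_pos h0 h1 ht ht'
  have := rho_mono h0 h1 (by linarith : -1 ≤ -tauOne m q) (by linarith) hs'
  linarith

lemma IsPosterior.leftProb_mem (h0 : 0 < p) (h1 : p < 1 / 2) (hq : IsPosterior m q) (hm : 0 < m) :
    0 ≤ leftProb p m q ∧ leftProb p m q ≤ 1 := by
  obtain ⟨hs, hs'⟩ := hq.tauOne_mem hm
  obtain ⟨ht, ht'⟩ := hq.tauTwo_mem hm
  have := rho_sub_rho_neg_pos h0 h1 ht ht'
  have := rho_mono h0 h1 (by linarith : -1 ≤ -tauOne m q) (by linarith) hs'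
  have hd := hq.leftProb_denom_pos h0 h1 hm
  rw [leftProb]
  exact ⟨div_nonneg (by linarith) hd.le, (div_le_one hd).2 (by linarith)⟩

/-- The probability that the query of index `medianIndex q - 1` is made. -/
noncomputable def leftWeight (p : ℝ) (m : ℕ) (q : ℕ → ℝ) : ℝ :=
  if medianIndex q = 0 then 0 else if medianIndex q + 1 = m then 1 else leftProb p m q

/-- The mean over the choice of the query. -/
noncomputable def queryMean (p : ℝ) (m : ℕ) (q : ℕ → ℝ) (F : ℕ → ℝ) : ℝ :=
  leftWeight p m q * F (medianIndex q - 1) + (1 - leftWeight p m q) * F (medianIndex q)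

lemma IsPosterior.leftWeight_mem (h0 : 0 < p) (h1 : p < 1 / 2) (hq : IsPosterior m q)
    (hm : 0 < m) : 0 ≤ leftWeight p m q ∧ leftWeight p m q ≤ 1 := by
  unfold leftWeight
  split_ifs
  · norm_num
  · norm_num
  · exact hq.leftProb_mem h0 h1 hm

lemma IsPosterior.queryMean_mono (h0 : 0 < p) (h1 : p < 1 / 2) (hq : IsPosterior m q)
    (hm : 0 < m) {F G : ℕ → ℝ} (h : ∀ a < m, F a ≤ G a) :
    queryMean p m q F ≤ queryMean p m q G := by
  obtain ⟨l0, l1⟩ := hq.leftWeight_mem h0 h1 hm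
  have hj := (hq.medianIndex_spec hm).1
  exact add_le_add (mul_le_mul_of_nonneg_left (h _ (by omega)) l0)
    (mul_le_mul_of_nonneg_left (h _ hj) (by linarith))

lemma queryMean_const (c : ℝ) : queryMean p m q (fun _ => c) = c := by
  rw [queryMean]; ring

lemma queryMean_add (F G : ℕ → ℝ) :
    queryMean p m q (fun a => F a + G a) = queryMean p m q F + queryMean p m q G := by
  simp only [queryMean]; ring

lemma queryMean_mul (c : ℝ) (F : ℕ → ℝ) :
    queryMean p m q (fun a => c * F a) = c * queryMean p m q F := by
  simp only [queryMean]; ring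

lemma queryMean_sum {ι : Type*} (s : Finset ι) (F : ι → ℕ → ℝ) :
    queryMean p m q (fun a => ∑ i ∈ s, F i a) = ∑ i ∈ s, queryMean p m q (F i) := by
  simp only [queryMean, Finset.mul_sum, Finset.sum_add_distrib]

lemma responseMean_mono (h0 : 0 < p) (h1 : p < 1 / 2) {F G : Bool → ℝ} (b : Bool)
    (h : ∀ y, F y ≤ G y) : responseMean p b F ≤ responseMean p b G :=
  add_le_add (mul_le_mul_of_nonneg_left (h _) (by linarith))
    (mul_le_mul_of_nonneg_left (h _) h0.le)

lemma responseMean_const (b : Bool) (c : ℝ) : responseMean p b (fun _ => c) = c := by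
  rw [responseMean]; ring

lemma responseMean_add (b : Bool) (F G : Bool → ℝ) :
    responseMean p b (fun a => F a + G a) = responseMean p b F + responseMean p b G := by
  simp only [responseMean]; ring

/-- The randomization between the two queries makes up for their imbalance. -/
lemma IsPosterior.queryMean_rho_nonpos (h0 : 0 < p) (h1 : p < 1 / 2) (hq : IsPosterior m q)
    (hm : 2 ≤ m) (hg : g < m) : queryMean p m q (fun a => rho p (-imbalance q g a)) ≤ 0 := by
  have hm0 : 0 < m := by omega
  obtain ⟨hj, hA, hT⟩ := hq.medianIndex_spec hm0
  obtain ⟨hs, hs'⟩ := hq.tauOne_mem hm0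
  obtain ⟨ht, ht'⟩ := hq.tauTwo_mem hm0
  have hτ1 := hq.tauOne_eq hm0
  have hτ2 : tauTwo q = 2 * ∑ i ∈ Finset.range (medianIndex q + 1), q i - 1 := rfl
  have hd := hq.leftProb_denom_pos h0 h1 hm0
  have hlt := hq.lt_one hm hg
  have hsucc : ∑ i ∈ Finset.range (medianIndex q + 1), q i =
      ∑ i ∈ Finset.range (medianIndex q), q i + q (medianIndex q) := Finset.sum_range_succ _ _
  have hx (a : ℕ) (ha : a < m) := hq.neg_one_le_imbalance hm hg ha
  have hx' (a : ℕ) := hq.imbalance_le_one (a := a) hm hg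
  rw [queryMean, leftWeight]
  split_ifs with hj0 hjm
  -- There is no left endpoint and the first interval has more than half of the mass. If it is the
  -- true one, the imbalance is `1`; otherwise the opposite mass exceeds `1/2`. The case of the last
  -- interval below is the mirror image.
  · have : 0 ≤ imbalance q g (medianIndex q) := by
      rcases Nat.lt_or_ge (medianIndex q) g with h | h
      · have := hq.le_imbalance hm hg hj
        rw [oppositeMass, if_pos h] at this
        linarith
      · have hg0 : g = 0 := by omega
        apply div_nonneg _ (by linarith)
        rw [oppositeMass, if_neg (by omega)]
        rw [hj0] at hsucc ⊢
        simp [hg0]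
        linarith [hg0 ▸ hlt]
    have := rho_nonpos h0 h1 (x := -imbalance q g (medianIndex q))
      (by linarith [hx' (medianIndex q)]) (by linarith)
    linarith
  · have hr : medianIndex q - 1 + 1 = medianIndex q := by omega
    have : 0 ≤ imbalance q g (medianIndex q - 1) := by
      rcases Nat.lt_or_ge (medianIndex q - 1) g with h | h
      · have hgj : g = medianIndex q := by omega
        apply div_nonneg _ (by linarith)
        rw [oppositeMass, if_pos h, hr, hgj]
        have : ∑ i ∈ Finset.range (medianIndex q + 1), q i = 1 := by rw [hjm, hq.sum_eq]
        have := hgj ▸ hlt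
        linarith
      · have := hq.le_imbalance hm hg (by omega : medianIndex q - 1 < m)
        rw [oppositeMass, if_neg (by omega), hr] at this
        linarith
    have := rho_nonpos h0 h1 (x := -imbalance q g (medianIndex q - 1))
      (by linarith [hx' (medianIndex q - 1)]) (by linarith)
    linarith
  · have hr : medianIndex q - 1 + 1 = medianIndex q := by omega
    set j := medianIndex q with hjdef
    set f₁ := rho p (tauOne m q) - rho p (-tauOne m q) with hf₁
    set f₂ := rho p (tauTwo q) - rho p (-tauTwo q) with hf₂
    have hf₁0 : 0 ≤ f₁ := sub_nonneg.2 (rho_mono h0 h1 (by linarith) (by linarith) hs')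
    have hf₂0 : 0 < f₂ := rho_sub_rho_neg_pos h0 h1 ht ht'
    have hl : leftProb p m q = f₂ / (f₁ + f₂) := rfl
    have hl' : 1 - f₂ / (f₁ + f₂) = f₁ / (f₁ + f₂) := by field_simp; ring
    -- Clears the common denominator of `π₁` and `1 - π₁`: the left query has weight `f₂` and the
    -- right one `f₁`.
    have red (u v : ℝ) (h : f₂ * u + f₁ * v ≤ 0) :
        leftProb p m q * u + (1 - leftProb p m q) * v ≤ 0 := by
      rw [hl, hl']
      have : f₂ / (f₁ + f₂) * u + f₁ / (f₁ + f₂) * v = (f₂ * u + f₁ * v) / (f₁ + f₂) := by ring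
      rw [this]
      exact div_nonpos_of_nonpos_of_nonneg h hd.le
    apply red
    have hxl := hx (j - 1) (by omega)
    have hxr := hx j hj
    have hxl' := hx' (j - 1)
    have hxr' := hx' j
    rcases lt_trichotomy g j with h | h | h
    -- The truth is left of the median interval. The imbalances are at least `tauOne` and `-tauTwo`,
    -- so monotonicity of `rho` leaves `f₂ * rho (-τ₁) + f₁ * rho τ₂`, which expands to the same
    -- expression as in `rho_mix_nonpos`.
    · have bl := hq.le_imbalance hm hg (by omega : j - 1 < m)
      have br := hq.le_imbalance hm hg hj
      rw [oppositeMass, if_neg (by omega), hr] at bl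
      rw [oppositeMass, if_neg (by omega)] at br
      have m1 : rho p (-imbalance q g (j - 1)) ≤ rho p (-tauOne m q) :=
        rho_mono h0 h1 (by linarith) (by linarith) (by linarith)
      have m2 : rho p (-imbalance q g j) ≤ rho p (tauTwo q) :=
        rho_mono h0 h1 (by linarith) (by linarith) (by linarith)
      have := rho_mix_nonpos h0 h1 hs hs' ht.le ht'
      nlinarith [mul_le_mul_of_nonneg_left m1 hf₂0.le, mul_le_mul_of_nonneg_left m2 hf₁0]
    -- The truth is the median interval, so its two endpoints have opposite imbalances. The sign of
    -- `tauTwo - tauOne` decides both which imbalance is nonnegative and which weight is larger, so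
    -- the favourable query gets the larger weight.
    · have hneg : imbalance q g j = -imbalance q g (j - 1) := by
        rw [imbalance, imbalance, oppositeMass, oppositeMass, if_neg (by omega), if_pos (by omega),
          hr, ← neg_div, h]
        congr 1
        linarith
      have hsgn : imbalance q g (j - 1) * (1 - q g) = (tauTwo q - tauOne m q) / 2 := by
        rw [imbalance, div_mul_cancel₀ _ (by linarith : (1 - q g) ≠ 0), oppositeMass,
          if_pos (by omega), hr, h]
        linarith
      rw [hneg, neg_neg]
      set x := imbalance q g (j - 1) with hxd
      have hsum := rho_add_rho_neg_nonpos h0 h1 hxl hxl'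
      rcases le_total 0 x with hx0 | hx0
      · have : tauOne m q ≤ tauTwo q := by
          nlinarith [mul_nonneg hx0 (by linarith : 0 ≤ 1 - q g)]
        have hf : f₁ ≤ f₂ := rho_sub_rho_neg_mono h0 h1 hs this ht'
        have hn := rho_nonpos h0 h1 (x := -x) (by linarith) (by linarith)
        linarith [mul_le_mul_of_nonpos_right hf hn,
          mul_le_mul_of_nonneg_left (by linarith : rho p x ≤ -rho p (-x)) hf₁0]
      · have : tauTwo q ≤ tauOne m q := by
          nlinarith [mul_nonneg (neg_nonneg.2 hx0) (by linarith : 0 ≤ 1 - q g)]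
        have hf : f₂ ≤ f₁ := rho_sub_rho_neg_mono h0 h1 ht.le this hs'
        have hn := rho_nonpos h0 h1 (x := x) (by linarith) (by linarith)
        linarith [mul_le_mul_of_nonpos_right hf hn,
          mul_le_mul_of_nonneg_left (by linarith : rho p (-x) ≤ -rho p x) hf₂0.le]
    · have bl := hq.le_imbalance hm hg (by omega : j - 1 < m)
      have br := hq.le_imbalance hm hg hj
      rw [oppositeMass, if_pos (by omega), hr] at bl
      rw [oppositeMass, if_pos (by omega)] at br
      have m1 : rho p (-imbalance q g (j - 1)) ≤ rho p (tauOne m q) :=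
        rho_mono h0 h1 (by linarith) (by linarith) (by linarith)
      have m2 : rho p (-imbalance q g j) ≤ rho p (-tauTwo q) :=
        rho_mono h0 h1 (by linarith) (by linarith) (by linarith)
      have := rho_mix_nonpos h0 h1 hs hs' ht.le ht'
      nlinarith [mul_le_mul_of_nonneg_left m1 hf₂0.le, mul_le_mul_of_nonneg_left m2 hf₁0]

/-- The mean change of the log-odds of the true interval is at least the capacity. -/
lemma IsPosterior.logOdds_drift (h0 : 0 < p) (h1 : p < 1 / 2) (hq : IsPosterior m q)
    (hm : 2 ≤ m) (hg : g < m) :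
    logOdds q g + (1 - entropy p) ≤ queryMean p m q fun a =>
      responseMean p (decide (a < g)) fun y => logOdds (bayesUpdate p q a y) g := by
  have hj := (hq.medianIndex_spec (by omega)).1
  have := hq.queryMean_rho_nonpos h0 h1 hm hg
  rw [queryMean] at this ⊢
  rw [hq.responseMean_logOdds h0 h1 hm hg (by omega), hq.responseMean_logOdds h0 h1 hm hg hj]
  nlinarith

/-! ### The error probability of a search -/

open Classical in
/-- The probability that a search from the posterior `q`, with true interval `g`, stops within `k`
queries at a wrong interval. -/
noncomputable def searchError (p : ℝ) (m : ℕ) (ε : ℝ) : ℕ → (ℕ → ℝ) → ℕ → ℝ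
  | 0, _, _ => 0
  | k + 1, q, g => queryMean p m q fun a => responseMean p (decide (a < g)) fun y =>
      if SearchDone m ε (bayesUpdate p q a y) then
        if argmaxIndex m (bayesUpdate p q a y) = g then 0 else 1
      else searchError p m ε k (bayesUpdate p q a y) g

lemma responseMean_nonneg (h0 : 0 < p) (h1 : p < 1 / 2) {F : Bool → ℝ} (b : Bool)
    (h : ∀ y, 0 ≤ F y) : 0 ≤ responseMean p b F := by
  simpa [responseMean_const] using responseMean_mono h0 h1 b h

lemma searchError_nonneg (h0 : 0 < p) (h1 : p < 1 / 2) (hm : 0 < m) (ε : ℝ) (k : ℕ)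
    (hq : IsPosterior m q) (g : ℕ) : 0 ≤ searchError p m ε k q g := by
  induction k generalizing q with
  | zero => exact le_rfl
  | succ k ih =>
    rw [searchError]
    refine (queryMean_const (p := p) (m := m) (q := q) 0).symm.trans_le <|
      hq.queryMean_mono h0 h1 hm fun a ha => responseMean_nonneg h0 h1 _ fun y => ?_
    split_ifs
    · exact le_rfl
    · exact zero_le_one
    · exact ih (hq.bayes h0 h1 ha y)

/-- Needed because in the error potential the horizon of the later searches drops along with that of
the current one. -/
lemma searchError_le_succ (h0 : 0 < p) (h1 : p < 1 / 2) (hm : 0 < m) (ε : ℝ) (k : ℕ)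
    (hq : IsPosterior m q) (g : ℕ) : searchError p m ε k q g ≤ searchError p m ε (k + 1) q g := by
  induction k generalizing q with
  | zero => exact searchError_nonneg h0 h1 hm ε _ hq g
  | succ k ih =>
    rw [searchError, searchError]
    refine hq.queryMean_mono h0 h1 hm fun a ha => responseMean_mono h0 h1 _ fun y => ?_
    split_ifs
    · exact le_rfl
    · exact le_rfl
    · exact ih (hq.bayes h0 h1 ha y)

lemma IsPosterior.argmaxIndex_spec (hm : 0 < m) :
    argmaxIndex m q < m ∧ ∀ j < m, q j ≤ q (argmaxIndex m q) := by
  obtain ⟨i, hi, hmax⟩ := (Finset.range m).exists_max_image q ⟨0, by simpa⟩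
  exact Nat.sInf_mem (s := {i | i < m ∧ ∀ j < m, q j ≤ q i})
    ⟨i, by simpa using hi, fun j hj => hmax j (by simpa)⟩

/-- Odds of at least `1/ε` for some `i` mean `1 - q i ≤ ε * q i ≤ ε`, and the largest posterior is
at least `q i`. -/
lemma IsPosterior.one_sub_argmax_le {ε : ℝ} (hε : 0 < ε) (hq : IsPosterior m q) (hm : 2 ≤ m)
    (hd : SearchDone m ε q) : 1 - q (argmaxIndex m q) ≤ ε := by
  obtain ⟨i, hi, h⟩ := hd
  have h1 := hq.lt_one hm hi
  have h2 := hq.pos i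
  have hp : 0 < q i / (1 - q i) := div_pos h2 (by linarith)
  rw [← Real.logb_inv, Real.logb_le_logb one_lt_two (inv_pos.2 hε) hp,
    le_div_iff₀ (by linarith), inv_mul_le_iff₀ hε] at h
  have := (IsPosterior.argmaxIndex_spec (q := q) (by omega : 0 < m)).2 i hi
  nlinarith

/-- Bayes' rule exchanges the mean over the response given the truth and over the truth. -/
lemma IsPosterior.sum_mul_responseMean (h0 : 0 < p) (h1 : p < 1 / 2) (hq : IsPosterior m q)
    (ha : a < m) (F : Bool → ℕ → ℝ) :
    ∑ g ∈ Finset.range m, q g * responseMean p (decide (a < g)) (fun y => F y g) =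
      bayesNorm p q a true / 2 * ∑ g ∈ Finset.range m, bayesUpdate p q a true g * F true g +
      bayesNorm p q a false / 2 *
        ∑ g ∈ Finset.range m, bayesUpdate p q a false g * F false g := by
  rw [Finset.mul_sum, Finset.mul_sum, ← Finset.sum_add_distrib]
  refine Finset.sum_congr rfl fun g _ => ?_
  have et := hq.bayesUpdate_mul h0 h1 ha true g
  have ef := hq.bayesUpdate_mul h0 h1 ha false g
  have : bayesNorm p q a true / 2 * (bayesUpdate p q a true g * F true g) +
      bayesNorm p q a false / 2 * (bayesUpdate p q a false g * F false g) =
      (bayesUpdate p q a true g * bayesNorm p q a true) * F true g / 2 +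
      (bayesUpdate p q a false g * bayesNorm p q a false) * F false g / 2 := by ring
  rw [this, et, ef, responseMean]
  by_cases h : a < g <;> simp [h] <;> ring

/-- If the true interval is distributed according to the posterior, the search errs with
probability at most `ε`. -/
lemma IsPosterior.sum_mul_searchError_le (h0 : 0 < p) (h1 : p < 1 / 2) (hm : 2 ≤ m) {ε : ℝ}
    (hε : 0 < ε) (k : ℕ) (hq : IsPosterior m q) :
    ∑ g ∈ Finset.range m, q g * searchError p m ε k q g ≤ ε := by
  classical
  induction k generalizing q with
  | zero => simpa [searchError] using hε.le
  | succ k ih =>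
    simp only [searchError]
    simp_rw [← queryMean_mul]
    rw [← queryMean_sum]
    refine le_of_le_of_eq (hq.queryMean_mono h0 h1 (by omega) (G := fun _ => ε) fun a ha => ?_)
      (queryMean_const _)
    have key (y : Bool) : ∑ g ∈ Finset.range m, bayesUpdate p q a y g *
        (if SearchDone m ε (bayesUpdate p q a y) then
          if argmaxIndex m (bayesUpdate p q a y) = g then 0 else 1
        else searchError p m ε k (bayesUpdate p q a y) g) ≤ ε := by
      have hq' := hq.bayes h0 h1 ha y
      by_cases hd : SearchDone m ε (bayesUpdate p q a y)
      -- The search stops: the sum is the posterior mass off the reported interval.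
      · have hmem : argmaxIndex m (bayesUpdate p q a y) ∈ Finset.range m := by
          simpa using (IsPosterior.argmaxIndex_spec (by omega)).1
        simp only [if_pos hd]
        refine le_trans (le_of_eq ?_) (hq'.one_sub_argmax_le hε hm hd)
        have hs := Finset.sum_erase_add _ (bayesUpdate p q a y) hmem
        rw [hq'.sum_eq] at hs
        rw [sub_eq_of_eq_add hs.symm, ← Finset.sum_erase_add _ _ hmem]
        simp only [if_true, mul_zero, add_zero]
        refine Finset.sum_congr rfl fun g hg => ?_
        rw [if_neg (Finset.ne_of_mem_erase hg).symm, mul_one]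
      · simp only [if_neg hd]
        exact ih hq'
    rw [hq.sum_mul_responseMean h0 h1 ha (fun y g => if SearchDone m ε (bayesUpdate p q a y) then
          if argmaxIndex m (bayesUpdate p q a y) = g then 0 else 1
        else searchError p m ε k (bayesUpdate p q a y) g)]
    -- Half of each norm is the predictive probability of that response, so the bound `ε` is
    -- averaged with weights of sum one.
    have hsum : bayesNorm p q a true + bayesNorm p q a false = 2 := by
      simp [bayesNorm]; ring
    have ht := hq.bayesNorm_pos h0 h1 ha true
    have hf := hq.bayesNorm_pos h0 h1 ha false
    have := mul_le_mul_of_nonneg_left (key true) (by linarith : 0 ≤ bayesNorm p q a true / 2)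
    have := mul_le_mul_of_nonneg_left (key false) (by linarith : 0 ≤ bayesNorm p q a false / 2)
    nlinarith

end Query

/-! ### Ranks in a uniformly random order -/

section Rank

variable {n : ℕ}

/-- The number of earlier elements that are smaller than the `j`-th. -/
noncomputable def insertionRank (f : Fin n → ℝ) (j : Fin n) : ℕ :=
  (Finset.univ.filter fun i => i < j ∧ f i < f j).card

/-- After the swap, position `j` carries the value `f i`, while the positions up to `j` carry the
same set of values as before. -/
lemma insertionRank_comp_swap (f : Fin n → ℝ) {i j : Fin n} (hij : i ≤ j) :
    insertionRank (f ∘ Equiv.swap i j) j = ((Finset.Iic j).filter fun l => f l < f i).card := by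
  classical
  rw [insertionRank, ← Finset.card_map (Equiv.swap i j).toEmbedding]
  congr 1
  ext l
  simp only [Finset.mem_map_equiv, Equiv.symm_swap, Finset.mem_filter, Finset.mem_univ, true_and,
    Function.comp_apply, Equiv.swap_apply_self, Equiv.swap_apply_right, Finset.mem_Iic]
  refine and_congr_left fun hl => ?_
  have hli : l ≠ i := fun h => by simp [h] at hl
  by_cases hlj : l = j
  · subst hlj
    simpa using lt_of_le_of_ne hij hli.symm
  · rw [Equiv.swap_apply_of_ne_of_ne hli hlj]
    exact ⟨le_of_lt, fun h => lt_of_le_of_ne h hlj⟩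

/-- Ranks within `Iic j` are distinct for distinct values and lie below `j + 1`, so by counting they
take each value in `range (j + 1)` exactly once. -/
lemma sum_rank_Iic {f : Fin n → ℝ} (hf : Function.Injective f) (j : Fin n) (F : ℕ → ℝ) :
    ∑ i ∈ Finset.Iic j, F ((Finset.Iic j).filter fun l => f l < f i).card =
      ∑ g ∈ Finset.range (j + 1), F g := by
  have hlt : ∀ i ∈ Finset.Iic j, ∀ i', f i < f i' →
      ((Finset.Iic j).filter fun l => f l < f i).card <
      ((Finset.Iic j).filter fun l => f l < f i').card := by
    intro i hi i' h
    refine Finset.card_lt_card (Finset.ssubset_iff_of_subset ?_ |>.2 ⟨i, ?_, ?_⟩)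
    · exact Finset.monotone_filter_right _ fun l _ hl => lt_trans hl h
    · exact Finset.mem_filter.2 ⟨hi, h⟩
    · simp
  have hinj : Set.InjOn (fun i => ((Finset.Iic j).filter fun l => f l < f i).card)
      (Finset.Iic j : Finset (Fin n)) := by
    intro i hi i' hi' h
    by_contra hne
    rcases lt_or_gt_of_ne (hf.ne hne) with h' | h'
    · exact (hlt i hi i' h').ne h
    · exact (hlt i' hi' i h').ne' h
  rw [← Finset.sum_image (f := F) hinj]
  congr 1
  refine Finset.eq_of_subset_of_card_le ?_ ?_
  · intro g hg
    obtain ⟨i, hi, rfl⟩ := Finset.mem_image.1 hg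
    rw [Finset.mem_range]
    rw [← Fin.card_Iic j]
    exact Finset.card_lt_card (Finset.filter_ssubset.2 ⟨i, hi, lt_irrefl _⟩)
  · rw [Finset.card_image_of_injOn hinj, Fin.card_Iic, Finset.card_range]

/-- In a uniformly random order, the rank of an element among its predecessors is uniform. -/
lemma sum_perm_insertionRank {f : Fin n → ℝ} (hf : Function.Injective f) (j : Fin n)
    (F : ℕ → ℝ) :
    (j + 1 : ℝ) * ∑ v : Equiv.Perm (Fin n), F (insertionRank (f ∘ v) j) =
      Fintype.card (Equiv.Perm (Fin n)) * ∑ g ∈ Finset.range (j + 1), F g := by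
  calc (j + 1 : ℝ) * ∑ v : Equiv.Perm (Fin n), F (insertionRank (f ∘ v) j)
      = ∑ i ∈ Finset.Iic j, ∑ v : Equiv.Perm (Fin n), F (insertionRank (f ∘ v) j) := by
        rw [Finset.sum_const, Fin.card_Iic, nsmul_eq_mul]
        push_cast
        rfl
    _ = ∑ i ∈ Finset.Iic j, ∑ v : Equiv.Perm (Fin n),
          F ((Finset.Iic j).filter fun l => (f ∘ v) l < (f ∘ v) i).card := by
        -- For fixed `i`, composing `v` with the transposition of `i` and `j` permutes the summands
        -- and turns the rank at `j` into the rank at `i` among the positions up to `j`.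
        refine Finset.sum_congr rfl fun i hi => ?_
        rw [← Equiv.sum_comp (Equiv.mulRight (Equiv.swap i j))]
        refine Finset.sum_congr rfl fun v _ => ?_
        rw [← insertionRank_comp_swap (f ∘ v) (Finset.mem_Iic.1 hi)]
        rfl
    _ = ∑ v : Equiv.Perm (Fin n), ∑ g ∈ Finset.range (j + 1), F g := by
        rw [Finset.sum_comm]
        exact Finset.sum_congr rfl fun v _ => sum_rank_Iic (hf.comp v.injective) j F
    _ = _ := by rw [Finset.sum_const, nsmul_eq_mul, Finset.card_univ]

end Rank

/-! ### Insertion into a sorted list -/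

section SortedList

variable {α : Type*} {θ : α → ℝ}

/-- The number of list elements below `t`. -/
noncomputable def gapIndex (θ : α → ℝ) (l : List α) (t : α) : ℕ :=
  l.countP fun x => decide (θ x < θ t)

lemma gapIndex_le (l : List α) (t : α) : gapIndex θ l t ≤ l.length := List.countP_le_length

lemma gapIndex_perm {l l' : List α} (h : l.Perm l') (t : α) : gapIndex θ l t = gapIndex θ l' t :=
  h.countP_eq _

lemma gapIndex_cons_of_not {x t : α} {l : List α} (h : (x :: l).Pairwise fun a b => θ a < θ b)
    (hx : ¬ θ x < θ t) : gapIndex θ (x :: l) t = 0 := by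
  rw [gapIndex, List.countP_eq_zero]
  intro y hy
  rw [List.pairwise_cons] at h
  rcases List.mem_cons.1 hy with rfl | hy
  · simpa using hx
  · simpa using (not_lt.1 hx).trans (h.1 y hy).le

lemma gapIndex_cons_of_lt {x t : α} {l : List α} (hx : θ x < θ t) :
    gapIndex θ (x :: l) t = gapIndex θ l t + 1 := by
  rw [gapIndex, List.countP_cons_of_pos (by simpa using hx), gapIndex]

/-- The link between sorting and searching: in a sorted list, a comparison with the element of index
`a` asks whether the true gap lies to the right of `a`. -/
lemma getElem_lt_iff_lt_gapIndex {l : List α} (h : l.Pairwise fun a b => θ a < θ b) (t : α) {a : ℕ}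
    (ha : a < l.length) : θ l[a] < θ t ↔ a < gapIndex θ l t := by
  induction l generalizing a with
  | nil => simp at ha
  | cons x l ih =>
    by_cases hx : θ x < θ t
    · rw [gapIndex_cons_of_lt hx]
      cases a with
      | zero => simpa using hx
      | succ a => simpa using ih h.of_cons (by simpa using ha)
    · rw [gapIndex_cons_of_not h hx]
      cases a with
      | zero => simpa using hx
      | succ a =>
        have ha' : a < l.length := by simpa using ha
        have := (List.pairwise_cons.1 h).1 l[a] (List.getElem_mem _)
        simp only [List.getElem_cons_succ, Nat.not_lt_zero, iff_false, not_lt]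
        exact (not_lt.1 hx).trans this.le

lemma pairwise_insertIdx_gapIndex {l : List α} (h : l.Pairwise fun a b => θ a < θ b) {t : α}
    (ht : ∀ x ∈ l, θ x ≠ θ t) :
    (l.insertIdx (gapIndex θ l t) t).Pairwise fun a b => θ a < θ b := by
  induction l with
  | nil => simp [gapIndex]
  | cons x l ih =>
    have hc := List.pairwise_cons.1 h
    by_cases hx : θ x < θ t
    · rw [gapIndex_cons_of_lt hx, List.insertIdx_succ_cons, List.pairwise_cons]
      refine ⟨fun y hy => ?_, ih hc.2 fun y hy => ht y (List.mem_cons_of_mem _ hy)⟩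
      rcases List.mem_cons.1 (List.insertIdx_subset_cons _ _ _ hy) with rfl | hy
      · exact hx
      · exact hc.1 y hy
    · rw [gapIndex_cons_of_not h hx, List.insertIdx_zero, List.pairwise_cons]
      have hxt : θ t < θ x := lt_of_le_of_ne (not_lt.1 hx) (ht x (by simp)).symm
      refine ⟨fun y hy => ?_, h⟩
      rcases List.mem_cons.1 hy with rfl | hy
      · exact hxt
      · exact hxt.trans (hc.1 y hy)

end SortedList

/-! ### Valid states of the insertion sort -/

namespace InsertionState

variable {n : ℕ} {p ε : ℝ} {S : InsertionState n}

open Classical in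
/-- The state after the response `y` to the query of the list element of index `a`. -/
noncomputable def respond (p ε : ℝ) (S : InsertionState n) (a : ℕ) (y : Bool) :
    InsertionState n :=
  match S.pending with
  | [] => S
  | t :: rest =>
    if SearchDone (S.sorted.length + 1) ε (bayesUpdate p S.posterior a y) then
      ⟨S.sorted.insertIdx (argmaxIndex (S.sorted.length + 1) (bayesUpdate p S.posterior a y)) t,
        rest, uniformPrior (S.sorted.length + 1 + 1)⟩
    else ⟨S.sorted, t :: rest, bayesUpdate p S.posterior a y⟩

lemma step_eq_respond (o : Query n × Bool) :
    step p ε S o = respond p ε S (S.sorted.idxOf o.1.1.1) o.2 := rfl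

lemma respond_of_done {a : ℕ} {y : Bool} {t : Fin n} {rest : List (Fin n)}
    (hS : S.pending = t :: rest)
    (hd : SearchDone (S.sorted.length + 1) ε (bayesUpdate p S.posterior a y)) :
    respond p ε S a y =
      ⟨S.sorted.insertIdx (argmaxIndex (S.sorted.length + 1) (bayesUpdate p S.posterior a y)) t,
        rest, uniformPrior (S.sorted.length + 1 + 1)⟩ := by
  simp only [respond, hS, if_pos hd]

lemma respond_of_not_done {a : ℕ} {y : Bool} {t : Fin n} {rest : List (Fin n)}
    (hS : S.pending = t :: rest)
    (hd : ¬ SearchDone (S.sorted.length + 1) ε (bayesUpdate p S.posterior a y)) :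
    respond p ε S a y = ⟨S.sorted, t :: rest, bayesUpdate p S.posterior a y⟩ := by
  simp only [respond, hS, if_neg hd]

/-- The invariants of the states of the algorithm. -/
structure Valid (ε : ℝ) (S : InsertionState n) : Prop where
  perm : (S.sorted ++ S.pending).Perm (List.finRange n)
  ne_nil : S.sorted ≠ []
  isPosterior : IsPosterior (S.sorted.length + 1) S.posterior
  not_done : ¬ SearchDone (S.sorted.length + 1) ε S.posterior

/-- Uniform odds are `1/(m-1) ≤ 1`, below the threshold `1/ε > 1`. A fresh search is thus never
finished already, which keeps the invariant `not_done` after an insertion. -/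
lemma not_searchDone_uniformPrior {ε : ℝ} (hε : 0 < ε) (hε1 : ε < 1) {m : ℕ} (hm : 2 ≤ m) :
    ¬ SearchDone m ε (uniformPrior m) := by
  rintro ⟨i, _, h⟩
  have hneg := Real.logb_neg one_lt_two hε hε1
  have hm' : (2 : ℝ) ≤ m := by exact_mod_cast hm
  have hm1 : (1 : ℝ) / m ≤ 1 / 2 := by gcongr
  have hm2 : (0 : ℝ) < 1 / m := by positivity
  have : Real.logb 2 (uniformPrior m i / (1 - uniformPrior m i)) ≤ 0 := by
    apply Real.logb_nonpos one_lt_two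
    · exact div_nonneg hm2.le (by simp only [uniformPrior]; linarith)
    · simp only [uniformPrior]
      rw [div_le_one (by linarith)]
      linarith
  linarith

lemma valid_init (hn : 0 < n) (hε : 0 < ε) (hε1 : ε < 1) (r : Equiv.Perm (Fin n)) :
    Valid ε (init r) := by
  have hl : (init r).sorted.length = 1 := by
    simp [init]; omega
  refine ⟨?_, ?_, ?_, ?_⟩
  · simp only [init, List.take_append_drop]
    rw [List.perm_ext_iff_of_nodup]
    · simp
      exact fun a => ⟨r.symm a, by simp⟩
    · exact ((List.nodup_reverse.2 (List.nodup_finRange n)).map r.injective)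
    · exact List.nodup_finRange n
  · intro h
    simp [h] at hl
  · rw [hl]
    exact isPosterior_uniformPrior (by norm_num)
  · rw [hl]
    exact not_searchDone_uniformPrior hε hε1 le_rfl

namespace Valid

lemma two_le (hS : Valid ε S) : 2 ≤ S.sorted.length + 1 := by
  have := List.length_pos_iff.2 hS.ne_nil
  omega

lemma nodup (hS : Valid ε S) : (S.sorted ++ S.pending).Nodup :=
  hS.perm.nodup_iff.2 (List.nodup_finRange n)

lemma nodup_sorted (hS : Valid ε S) : S.sorted.Nodup := (List.nodup_append.1 hS.nodup).1

lemma length_add (hS : Valid ε S) : S.sorted.length + S.pending.length = n := by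
  simpa using hS.perm.length_eq

lemma ne_of_mem (hS : Valid ε S) {t : Fin n} {rest : List (Fin n)} (hp : S.pending = t :: rest)
    {x : Fin n} (hx : x ∈ S.sorted) : x ≠ t := by
  have := (List.nodup_append.1 hS.nodup).2.2 x hx t (by simp [hp])
  exact this

lemma respond (h0 : 0 < p) (h1 : p < 1 / 2) (hε : 0 < ε) (hε1 : ε < 1) (hS : Valid ε S) {a : ℕ}
    (ha : a < S.sorted.length + 1) (y : Bool) : Valid ε (respond p ε S a y) := by
  rcases hp : S.pending with _ | ⟨t, rest⟩
  · simpa only [InsertionState.respond, hp] using hS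
  by_cases hd : SearchDone (S.sorted.length + 1) ε (bayesUpdate p S.posterior a y)
  · rw [respond_of_done hp hd]
    have hm : argmaxIndex (S.sorted.length + 1) (bayesUpdate p S.posterior a y) ≤
        S.sorted.length :=
      Nat.lt_succ_iff.1 (IsPosterior.argmaxIndex_spec (Nat.succ_pos _)).1
    have hlen := List.length_insertIdx_of_le_length hm t
    refine ⟨?_, ?_, ?_, ?_⟩
    · refine ((List.perm_insertIdx t S.sorted hm).append_right rest).trans ?_
      refine List.Perm.trans ?_ hS.perm
      rw [hp, List.cons_append]
      exact List.perm_middle.symm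
    · exact List.ne_nil_of_length_pos (by simp only; omega)
    · rw [hlen]
      exact isPosterior_uniformPrior (Nat.succ_pos _)
    · rw [hlen]
      exact not_searchDone_uniformPrior hε hε1 (by omega)
  · rw [respond_of_not_done hp hd]
    exact ⟨hp ▸ hS.perm, hS.ne_nil, hS.isPosterior.bayes h0 h1 ha y, hd⟩

lemma step (h0 : 0 < p) (h1 : p < 1 / 2) (hε : 0 < ε) (hε1 : ε < 1) (hS : Valid ε S)
    (o : Query n × Bool) : Valid ε (step p ε S o) := by
  rw [step_eq_respond]
  exact hS.respond h0 h1 hε hε1 (Nat.lt_succ_of_le List.idxOf_le_length) o.2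

lemma queryIndex_lt (hS : Valid ε S) (u : ℝ) :
    queryIndex p (S.sorted.length + 1) S.posterior u < S.sorted.length := by
  have := (hS.isPosterior.medianIndex_spec (Nat.succ_pos _)).1
  have h2 := hS.two_le
  unfold queryIndex
  split_ifs with h
  · omega
  · have : ¬ (medianIndex S.posterior ≠ 0 ∧ medianIndex S.posterior + 1 = S.sorted.length + 1) :=
      fun h' => h ⟨h'.1, Or.inl h'.2⟩
    omega

lemma nextQuery_eq (hS : Valid ε S) {t : Fin n} {rest : List (Fin n)}
    (hp : S.pending = t :: rest) (u : ℝ) :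
    nextQuery p S u = some ⟨(S.sorted[queryIndex p (S.sorted.length + 1) S.posterior u]'
      (hS.queryIndex_lt u), t), hS.ne_of_mem hp (List.getElem_mem _)⟩ := by
  have hne := hS.ne_of_mem hp (List.getElem_mem (hS.queryIndex_lt (p := p) u))
  simp only [nextQuery, hp, List.getElem?_eq_getElem (hS.queryIndex_lt (p := p) u), dif_pos hne]

lemma nextQuery_eq_none_iff (hS : Valid ε S) (u : ℝ) :
    nextQuery p S u = none ↔ S.pending = [] := by
  rcases hp : S.pending with _ | ⟨t, rest⟩
  · simp [nextQuery, hp]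
  · simp [hS.nextQuery_eq hp]

/-- Two strictly sorted lists that are permutations of each other coincide, and a permutation is
determined by its list of values, so the choice in `toPerm` is forced. -/
lemma toPerm_eq (hS : Valid ε S) (hp : S.pending = []) {θ : Fin n → ℝ}
    (hs : S.sorted.Pairwise fun a b => θ a < θ b) {π : Equiv.Perm (Fin n)}
    (hπ : StrictMono (θ ∘ π)) : S.toPerm = π := by
  have hperm : S.sorted.Perm (List.finRange n) := by simpa [hp] using hS.perm
  have hofFn : ∀ e : Equiv.Perm (Fin n), (List.ofFn e).Perm (List.finRange n) := fun e => by
    rw [List.perm_ext_iff_of_nodup (List.nodup_ofFn.2 e.injective) (List.nodup_finRange n)]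
    simp [List.mem_ofFn]
    exact fun a => ⟨e.symm a, by simp⟩
  have hπs : (List.ofFn π).Pairwise fun a b => θ a < θ b := by
    rw [List.pairwise_ofFn]
    exact fun i j hij => hπ hij
  have heq : List.ofFn π = S.sorted := by
    refine List.Perm.eq_of_pairwise (le := fun a b => θ a < θ b) ?_ hπs hs
      ((hofFn π).trans hperm.symm)
    exact fun a b _ _ h h' => absurd h (lt_asymm h')
  have h : ∃ e : Equiv.Perm (Fin n), List.ofFn e = S.sorted := ⟨π, heq⟩
  rw [toPerm, dif_pos h]
  have := h.choose_spec.trans heq.symm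
  exact Equiv.ext fun i => congrFun (List.ofFn_injective this) i

end Valid

lemma valid_after (h0 : 0 < p) (h1 : p < 1 / 2) (hε : 0 < ε) (hε1 : ε < 1) (hn : 0 < n)
    (r : Equiv.Perm (Fin n)) (h : History n) : Valid ε (after p ε r h) := by
  induction h with
  | nil => exact valid_init hn hε hε1 r
  | cons o h ih => exact ih.step h0 h1 hε hε1 o

/-- A list that is not sorted stays so. -/
lemma pairwise_of_pairwise_respond {θ : Fin n → ℝ} {a : ℕ} {y : Bool}
    (h : (respond p ε S a y).sorted.Pairwise fun a b => θ a < θ b) :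
    S.sorted.Pairwise fun a b => θ a < θ b := by
  rcases hp : S.pending with _ | ⟨t, rest⟩
  · simpa only [respond, hp] using h
  by_cases hd : SearchDone (S.sorted.length + 1) ε (bayesUpdate p S.posterior a y)
  · rw [respond_of_done hp hd] at h
    exact h.sublist (List.sublist_insertIdx _ _ _)
  · rwa [respond_of_not_done hp hd] at h

end InsertionState

/-! ### Runs of a code -/

instance instMeasurableSpaceHistory (n : ℕ) : MeasurableSpace (History n) := ⊤

instance instDiscreteMeasurableSpaceHistory (n : ℕ) : DiscreteMeasurableSpace (History n) :=
  ⟨fun _ => trivial⟩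

instance instMeasurableSpaceOptionQuery (n : ℕ) : MeasurableSpace (Option (Query n)) := ⊤

instance instDiscreteMeasurableSpaceOptionQuery (n : ℕ) :
    DiscreteMeasurableSpace (Option (Query n)) := ⟨fun _ => trivial⟩

instance instDiscreteMeasurableSpacePermFin (n : ℕ) :
    DiscreteMeasurableSpace (Equiv.Perm (Fin n)) := ⟨fun _ => trivial⟩

instance isProbabilityMeasure_noiseLaw (p : unitInterval) : IsProbabilityMeasure (noiseLaw p) := by
  unfold noiseLaw; infer_instance

namespace SortingCode

variable {n : ℕ} (c : SortingCode n) (θ : Fin n → ℝ)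

instance isProbabilityMeasure_runLaw (p : unitInterval) (c : SortingCode n) :
    IsProbabilityMeasure (c.runLaw p) := by
  unfold runLaw; infer_instance

/-- The code has stopped at time `k`. -/
def StoppedAt (ω : c.Seed × (ℕ → Bool)) (k : ℕ) : Prop :=
  c.next ω.1 (c.history θ ω.1 ω.2 k) = none

variable {c θ}

lemma history_succ_of_none {s : c.Seed} {z : ℕ → Bool} {k : ℕ}
    (h : c.next s (c.history θ s z k) = none) :
    c.history θ s z (k + 1) = c.history θ s z k := by
  simp only [history, h]

lemma history_succ_of_some {s : c.Seed} {z : ℕ → Bool} {k : ℕ} {q : Query n}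
    (h : c.next s (c.history θ s z k) = some q) :
    c.history θ s z (k + 1) =
      (q, xor (decide (θ q.1.1 < θ q.1.2)) (z k)) :: c.history θ s z k := by
  simp only [history, h]

lemma history_of_stoppedAt {ω : c.Seed × (ℕ → Bool)} {k j : ℕ} (h : c.StoppedAt θ ω k)
    (hkj : k ≤ j) : c.history θ ω.1 ω.2 j = c.history θ ω.1 ω.2 k := by
  induction j, hkj using Nat.le_induction with
  | base => rfl
  | succ j _ ih => rw [history_succ_of_none (by rw [ih]; exact h), ih]

lemma StoppedAt.mono {ω : c.Seed × (ℕ → Bool)} {k j : ℕ} (h : c.StoppedAt θ ω k) (hkj : k ≤ j) :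
    c.StoppedAt θ ω j := by
  rw [StoppedAt, history_of_stoppedAt h hkj]
  exact h

lemma length_history_le (s : c.Seed) (z : ℕ → Bool) (k : ℕ) :
    (c.history θ s z k).length ≤ k := by
  induction k with
  | zero => simp [history]
  | succ k ih =>
    rcases hq : c.next s (c.history θ s z k) with _ | q
    · rw [history_succ_of_none hq]; omega
    · rw [history_succ_of_some hq, List.length_cons]; omega

lemma length_history_of_not_stoppedAt {ω : c.Seed × (ℕ → Bool)} {k : ℕ}
    (h : ¬ c.StoppedAt θ ω k) : (c.history θ ω.1 ω.2 k).length = k := by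
  induction k with
  | zero => simp [history]
  | succ k ih =>
    have hk : ¬ c.StoppedAt θ ω k := fun h' => h (h'.mono k.le_succ)
    obtain ⟨q, hq⟩ := Option.ne_none_iff_exists'.1 hk
    rw [history_succ_of_some hq, List.length_cons, ih hk]

/-- There are only countably many histories, so measurability in the seed for each fixed history
suffices. -/
lemma measurable_next (c : SortingCode n) :
    Measurable fun x : c.Seed × History n => c.next x.1 x.2 := by
  refine measurable_from_prod_countable_left fun h => ?_
  refine measurable_to_countable' fun a => ?_
  exact c.measurableSet_next h a

lemma measurable_history (k : ℕ) :
    Measurable fun ω : c.Seed × (ℕ → Bool) => c.history θ ω.1 ω.2 k := by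
  induction k with
  | zero => exact measurable_const
  | succ k ih =>
    have h1 : Measurable fun ω : c.Seed × (ℕ → Bool) =>
        (c.next ω.1 (c.history θ ω.1 ω.2 k), c.history θ ω.1 ω.2 k, ω.2 k) :=
      (c.measurable_next.comp (measurable_fst.prodMk ih)).prodMk
        (ih.prodMk ((measurable_pi_apply k).comp measurable_snd))
    have h2 : Measurable fun x : Option (Query n) × History n × Bool =>
        match x.1 with
        | none => x.2.1
        | some q => (q, xor (decide (θ q.1.1 < θ q.1.2)) x.2.2) :: x.2.1 :=
      measurable_of_countable _
    exact h2.comp h1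

lemma measurableSet_stoppedAt (k : ℕ) :
    MeasurableSet {ω : c.Seed × (ℕ → Bool) | c.StoppedAt θ ω k} :=
  (c.measurable_next.comp (measurable_fst.prodMk (measurable_history k)))
    (measurableSet_singleton none)

lemma measurable_estimate (c : SortingCode n) :
    Measurable fun x : c.Seed × History n => c.estimate x.1 x.2 := by
  refine measurable_from_prod_countable_left fun h => ?_
  refine measurable_to_countable' fun a => ?_
  exact c.measurableSet_estimate h a

lemma measurableSet_outputs (π : Equiv.Perm (Fin n)) : MeasurableSet (c.outputs θ π) := by
  have : c.outputs θ π = ⋃ k, ({ω | c.StoppedAt θ ω k} ∩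
      {ω | c.estimate ω.1 (c.history θ ω.1 ω.2 k) = π}) := by
    ext ω
    simp [outputs, StoppedAt]
  rw [this]
  refine MeasurableSet.iUnion fun k => (measurableSet_stoppedAt k).inter ?_
  exact (c.measurable_estimate.comp (measurable_fst.prodMk (measurable_history k)))
    (measurableSet_singleton π)

lemma queryCount_le_of_stoppedAt {ω : c.Seed × (ℕ → Bool)} {k : ℕ} (h : c.StoppedAt θ ω k) :
    c.queryCount θ ω ≤ k :=
  iInf₂_le k h

open Classical in
-- Stopping is permanent, so `M` counts the times at which the code is still running. Expectations
-- of `M` thereby become sums over time, also when `M` is infinite.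
lemma queryCount_eq_tsum (ω : c.Seed × (ℕ → Bool)) :
    (c.queryCount θ ω : ℝ≥0∞) = ∑' k, if c.StoppedAt θ ω k then (0 : ℝ≥0∞) else 1 := by
  by_cases h : ∃ k, c.StoppedAt θ ω k
  · have hM : c.queryCount θ ω = (Nat.find h : ℕ∞) := by
      refine le_antisymm (queryCount_le_of_stoppedAt (Nat.find_spec h)) ?_
      exact le_iInf₂ fun k hk => by exact_mod_cast Nat.find_min' h hk
    have hite : ∀ k, (if c.StoppedAt θ ω k then (0 : ℝ≥0∞) else 1) =
        if k ∈ Finset.range (Nat.find h) then 1 else 0 := by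
      intro k
      by_cases hk : k < Nat.find h
      · rw [if_neg (Nat.find_min h hk), if_pos (Finset.mem_range.2 hk)]
      · rw [if_pos ((Nat.find_spec h).mono (not_lt.1 hk)), if_neg (by simpa using hk)]
    simp_rw [hite]
    rw [tsum_eq_sum (s := Finset.range (Nat.find h)) (fun k hk => by rw [if_neg hk]),
      Finset.sum_congr rfl (fun k hk => if_pos hk), hM]
    simp
  · have hM : c.queryCount θ ω = ⊤ := by
      rw [queryCount, iInf₂_eq_top]
      exact fun k hk => absurd ⟨k, hk⟩ h
    push Not at h
    rw [hM]
    simp [h]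

lemma measurable_queryCount :
    Measurable fun ω : c.Seed × (ℕ → Bool) => (c.queryCount θ ω : ℝ≥0∞) := by
  classical
  simp_rw [queryCount_eq_tsum]
  exact Measurable.tsum fun k =>
    Measurable.ite (measurableSet_stoppedAt k) measurable_const measurable_const

end SortingCode

/-! ### Product measures -/

/-- A coordinate that a function does not depend on may be sampled anew. -/
lemma lintegral_infinitePi_resample {X : Type*} [MeasurableSpace X] (ν : Measure X)
    [IsProbabilityMeasure ν] (k : ℕ) {G : (ℕ → X) → X → ℝ≥0∞}
    (hG : Measurable fun x : (ℕ → X) × X => G x.1 x.2)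
    (h : ∀ x y y', G (Function.update x k y) y' = G x y') :
    ∫⁻ x, G x (x k) ∂(Measure.infinitePi fun _ : ℕ => ν) =
      ∫⁻ x, ∫⁻ y, G x y ∂ν ∂(Measure.infinitePi fun _ : ℕ => ν) := by
  set P := Measure.infinitePi fun _ : ℕ => ν
  have hmeas : Measurable fun x : (ℕ → X) × X => Function.update x.1 k x.2 := by
    refine measurable_pi_lambda _ fun i => ?_
    by_cases hi : i = k
    · subst hi; simpa using measurable_snd
    · simp only [Function.update_of_ne hi]
      exact (measurable_pi_apply i).comp measurable_fst
  -- Replacing one coordinate by a fresh sample preserves the product law; it suffices to check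
  -- finite boxes, where the factor of coordinate `k` comes from the new sample.
  have hmap : (P.prod ν).map (fun x : (ℕ → X) × X => Function.update x.1 k x.2) = P := by
    refine Measure.eq_infinitePi _ fun s t ht => ?_
    rw [Measure.map_apply hmeas (MeasurableSet.pi s.countable_toSet fun i _ => ht i)]
    have hpre : (fun x : (ℕ → X) × X => Function.update x.1 k x.2) ⁻¹' (Set.pi s t) =
        (Set.pi (s.erase k : Finset ℕ) t) ×ˢ (if k ∈ s then t k else Set.univ) := by
      ext ⟨x, y⟩
      simp only [Set.mem_preimage, Set.mem_pi, Set.mem_prod, Finset.mem_coe, Finset.mem_erase]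
      constructor
      · intro hx
        refine ⟨fun i hi => by simpa [hi.1] using hx i hi.2, ?_⟩
        split_ifs with hk
        · simpa using hx k hk
        · trivial
      · rintro ⟨hx, hy⟩ i hi
        by_cases hik : i = k
        · subst hik
          simpa [hi] using hy
        · simpa [hik] using hx i ⟨hik, hi⟩
    rw [hpre, Measure.prod_prod, Measure.infinitePi_pi _ fun i _ => ht i]
    split_ifs with hk
    · rw [Finset.prod_erase_mul _ _ hk]
    · rw [measure_univ, mul_one, Finset.erase_eq_of_notMem hk]
  have hG' : Measurable fun x : ℕ → X => G x (x k) :=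
    hG.comp (measurable_id.prodMk (measurable_pi_apply k))
  conv_lhs => rw [← hmap]
  rw [lintegral_map hG' hmeas]
  simp only [h, Function.update_self]
  exact lintegral_prod _ hG.aemeasurable

lemma lintegral_bernoulli (p : unitInterval) (f : Bool → ℝ≥0∞) :
    ∫⁻ b, f b ∂(bernoulliMeasure true false p) =
      ENNReal.ofReal (1 - p) * f false + ENNReal.ofReal p * f true := by
  rw [bernoulliMeasure_def, lintegral_add_measure, lintegral_smul_measure, lintegral_smul_measure,
    lintegral_dirac, lintegral_dirac, add_comm]
  have e1 : ENNReal.ofReal (p : ℝ) = (unitInterval.toNNReal p : ℝ≥0∞) := by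
    rw [← unitInterval.coe_toNNReal, ENNReal.ofReal_coe_nnreal]
  have e2 : ENNReal.ofReal (1 - p : ℝ) = (unitInterval.toNNReal (unitInterval.symm p) : ℝ≥0∞) := by
    rw [← unitInterval.coe_symm_eq, ← unitInterval.coe_toNNReal, ENNReal.ofReal_coe_nnreal]
  rw [e1, e2]
  rfl

lemma volume_unitInterval_lt {c : ℝ} (h0 : 0 ≤ c) (h1 : c ≤ 1) :
    volume {v : unitInterval | (v : ℝ) < c} = ENNReal.ofReal c := by
  have : {v : unitInterval | (v : ℝ) < c} = Set.Iio ⟨c, h0, h1⟩ := by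
    ext v; simp [← Subtype.coe_lt_coe]
  rw [this, unitInterval.volume_Iio]

/-! ### The sorting algorithm as a Markov chain -/

/-- The target error of a single search. -/
noncomputable def targetError (n : ℕ) : ℝ := 1 / (n * Real.logb 2 n)

lemma one_le_logb {n : ℕ} (hn : 2 ≤ n) : 1 ≤ Real.logb 2 n := by
  rw [Real.le_logb_iff_rpow_le one_lt_two (by positivity), Real.rpow_one]
  exact_mod_cast hn

lemma two_le_mul_logb {n : ℕ} (hn : 2 ≤ n) : 2 ≤ n * Real.logb 2 n := by
  have : (2 : ℝ) ≤ n := by exact_mod_cast hn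
  nlinarith [one_le_logb hn]

lemma targetError_pos {n : ℕ} (hn : 2 ≤ n) : 0 < targetError n :=
  one_div_pos.2 (by linarith [two_le_mul_logb hn])

lemma targetError_lt_one {n : ℕ} (hn : 2 ≤ n) : targetError n < 1 := by
  rw [targetError, div_lt_one] <;> linarith [two_le_mul_logb hn]

section Chain

variable {n : ℕ} {p : ℝ} {θ : Fin n → ℝ} {r : Equiv.Perm (Fin n)}

/-- The state of the algorithm after a history. -/
noncomputable abbrev stateAfter (p : ℝ) (r : Equiv.Perm (Fin n)) (h : History n) :
    InsertionState n :=
  InsertionState.after p (targetError n) r h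

/-- One time step, with the uniform variable `v` and the noise bit `b`. -/
noncomputable def extendHistory (p : ℝ) (θ : Fin n → ℝ) (r : Equiv.Perm (Fin n)) (h : History n)
    (v : unitInterval) (b : Bool) : History n :=
  match (stateAfter p r h).nextQuery p v with
  | none => h
  | some q => (q, xor (decide (θ q.1.1 < θ q.1.2)) b) :: h

/-- The history after `k` time steps, for the renaming `r`. -/
noncomputable def runHistory (p : ℝ) (θ : Fin n → ℝ) (r : Equiv.Perm (Fin n)) (k : ℕ)
    (x : (ℕ → unitInterval) × (ℕ → Bool)) : History n :=
  (vlbzSort p n).history θ (r, x.1) x.2 k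

/-- The joint law of the uniform variables and of the noise. -/
noncomputable def pathLaw (p : unitInterval) : Measure ((ℕ → unitInterval) × (ℕ → Bool)) :=
  (Measure.infinitePi fun _ => (volume : Measure unitInterval)).prod (noiseLaw p)

instance (p : unitInterval) : IsProbabilityMeasure (pathLaw p) := by
  unfold pathLaw; infer_instance

lemma lintegral_runLaw_vlbzSort (p : unitInterval)
    {f : (vlbzSort p n).Seed × (ℕ → Bool) → ℝ≥0∞} (hf : Measurable f) :
    ∫⁻ ω, f ω ∂((vlbzSort p n).runLaw p) =
      ∑ r : Equiv.Perm (Fin n), ((Fintype.card (Equiv.Perm (Fin n)) : ℝ≥0∞)⁻¹ *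
        ∫⁻ x, f ((r, x.1), x.2) ∂(pathLaw p)) := by
  have hlaw : (vlbzSort p n).runLaw p =
      ((PMF.uniformOfFintype (Equiv.Perm (Fin n))).toMeasure.prod
        (Measure.infinitePi fun _ => (volume : Measure unitInterval))).prod (noiseLaw p) := rfl
  rw [hlaw]
  have hf' : Measurable (fun ω : (Equiv.Perm (Fin n) × (ℕ → unitInterval)) × (ℕ → Bool) => f ω) :=
    hf
  have hf2 : Measurable (fun ω : Equiv.Perm (Fin n) × (ℕ → unitInterval) =>
      ∫⁻ z, f (ω, z) ∂(noiseLaw p)) := hf'.lintegral_prod_right'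
  refine (lintegral_prod _ hf'.aemeasurable).trans ?_
  refine (lintegral_prod _ hf2.aemeasurable).trans ?_
  rw [lintegral_fintype]
  refine Finset.sum_congr rfl fun r _ => ?_
  rw [PMF.toMeasure_apply_singleton _ _ (measurableSet_singleton r), PMF.uniformOfFintype_apply,
    mul_comm, pathLaw]
  congr 1
  have hm : Measurable fun x : (ℕ → unitInterval) × (ℕ → Bool) => f ((r, x.1), x.2) :=
    hf'.comp ((measurable_const.prodMk measurable_fst).prodMk measurable_snd)
  exact (lintegral_prod (fun x : (ℕ → unitInterval) × (ℕ → Bool) => f ((r, x.1), x.2))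
    hm.aemeasurable).symm

lemma measurable_runHistory (k : ℕ) : Measurable (runHistory p θ r k) := by
  have h : Measurable fun ω : (Equiv.Perm (Fin n) × (ℕ → unitInterval)) × (ℕ → Bool) =>
      (vlbzSort p n).history θ ω.1 ω.2 k :=
    SortingCode.measurable_history (c := vlbzSort p n) (θ := θ) k
  exact h.comp ((measurable_const.prodMk measurable_fst).prodMk measurable_snd)

lemma measurable_extendHistory :
    Measurable fun x : (History n × unitInterval) × Bool => extendHistory p θ r x.1.1 x.1.2 x.2 := by
  have h0 : Measurable fun x : (Equiv.Perm (Fin n) × (ℕ → unitInterval)) × History n =>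
      (vlbzSort p n).next x.1 x.2 := (vlbzSort p n).measurable_next
  have h1 : Measurable fun x : (History n × unitInterval) × Bool =>
      ((stateAfter p r x.1.1).nextQuery p x.1.2, x.1.1, x.2) :=
    (h0.comp ((measurable_const (a := r).prodMk (measurable_pi_lambda _ fun _ : ℕ =>
      measurable_snd.comp measurable_fst)).prodMk (measurable_fst.comp measurable_fst))).prodMk
      ((measurable_fst.comp measurable_fst).prodMk measurable_snd)
  have h2 : Measurable fun x : Option (Query n) × History n × Bool =>
      match x.1 with
      | none => x.2.1
      | some q => (q, xor (decide (θ q.1.1 < θ q.1.2)) x.2.2) :: x.2.1 :=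
    measurable_of_countable _
  exact h2.comp h1

lemma valid_stateAfter (h0 : 0 < p) (h1 : p < 1 / 2) (hn : 2 ≤ n) (r : Equiv.Perm (Fin n))
    (h : History n) : (stateAfter p r h).Valid (targetError n) :=
  InsertionState.valid_after h0 h1 (targetError_pos hn) (targetError_lt_one hn) (by omega) r h

lemma stoppedAt_iff (h0 : 0 < p) (h1 : p < 1 / 2) (hn : 2 ≤ n) (k : ℕ)
    (x : (ℕ → unitInterval) × (ℕ → Bool)) :
    (vlbzSort p n).StoppedAt θ ((r, x.1), x.2) k ↔
      (stateAfter p r (runHistory p θ r k x)).pending = [] :=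
  (valid_stateAfter h0 h1 hn r _).nextQuery_eq_none_iff _

lemma extendHistory_of_pending_nil {h : History n} (hp : (stateAfter p r h).pending = [])
    (v : unitInterval) (b : Bool) : extendHistory p θ r h v b = h := by
  have : (stateAfter p r h).nextQuery p v = none := by simp only [InsertionState.nextQuery, hp]
  simp only [extendHistory, this]

/-- The algorithm reads its uniform variable at the length of the history. This length is `k` as
long as it has not stopped, and afterwards the variable is irrelevant. -/
lemma runHistory_succ (h0 : 0 < p) (h1 : p < 1 / 2) (hn : 2 ≤ n) (k : ℕ)
    (x : (ℕ → unitInterval) × (ℕ → Bool)) :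
    runHistory p θ r (k + 1) x = extendHistory p θ r (runHistory p θ r k x) (x.1 k) (x.2 k) := by
  by_cases hs : (vlbzSort p n).StoppedAt θ ((r, x.1), x.2) k
  · rw [extendHistory_of_pending_nil ((stoppedAt_iff h0 h1 hn k x).1 hs)]
    exact SortingCode.history_succ_of_none hs
  · have hlen := SortingCode.length_history_of_not_stoppedAt hs
    obtain ⟨q, hq⟩ := Option.ne_none_iff_exists'.1 hs
    have hq' : (stateAfter p r (runHistory p θ r k x)).nextQuery p (x.1 k) = some q := by
      have : (vlbzSort p n).next (r, x.1) ((vlbzSort p n).history θ (r, x.1) x.2 k) =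
          (stateAfter p r (runHistory p θ r k x)).nextQuery p
            (x.1 ((vlbzSort p n).history θ (r, x.1) x.2 k).length) := rfl
      rw [← hq, this, hlen]
    simp only [extendHistory, hq']
    exact SortingCode.history_succ_of_some hq

/-- The history at time `j` uses only the coordinates below `j`, so those of index `k ≥ j` are
fresh. This is the hypothesis of `lintegral_infinitePi_resample`. -/
lemma runHistory_update_left (h0 : 0 < p) (h1 : p < 1 / 2) (hn : 2 ≤ n) {j k : ℕ} (hjk : j ≤ k)
    (u : ℕ → unitInterval) (z : ℕ → Bool) (v : unitInterval) :
    runHistory p θ r j (Function.update u k v, z) = runHistory p θ r j (u, z) := by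
  induction j with
  | zero => rfl
  | succ j ih =>
    rw [runHistory_succ h0 h1 hn, runHistory_succ h0 h1 hn, ih (by omega)]
    simp only [Function.update_of_ne (show j ≠ k by omega)]

lemma runHistory_update_right (h0 : 0 < p) (h1 : p < 1 / 2) (hn : 2 ≤ n) {j k : ℕ} (hjk : j ≤ k)
    (u : ℕ → unitInterval) (z : ℕ → Bool) (b : Bool) :
    runHistory p θ r j (u, Function.update z k b) = runHistory p θ r j (u, z) := by
  induction j with
  | zero => rfl
  | succ j ih =>
    rw [runHistory_succ h0 h1 hn, runHistory_succ h0 h1 hn, ih (by omega)]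
    simp only [Function.update_of_ne (show j ≠ k by omega)]

/-- The mean of `V` after one time step from the history `h`. -/
noncomputable def stepMean (p : unitInterval) (θ : Fin n → ℝ) (r : Equiv.Perm (Fin n))
    (V : History n → ℝ≥0∞) (h : History n) : ℝ≥0∞ :=
  ∫⁻ v : unitInterval, ∫⁻ b, V (extendHistory p θ r h v b) ∂(bernoulliMeasure true false p)

/-- The Markov property. -/
lemma lintegral_runHistory_succ {p : unitInterval} (h0 : 0 < (p : ℝ)) (h1 : (p : ℝ) < 1 / 2)
    (hn : 2 ≤ n) (V : History n → ℝ≥0∞) (k : ℕ) :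
    ∫⁻ x, V (runHistory p θ r (k + 1) x) ∂(pathLaw p) =
      ∫⁻ x, stepMean p θ r V (runHistory p θ r k x) ∂(pathLaw p) := by
  have hV : Measurable V := measurable_of_countable _
  have hE : Measurable fun x : (History n × unitInterval) × Bool =>
      V (extendHistory p θ r x.1.1 x.1.2 x.2) := hV.comp measurable_extendHistory
  have hB : Measurable fun x : History n × unitInterval =>
      ∫⁻ b, V (extendHistory p θ r x.1 x.2 b) ∂(bernoulliMeasure true false p) :=
    hE.lintegral_prod_right'
  have hH : Measurable (runHistory (n := n) p θ r k) := measurable_runHistory k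
  have hS : Measurable (stepMean p θ r V) := measurable_of_countable _
  have heval (j : ℕ) : Measurable fun u : ℕ → unitInterval => u j := measurable_pi_apply j
  rw [pathLaw, lintegral_prod (fun x => V (runHistory p θ r (k + 1) x))
      (hV.comp (measurable_runHistory (k + 1))).aemeasurable,
    lintegral_prod_symm (fun x => stepMean p θ r V (runHistory p θ r k x))
      (hS.comp hH).aemeasurable]
  calc _ = ∫⁻ u, ∫⁻ z, ∫⁻ b, V (extendHistory p θ r (runHistory p θ r k (u, z)) (u k) b)
          ∂(bernoulliMeasure true false p) ∂(noiseLaw p)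
          ∂(Measure.infinitePi fun _ => (volume : Measure unitInterval)) := by
        refine lintegral_congr fun u => ?_
        simp_rw [runHistory_succ h0 h1 hn]
        refine lintegral_infinitePi_resample _ k
          (G := fun z b => V (extendHistory p θ r (runHistory p θ r k (u, z)) (u k) b)) ?_ ?_
        · exact hE.comp (((hH.comp (measurable_const.prodMk measurable_fst)).prodMk
            measurable_const).prodMk measurable_snd)
        · intro z b b'
          simp only [runHistory_update_right h0 h1 hn le_rfl]
    _ = ∫⁻ z, ∫⁻ u, ∫⁻ b, V (extendHistory p θ r (runHistory p θ r k (u, z)) (u k) b)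
          ∂(bernoulliMeasure true false p)
          ∂(Measure.infinitePi fun _ => (volume : Measure unitInterval)) ∂(noiseLaw p) := by
        refine lintegral_lintegral_swap (Measurable.aemeasurable ?_)
        exact hB.comp (hH.prodMk ((heval k).comp measurable_fst))
    _ = _ := by
        refine lintegral_congr fun z => ?_
        refine lintegral_infinitePi_resample _ k
          (G := fun u v => ∫⁻ b, V (extendHistory p θ r (runHistory p θ r k (u, z)) v b)
            ∂(bernoulliMeasure true false p)) ?_ ?_
        · exact hB.comp ((hH.comp (measurable_fst.prodMk measurable_const)).prodMk measurable_snd)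
        · intro u v v'
          simp only [runHistory_update_left h0 h1 hn le_rfl]

/-- A potential that pays for a running cost bounds the total cost. -/
lemma sum_lintegral_le_of_stepMean_le {p : unitInterval} (h0 : 0 < (p : ℝ))
    (h1 : (p : ℝ) < 1 / 2) (hn : 2 ≤ n) {V c : History n → ℝ≥0∞}
    (hV : ∀ h, c h + stepMean p θ r V h ≤ V h) (K : ℕ) :
    ∑ k ∈ Finset.range K, ∫⁻ x, c (runHistory p θ r k x) ∂(pathLaw p) +
      ∫⁻ x, V (runHistory p θ r K x) ∂(pathLaw p) ≤ V [] := by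
  induction K with
  | zero => simp [runHistory, SortingCode.history]
  | succ K ih =>
    refine le_trans ?_ ih
    have hc : Measurable fun x => c (runHistory p θ r K x) :=
      (measurable_of_countable c).comp (measurable_runHistory K)
    rw [Finset.sum_range_succ, add_assoc, lintegral_runHistory_succ h0 h1 hn,
      ← lintegral_add_left hc]
    gcongr with x
    exact hV _

/-- A sequence of potentials that dominates one step bounds the mean after `k` steps. -/
lemma lintegral_le_of_stepMean_le {p : unitInterval} (h0 : 0 < (p : ℝ))
    (h1 : (p : ℝ) < 1 / 2) (hn : 2 ≤ n) {U : ℕ → History n → ℝ≥0∞}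
    (hU : ∀ k h, stepMean p θ r (U k) h ≤ U (k + 1) h) (k j : ℕ) :
    ∫⁻ x, U j (runHistory p θ r k x) ∂(pathLaw p) ≤ U (j + k) [] := by
  induction k generalizing j with
  | zero => simp [runHistory, SortingCode.history]
  | succ k ih =>
    rw [lintegral_runHistory_succ h0 h1 hn]
    refine (lintegral_mono fun x => hU j _).trans ((ih (j + 1)).trans_eq ?_)
    congr 1
    omega

end Chain

/-! ### A step of the chain as a step of a search -/

section Potential

variable {n : ℕ} {p : unitInterval} {θ : Fin n → ℝ} {r : Equiv.Perm (Fin n)}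

lemma lintegral_queryIndex {p : ℝ} (h0 : 0 < p) (h1 : p < 1 / 2) {m : ℕ} {q : ℕ → ℝ}
    (hq : IsPosterior m q) (hm : 0 < m) {F : ℕ → ℝ} (hF : ∀ a < m, 0 ≤ F a) :
    ∫⁻ v : unitInterval, ENNReal.ofReal (F (queryIndex p m q v)) =
      ENNReal.ofReal (queryMean p m q F) := by
  have hj := (hq.medianIndex_spec hm).1
  rw [queryMean, leftWeight]
  split_ifs with hj0 hjm
  · have (v : unitInterval) : queryIndex p m q v = medianIndex q := by simp [queryIndex, hj0]
    simp [this]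
  · have (v : unitInterval) : queryIndex p m q v = medianIndex q - 1 := by
      simp [queryIndex, hj0, hjm]
    simp [this]
  · obtain ⟨l0, l1⟩ := hq.leftProb_mem h0 h1 hm
    have hA : MeasurableSet {v : unitInterval | (v : ℝ) < leftProb p m q} :=
      measurableSet_lt measurable_subtype_coe measurable_const
    have e1 : ∫⁻ v : unitInterval in {v : unitInterval | (v : ℝ) < leftProb p m q},
        ENNReal.ofReal (F (queryIndex p m q v)) =
        ENNReal.ofReal (F (medianIndex q - 1)) * ENNReal.ofReal (leftProb p m q) := by
      rw [← volume_unitInterval_lt l0 l1, ← setLIntegral_const]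
      refine setLIntegral_congr_fun hA fun v hv => ?_
      have hv : (v : ℝ) < leftProb p m q := hv
      simp [queryIndex, hj0, hv]
    have e2 : ∫⁻ v : unitInterval in {v : unitInterval | (v : ℝ) < leftProb p m q}ᶜ,
        ENNReal.ofReal (F (queryIndex p m q v)) =
        ENNReal.ofReal (F (medianIndex q)) * ENNReal.ofReal (1 - leftProb p m q) := by
      rw [ENNReal.ofReal_sub _ l0, ENNReal.ofReal_one, ← volume_unitInterval_lt l0 l1,
        ← prob_compl_eq_one_sub hA, ← setLIntegral_const]
      refine setLIntegral_congr_fun hA.compl fun v hv => ?_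
      have hv : ¬ (v : ℝ) < leftProb p m q := hv
      simp only [queryIndex, hjm, hv, or_self, and_false, if_false]
    rw [← lintegral_add_compl _ hA, e1, e2, ← ENNReal.ofReal_mul (hF _ (by omega)),
      ← ENNReal.ofReal_mul (hF _ hj), ← ENNReal.ofReal_add]
    · congr 1; ring
    · exact mul_nonneg (hF _ (by omega)) l0
    · exact mul_nonneg (hF _ hj) (by linarith)

/-- The items of the list are in the right order. -/
def IsSorted (θ : Fin n → ℝ) (S : InsertionState n) : Prop :=
  S.sorted.Pairwise fun a b => θ a < θ b

/-- While the list is sorted, the noisy comparison is a noisy answer about the true gap, and the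
position of the queried element is recovered from its name because the list has no repetitions. One
time step is then exactly one step of the abstract search. -/
lemma stateAfter_extendHistory (h0 : 0 < (p : ℝ)) (h1 : (p : ℝ) < 1 / 2) (hn : 2 ≤ n)
    {h : History n} {t : Fin n} {rest : List (Fin n)}
    (hp : (stateAfter p r h).pending = t :: rest) (hs : IsSorted θ (stateAfter p r h))
    (v : unitInterval) (b : Bool) :
    stateAfter p r (extendHistory p θ r h v b) =
      (stateAfter p r h).respond p (targetError n)
        (queryIndex p ((stateAfter p r h).sorted.length + 1) (stateAfter p r h).posterior v)
        (xor (decide (queryIndex p ((stateAfter p r h).sorted.length + 1)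
          (stateAfter p r h).posterior v < gapIndex θ (stateAfter p r h).sorted t)) b) := by
  have hv := valid_stateAfter h0 h1 hn r h
  simp only [extendHistory, hv.nextQuery_eq hp]
  have : ∀ o : Query n × Bool, stateAfter p r (o :: h) =
      (stateAfter p r h).respond p (targetError n) ((stateAfter p r h).sorted.idxOf o.1.1.1) o.2 :=
    fun _ => rfl
  rw [this]
  simp only [hv.nodup_sorted.idxOf_getElem]
  simp only [getElem_lt_iff_lt_gapIndex hs t (hv.queryIndex_lt (p := p) v)]

lemma not_isSorted_extendHistory {h : History n} (hs : ¬ IsSorted θ (stateAfter p r h))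
    (v : unitInterval) (b : Bool) : ¬ IsSorted θ (stateAfter p r (extendHistory p θ r h v b)) := by
  intro h'
  rcases hq : (stateAfter p r h).nextQuery p v with _ | q
  · simp only [extendHistory, hq] at h'
    exact hs h'
  · simp only [extendHistory, hq] at h'
    exact hs (InsertionState.pairwise_of_pairwise_respond h')

/-- Reduces an integral over the randomness of one step to the finite means `queryMean` and
`responseMean`, for which the search lemmas are stated. -/
lemma stepMean_le (h0 : 0 < (p : ℝ)) (h1 : (p : ℝ) < 1 / 2) (hn : 2 ≤ n) {h : History n}
    {t : Fin n} {rest : List (Fin n)} (hp : (stateAfter p r h).pending = t :: rest)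
    (hs : IsSorted θ (stateAfter p r h)) {W : InsertionState n → ℝ≥0∞} {w : ℕ → Bool → ℝ}
    (hw : ∀ a < (stateAfter p r h).sorted.length + 1, ∀ y, 0 ≤ w a y)
    (hW : ∀ a < (stateAfter p r h).sorted.length + 1, ∀ y,
      W ((stateAfter p r h).respond p (targetError n) a y) ≤ ENNReal.ofReal (w a y)) :
    stepMean p θ r (fun h => W (stateAfter p r h)) h ≤
      ENNReal.ofReal (queryMean p ((stateAfter p r h).sorted.length + 1)
        (stateAfter p r h).posterior fun a =>
          responseMean p (decide (a < gapIndex θ (stateAfter p r h).sorted t)) (w a)) := by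
  have hv := valid_stateAfter h0 h1 hn r h
  rw [← lintegral_queryIndex h0 h1 hv.isPosterior (Nat.succ_pos _)
    fun a ha => responseMean_nonneg h0 h1 _ (hw a ha), stepMean]
  refine lintegral_mono fun v => ?_
  simp only [stateAfter_extendHistory h0 h1 hn hp hs]
  have hlt : queryIndex p ((stateAfter p r h).sorted.length + 1) (stateAfter p r h).posterior v <
      (stateAfter p r h).sorted.length + 1 := (hv.queryIndex_lt v).trans (Nat.lt_succ_self _)
  rw [lintegral_bernoulli, Bool.xor_false, Bool.xor_true, responseMean,
    ENNReal.ofReal_add (mul_nonneg (by linarith) (hw _ hlt _)) (mul_nonneg h0.le (hw _ hlt _)),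
    ENNReal.ofReal_mul (by linarith), ENNReal.ofReal_mul h0.le]
  gcongr
  · exact hW _ hlt _
  · exact hW _ hlt _

lemma stepMean_of_pending_nil {h : History n} (hp : (stateAfter p r h).pending = [])
    (V : History n → ℝ≥0∞) : stepMean p θ r V h = V h := by
  simp [stepMean, extendHistory_of_pending_nil hp]

lemma stepMean_of_forall {h : History n} {V : History n → ℝ≥0∞} {c : ℝ≥0∞}
    (hV : ∀ v b, V (extendHistory p θ r h v b) = c) : stepMean p θ r V h = c := by
  simp [stepMean, hV]

/-! ### The expected number of queries -/

/-- An upper bound for the log-odds of the true interval at the end of a search. -/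
noncomputable def oddsBound (p : ℝ) (n : ℕ) : ℝ :=
  -Real.logb 2 (targetError n) + Real.logb 2 ((1 - p) / p)

/-- An upper bound for the mean length of a single search. -/
noncomputable def searchLength (p : ℝ) (n : ℕ) : ℝ :=
  (oddsBound p n + Real.logb 2 n) / (1 - entropy p)

open Classical in
/-- An upper bound for the mean number of queries that are made before the first error. -/
noncomputable def timePotential (p : ℝ) (θ : Fin n → ℝ) (S : InsertionState n) : ℝ≥0∞ :=
  if IsSorted θ S then
    match S.pending with
    | [] => 0
    | t :: rest => ENNReal.ofReal
        ((oddsBound p n - logOdds S.posterior (gapIndex θ S.sorted t)) / (1 - entropy p) +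
          rest.length * searchLength p n)
  else 0

lemma timePotential_of_pending_cons {p : ℝ} {S : InsertionState n} {t : Fin n}
    {rest : List (Fin n)} (hS : IsSorted θ S) (hp : S.pending = t :: rest) :
    timePotential p θ S = ENNReal.ofReal
        ((oddsBound p n - logOdds S.posterior (gapIndex θ S.sorted t)) / (1 - entropy p) +
          rest.length * searchLength p n) := by
  simp only [timePotential, if_pos hS, hp]

lemma timePotential_of_pending_nil {p : ℝ} {S : InsertionState n} (hp : S.pending = []) :
    timePotential p θ S = 0 := by
  simp only [timePotential, hp, ite_self]

lemma timePotential_of_not {p : ℝ} {S : InsertionState n} (hS : ¬ IsSorted θ S) :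
    timePotential p θ S = 0 := by
  simp only [timePotential, if_neg hS]

lemma oddsBound_nonneg {p : ℝ} (h0 : 0 < p) (h1 : p < 1 / 2) (hn : 2 ≤ n) :
    0 ≤ oddsBound p n := by
  have e1 := Real.logb_neg one_lt_two (targetError_pos hn) (targetError_lt_one hn)
  have e2 : 0 ≤ Real.logb 2 ((1 - p) / p) :=
    Real.logb_nonneg one_lt_two (by rw [le_div_iff₀ h0]; linarith)
  rw [oddsBound]
  linarith

lemma searchLength_nonneg {p : ℝ} (h0 : 0 < p) (h1 : p < 1 / 2) (hn : 2 ≤ n) :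
    0 ≤ searchLength p n :=
  div_nonneg (add_nonneg (oddsBound_nonneg h0 h1 hn) (by linarith [one_le_logb hn]))
    (one_sub_entropy_pos h1).le

lemma logOdds_uniformPrior {m : ℕ} (hm : 2 ≤ m) (g : ℕ) :
    logOdds (uniformPrior m) g = -Real.logb 2 (m - 1 : ℝ) := by
  have : (2 : ℝ) ≤ m := by exact_mod_cast hm
  rw [logOdds, uniformPrior, ← Real.logb_inv]
  congr 1
  have : (m : ℝ) - 1 ≠ 0 := by linarith
  field_simp

/-- A fresh search in a list of length `l` starts with log-odds `-log₂ l ≥ -log₂ n`, so its first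
term is at most one `searchLength`. -/
lemma timePotential_uniformPrior_le {p : ℝ} (h1 : p < 1 / 2)
    {l pend : List (Fin n)} (hl : 0 < l.length) (hln : l.length ≤ n) :
    timePotential p θ ⟨l, pend, uniformPrior (l.length + 1)⟩ ≤
      ENNReal.ofReal (pend.length * searchLength p n) := by
  by_cases hs : IsSorted θ ⟨l, pend, uniformPrior (l.length + 1)⟩
  · rcases pend with _ | ⟨t, rest⟩
    · rw [timePotential_of_pending_nil rfl]; exact zero_le
    · rw [timePotential_of_pending_cons hs rfl]
      apply ENNReal.ofReal_le_ofReal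
      rw [logOdds_uniformPrior (by omega), List.length_cons]
      push_cast
      rw [add_sub_cancel_right, sub_neg_eq_add, add_comm, add_mul, one_mul]
      gcongr
      rw [searchLength]
      have : (1 : ℝ) ≤ l.length := by exact_mod_cast hl
      have := one_sub_entropy_pos h1
      gcongr
      norm_num
  · rw [timePotential_of_not hs]; exact zero_le

lemma logOdds_le_of_not_done {m : ℕ} {q : ℕ → ℝ} {ε : ℝ} (h : ¬ SearchDone m ε q)
    {g : ℕ} (hg : g < m) : logOdds q g ≤ -Real.logb 2 ε := by
  by_contra hc
  exact h ⟨g, hg, (not_le.1 hc).le⟩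

open Classical in
-- The drift of the log-odds, divided by `1 - H(p)`, pays one unit per query. The end of a search
-- only lowers the potential, and so does a wrong insertion, after which the potential is zero.
lemma stepMean_timePotential (h0 : 0 < (p : ℝ)) (h1 : (p : ℝ) < 1 / 2) (hn : 2 ≤ n)
    (h : History n) :
    (if IsSorted θ (stateAfter p r h) ∧ (stateAfter p r h).pending ≠ [] then (1 : ℝ≥0∞) else 0) +
      stepMean p θ r (fun h => timePotential p θ (stateAfter p r h)) h ≤
      timePotential p θ (stateAfter p r h) := by
  have hv := valid_stateAfter h0 h1 hn r h
  by_cases hs : IsSorted θ (stateAfter p r h)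
  swap
  · rw [if_neg (fun h => hs h.1), zero_add, stepMean_of_forall (c := 0)]
    · exact zero_le
    · exact fun v b => timePotential_of_not (not_isSorted_extendHistory hs v b)
  rcases hp : (stateAfter p r h).pending with _ | ⟨t, rest⟩
  · rw [if_neg (by simp), zero_add, stepMean_of_pending_nil hp]
  rw [if_pos ⟨hs, by simp⟩]
  set S := stateAfter p r h with hS
  set g := gapIndex θ S.sorted t with hg
  have hgm : g < S.sorted.length + 1 := Nat.lt_succ_of_le (gapIndex_le _ _)
  have hC := one_sub_entropy_pos h1
  have hD := searchLength_nonneg h0 h1 hn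
  set w : ℕ → Bool → ℝ := fun a y =>
    (oddsBound p n - logOdds (bayesUpdate p S.posterior a y) g) / (1 - entropy p) +
      rest.length * searchLength p n with hw
  -- Before the response the log-odds of the true gap are at most `-log₂ ε`, since the search is not
  -- done. One response overshoots by at most `log₂ ((1-p)/p)`, which is why `oddsBound` contains
  -- this term.
  have hodds : ∀ a < S.sorted.length + 1, ∀ y,
      0 ≤ (oddsBound p n - logOdds (bayesUpdate p S.posterior a y) g) / (1 - entropy p) := by
    intro a ha y
    have e1 := hv.isPosterior.logOdds_bayesUpdate_le h0 h1 hv.two_le hgm ha y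
    have e2 := logOdds_le_of_not_done hv.not_done hgm
    apply div_nonneg _ hC.le
    rw [oddsBound]
    linarith
  have hw0 : ∀ a < S.sorted.length + 1, ∀ y, 0 ≤ w a y := fun a ha y =>
    add_nonneg (hodds a ha y) (mul_nonneg (Nat.cast_nonneg _) hD)
  have hstep := stepMean_le (θ := θ) (W := timePotential p θ) h0 h1 hn hp hs hw0 (fun a ha y => by
    by_cases hd : SearchDone (S.sorted.length + 1) (targetError n) (bayesUpdate p S.posterior a y)
    · rw [InsertionState.respond_of_done hp hd]
      have hm : argmaxIndex (S.sorted.length + 1) (bayesUpdate p S.posterior a y) ≤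
          S.sorted.length :=
        Nat.lt_succ_iff.1 (IsPosterior.argmaxIndex_spec (Nat.succ_pos _)).1
      generalize argmaxIndex (S.sorted.length + 1) (bayesUpdate p S.posterior a y) = i at hm ⊢
      have hlen := List.length_insertIdx_of_le_length hm t
      have hadd := hv.length_add
      rw [hp, List.length_cons] at hadd
      rw [← hlen]
      refine le_trans (timePotential_uniformPrior_le h1 ?_ ?_) ?_
      · omega
      · omega
      apply ENNReal.ofReal_le_ofReal
      simp only [hw]
      linarith [hodds a ha y]
    · rw [InsertionState.respond_of_not_done hp hd]
      exact (timePotential_of_pending_cons (S := ⟨S.sorted, t :: rest, _⟩) hs rfl).le)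
  refine (add_le_add_right hstep 1).trans ?_
  rw [timePotential_of_pending_cons hs hp, ← ENNReal.ofReal_one, ← ENNReal.ofReal_add zero_le_one]
  · apply ENNReal.ofReal_le_ofReal
    have hdrift := hv.isPosterior.logOdds_drift h0 h1 hv.two_le hgm
    -- The potential is affine in the log-odds, so its mean is obtained by inserting their mean.
    have hlin : queryMean p (S.sorted.length + 1) S.posterior (fun a =>
        responseMean p (decide (a < g)) (w a)) =
        (oddsBound p n - queryMean p (S.sorted.length + 1) S.posterior (fun a =>
          responseMean p (decide (a < g)) fun y => logOdds (bayesUpdate p S.posterior a y) g)) /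
          (1 - entropy p) + rest.length * searchLength p n := by
      simp only [queryMean, responseMean, hw]
      field_simp
      ring
    rw [hlin, ← add_assoc]
    gcongr
    rw [← sub_nonneg]
    have : (oddsBound p n - logOdds S.posterior g) / (1 - entropy p) -
        (1 + (oddsBound p n - queryMean p (S.sorted.length + 1) S.posterior (fun a =>
          responseMean p (decide (a < g)) fun y => logOdds (bayesUpdate p S.posterior a y) g)) /
          (1 - entropy p)) =
        (queryMean p (S.sorted.length + 1) S.posterior (fun a =>
          responseMean p (decide (a < g)) fun y => logOdds (bayesUpdate p S.posterior a y) g) -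
          (logOdds S.posterior g + (1 - entropy p))) / (1 - entropy p) := by
      field_simp
      ring
    rw [this]
    exact div_nonneg (by linarith) hC.le
  · rw [← queryMean_const (p := p) (m := S.sorted.length + 1) (q := S.posterior) 0]
    exact hv.isPosterior.queryMean_mono h0 h1 (Nat.succ_pos _) fun a ha =>
      responseMean_nonneg h0 h1 _ (hw0 a ha)

lemma timePotential_init_le {p : ℝ} (h0 : 0 < p) (h1 : p < 1 / 2) (hn : 2 ≤ n) :
    timePotential p θ (stateAfter p r []) ≤ ENNReal.ofReal (n * searchLength p n) := by
  have hlen : (stateAfter p r []).sorted.length = 1 := by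
    simp [stateAfter, InsertionState.after, InsertionState.init]; omega
  have h := timePotential_uniformPrior_le (θ := θ) h1 (l := (stateAfter p r []).sorted)
    (pend := (stateAfter p r []).pending) (by omega) (by omega)
  rw [hlen] at h
  refine h.trans (ENNReal.ofReal_le_ofReal ?_)
  have hadd := (valid_stateAfter h0 h1 hn r []).length_add
  refine mul_le_mul_of_nonneg_right ?_ (searchLength_nonneg h0 h1 hn)
  exact_mod_cast (by omega : (stateAfter p r []).pending.length ≤ n)

open Classical in
/-- The mean number of queries that are made before the first error. -/
lemma tsum_measure_sorted_le (h0 : 0 < (p : ℝ)) (h1 : (p : ℝ) < 1 / 2) (hn : 2 ≤ n) :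
    ∑' k, ∫⁻ x, (if IsSorted θ (stateAfter p r (runHistory p θ r k x)) ∧
      (stateAfter p r (runHistory p θ r k x)).pending ≠ [] then (1 : ℝ≥0∞) else 0) ∂(pathLaw p) ≤
      ENNReal.ofReal (n * searchLength p n) := by
  refine ENNReal.tsum_le_of_sum_range_le fun K => ?_
  refine le_trans ?_ (timePotential_init_le (θ := θ) (r := r) h0 h1 hn)
  refine le_trans le_self_add (sum_lintegral_le_of_stepMean_le (θ := θ) h0 h1 hn
    (c := fun h => if IsSorted θ (stateAfter p r h) ∧ (stateAfter p r h).pending ≠ [] then 1 else 0)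
    (V := fun h => timePotential p θ (stateAfter p r h))
    (stepMean_timePotential h0 h1 hn) K)

end Potential

/-! ### The probability of a wrong insertion -/

section ErrorPotential

variable {n : ℕ} {p : unitInterval} {θ : Fin n → ℝ} {r : Equiv.Perm (Fin n)}

/-- The sum of the error probabilities of the insertions of the items of the second list into the
sorted version of the first list, when every search makes at most `k` queries. -/
noncomputable def insertionError (p ε : ℝ) (θ : Fin n → ℝ) (k : ℕ) :
    List (Fin n) → List (Fin n) → ℝ
  | _, [] => 0
  | l, t :: rest =>
    searchError p (l.length + 1) ε k (uniformPrior (l.length + 1)) (gapIndex θ l t) +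
      insertionError p ε θ k (l ++ [t]) rest

/-- The true gap is a count of smaller elements, so only the set of listed items matters. The errors
of the future searches are therefore known in advance, whatever the current search does, as long as
the list stays sorted. -/
lemma insertionError_perm {p ε : ℝ} {k : ℕ} {l l' : List (Fin n)} (h : l.Perm l')
    (pend : List (Fin n)) : insertionError p ε θ k l pend = insertionError p ε θ k l' pend := by
  induction pend generalizing l l' with
  | nil => rfl
  | cons t rest ih =>
    rw [insertionError, insertionError, h.length_eq, gapIndex_perm h, ih (h.append_right [t])]

lemma insertionError_nonneg {p : ℝ} (h0 : 0 < p) (h1 : p < 1 / 2) (ε : ℝ) (k : ℕ)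
    (l pend : List (Fin n)) : 0 ≤ insertionError p ε θ k l pend := by
  induction pend generalizing l with
  | nil => exact le_refl (0 : ℝ)
  | cons t rest ih =>
    exact add_nonneg (searchError_nonneg h0 h1 (Nat.succ_pos _) _ _
      (isPosterior_uniformPrior (Nat.succ_pos _)) _) (ih _)

lemma insertionError_le_succ {p : ℝ} (h0 : 0 < p) (h1 : p < 1 / 2) (ε : ℝ) (k : ℕ)
    (l pend : List (Fin n)) :
    insertionError p ε θ k l pend ≤ insertionError p ε θ (k + 1) l pend := by
  induction pend generalizing l with
  | nil => exact le_refl (0 : ℝ)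
  | cons t rest ih =>
    exact add_le_add (searchError_le_succ h0 h1 (Nat.succ_pos _) _ _
      (isPosterior_uniformPrior (Nat.succ_pos _)) _) (ih _)

open Classical in
/-- An upper bound for the probability of an error within the next `k` queries. -/
noncomputable def errorPotential (p : ℝ) (θ : Fin n → ℝ) (k : ℕ) (S : InsertionState n) : ℝ≥0∞ :=
  if IsSorted θ S then
    match S.pending with
    | [] => 0
    | t :: rest => ENNReal.ofReal
        (searchError p (S.sorted.length + 1) (targetError n) k S.posterior
          (gapIndex θ S.sorted t) + insertionError p (targetError n) θ k (S.sorted ++ [t]) rest)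
  else 1

lemma errorPotential_of_pending_cons {p : ℝ} {k : ℕ} {S : InsertionState n} {t : Fin n}
    {rest : List (Fin n)} (hS : IsSorted θ S) (hp : S.pending = t :: rest) :
    errorPotential p θ k S = ENNReal.ofReal
        (searchError p (S.sorted.length + 1) (targetError n) k S.posterior
          (gapIndex θ S.sorted t) +
            insertionError p (targetError n) θ k (S.sorted ++ [t]) rest) := by
  simp only [errorPotential, if_pos hS, hp]

lemma errorPotential_of_not {p : ℝ} {k : ℕ} {S : InsertionState n} (hS : ¬ IsSorted θ S) :
    errorPotential p θ k S = 1 := by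
  simp only [errorPotential, if_neg hS]

lemma errorPotential_uniformPrior {p : ℝ} {k : ℕ} {l pend : List (Fin n)}
    (hs : IsSorted θ ⟨l, pend, uniformPrior (l.length + 1)⟩) :
    errorPotential p θ k ⟨l, pend, uniformPrior (l.length + 1)⟩ =
      ENNReal.ofReal (insertionError p (targetError n) θ k l pend) := by
  rcases pend with _ | ⟨t, rest⟩
  · simp only [errorPotential, if_pos hs, insertionError, ENNReal.ofReal_zero]
  · rw [errorPotential_of_pending_cons hs rfl, insertionError]

/-- The recursion of `searchError` is the one-step mean of the chain. A wrong insertion, which makes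
the potential `1`, is paid for by the value `1` in that recursion; a right one starts the next
search, already accounted for in `insertionError`. -/
lemma stepMean_errorPotential (h0 : 0 < (p : ℝ)) (h1 : (p : ℝ) < 1 / 2) (hn : 2 ≤ n)
    (hθ : Function.Injective θ) (k : ℕ) (h : History n) :
    stepMean p θ r (fun h => errorPotential p θ k (stateAfter p r h)) h ≤
      errorPotential p θ (k + 1) (stateAfter p r h) := by
  classical
  have hv := valid_stateAfter h0 h1 hn r h
  by_cases hs : IsSorted θ (stateAfter p r h)
  swap
  · rw [errorPotential_of_not hs, stepMean_of_forall (c := 1)]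
    exact fun v b => errorPotential_of_not (not_isSorted_extendHistory hs v b)
  rcases hp : (stateAfter p r h).pending with _ | ⟨t, rest⟩
  · rw [stepMean_of_pending_nil hp]
    simp only [errorPotential, hp, le_refl]
  set S := stateAfter p r h with hS
  set g := gapIndex θ S.sorted t with hg
  have hgm : g < S.sorted.length + 1 := Nat.lt_succ_of_le (gapIndex_le _ _)
  have hI := insertionError_nonneg (θ := θ) h0 h1 (targetError n) k (S.sorted ++ [t]) rest
  set e : ℕ → Bool → ℝ := fun a y =>
      if SearchDone (S.sorted.length + 1) (targetError n) (bayesUpdate p S.posterior a y) then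
        if argmaxIndex (S.sorted.length + 1) (bayesUpdate p S.posterior a y) = g then 0 else 1
      else searchError p (S.sorted.length + 1) (targetError n) k (bayesUpdate p S.posterior a y) g
    with he
  have he0 : ∀ a < S.sorted.length + 1, ∀ y, 0 ≤ e a y := fun a ha y => by
    simp only [he]
    split_ifs
    · exact le_rfl
    · exact zero_le_one
    · exact searchError_nonneg h0 h1 (Nat.succ_pos _) _ _ (hv.isPosterior.bayes h0 h1 ha y) _
  have hstep := stepMean_le (θ := θ) (W := errorPotential p θ k)
    (w := fun a y => e a y + insertionError p (targetError n) θ k (S.sorted ++ [t]) rest)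
    h0 h1 hn hp hs (fun a ha y => add_nonneg (he0 a ha y) hI) (fun a ha y => by
    by_cases hd : SearchDone (S.sorted.length + 1) (targetError n) (bayesUpdate p S.posterior a y)
    · rw [InsertionState.respond_of_done hp hd]
      have hm : argmaxIndex (S.sorted.length + 1) (bayesUpdate p S.posterior a y) ≤
          S.sorted.length :=
        Nat.lt_succ_iff.1 (IsPosterior.argmaxIndex_spec (Nat.succ_pos _)).1
      generalize hi : argmaxIndex (S.sorted.length + 1) (bayesUpdate p S.posterior a y) = i at hm ⊢
      have hlen := List.length_insertIdx_of_le_length hm t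
      have hperm : (S.sorted.insertIdx i t).Perm (S.sorted ++ [t]) :=
        (List.perm_insertIdx t S.sorted hm).trans (List.perm_append_singleton t S.sorted).symm
      rw [← hlen]
      by_cases hs' : IsSorted θ ⟨S.sorted.insertIdx i t, rest,
          uniformPrior ((S.sorted.insertIdx i t).length + 1)⟩
      · rw [errorPotential_uniformPrior hs', insertionError_perm hperm]
        exact ENNReal.ofReal_le_ofReal (le_add_of_nonneg_left (he0 a ha y))
      · rw [errorPotential_of_not hs', ← ENNReal.ofReal_one]
        apply ENNReal.ofReal_le_ofReal
        -- Insertion at the true gap would have kept the list sorted.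
        have hne : i ≠ g := by
          rintro rfl
          exact hs' (pairwise_insertIdx_gapIndex hs fun x hx => hθ.ne (hv.ne_of_mem hp hx))
        simp only [he, if_pos hd, hi, if_neg hne]
        linarith
    · rw [InsertionState.respond_of_not_done hp hd]
      refine (errorPotential_of_pending_cons (S := ⟨S.sorted, t :: rest, _⟩) hs rfl).le.trans ?_
      simp only [he, if_neg hd]
      exact le_rfl)
  refine hstep.trans ?_
  rw [errorPotential_of_pending_cons hs hp]
  apply ENNReal.ofReal_le_ofReal
  simp only [responseMean_add, responseMean_const, queryMean_add, queryMean_const]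
  rw [searchError]
  -- The current search has used one query of its horizon; the later searches are simply granted one
  -- more.
  exact add_le_add_right (insertionError_le_succ h0 h1 _ _ _ _) _

end ErrorPotential

/-! ### Averaging over the renaming, and the bounds for the whole algorithm -/

section Bounds

variable {n : ℕ} {p : unitInterval} {θ : Fin n → ℝ}

lemma gapIndex_eq_insertionRank {v : Fin n → Fin n} (hv : Function.Injective v)
    {l₁ l₂ : List (Fin n)} {t : Fin n} (h : l₁ ++ t :: l₂ = List.ofFn v) {j : Fin n}
    (hj : (j : ℕ) = l₁.length) : gapIndex θ l₁ t = insertionRank (θ ∘ v) j := by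
  have hget (i : Fin n) : (l₁ ++ t :: l₂)[(i : ℕ)]? = some (v i) := by
    rw [h]; simp
  have ht : v j = t := by
    have := hget j
    rw [hj] at this
    simpa using this.symm
  have hnd : (l₁ ++ t :: l₂).Nodup := h ▸ List.nodup_ofFn.2 hv
  have hnd₁ : l₁.Nodup := (List.nodup_append.1 hnd).1
  have hmem (x : Fin n) : x ∈ l₁ ↔ ∃ i < j, v i = x := by
    have hlen : l₁.length < n := hj ▸ j.2
    constructor
    · intro hx
      obtain ⟨i, hi, rfl⟩ := List.getElem_of_mem hx
      refine ⟨⟨i, by omega⟩, by rw [Fin.lt_def]; simp only; omega, ?_⟩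
      have := hget ⟨i, by omega⟩
      simp only [List.getElem?_append_left hi, List.getElem?_eq_getElem hi, Option.some.injEq]
        at this
      exact this.symm
    · rintro ⟨i, hi, rfl⟩
      have hi' : (i : ℕ) < l₁.length := by rw [← hj]; exact hi
      have := hget i
      rw [List.getElem?_append_left hi', List.getElem?_eq_getElem hi', Option.some.injEq] at this
      rw [← this]
      exact List.getElem_mem hi'
  rw [gapIndex, List.countP_eq_length_filter, ← List.toFinset_card_of_nodup (hnd₁.filter _),
    insertionRank,
    ← Finset.card_image_of_injective (Finset.univ.filter fun i => i < j ∧ (θ ∘ v) i < (θ ∘ v) j) hv]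
  congr 1
  ext x
  simp only [List.mem_toFinset, List.mem_filter, hmem, decide_eq_true_eq, Finset.mem_image,
    Finset.mem_filter, Finset.mem_univ, true_and, Function.comp_apply, ht]
  constructor
  · rintro ⟨⟨i, hi, rfl⟩, h'⟩
    exact ⟨i, ⟨hi, h'⟩, rfl⟩
  · rintro ⟨i, ⟨hi, h'⟩, rfl⟩
    exact ⟨⟨i, hi, rfl⟩, h'⟩

/-- Items are inserted in the order `v`, so the true gap of the `j`-th one is its rank among its
predecessors. This puts the union bound in a form to which `sum_perm_insertionRank` applies. -/
lemma insertionError_eq_sum {p ε : ℝ} {k : ℕ} {v : Fin n → Fin n} (hv : Function.Injective v)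
    {l₁ l₂ : List (Fin n)} (h : l₁ ++ l₂ = List.ofFn v) :
    insertionError p ε θ k l₁ l₂ = ∑ j ∈ Finset.univ.filter fun j : Fin n => l₁.length ≤ j,
      searchError p (j + 1) ε k (uniformPrior (j + 1)) (insertionRank (θ ∘ v) j) := by
  induction l₂ generalizing l₁ with
  | nil =>
    have hlen : l₁.length = n := by simpa using congrArg List.length h
    rw [insertionError, Finset.sum_eq_zero]
    intro j hj
    have := (Finset.mem_filter.1 hj).2
    omega
  | cons t rest ih =>
    have hlen : l₁.length < n := by
      have := congrArg List.length h
      simp at this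
      omega
    have hsplit : (Finset.univ.filter fun j : Fin n => l₁.length ≤ j) =
        insert ⟨l₁.length, hlen⟩ (Finset.univ.filter fun j : Fin n => (l₁ ++ [t]).length ≤ j) := by
      ext j
      simp only [Finset.mem_filter, Finset.mem_univ, true_and, Finset.mem_insert, Fin.ext_iff,
        List.length_append, List.length_singleton]
      omega
    rw [insertionError, ih (by simpa using h), hsplit, Finset.sum_insert (by simp),
      gapIndex_eq_insertionRank hv h (j := ⟨l₁.length, hlen⟩) rfl]

/-- Averaged over the renaming, the error potential of the initial state is small. -/
lemma sum_errorPotential_le (h0 : 0 < (p : ℝ)) (h1 : (p : ℝ) < 1 / 2) (hn : 2 ≤ n)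
    (hθ : Function.Injective θ) (k : ℕ) :
    ∑ r : Equiv.Perm (Fin n), ((Fintype.card (Equiv.Perm (Fin n)) : ℝ≥0∞)⁻¹ *
      errorPotential p θ k (stateAfter p r [])) ≤ ENNReal.ofReal (1 / Real.logb 2 n) := by
  have hε := targetError_pos hn
  set N : ℕ := Fintype.card (Equiv.Perm (Fin n)) with hN
  have hN0 : 0 < N := Fintype.card_pos
  have hN0' : (0 : ℝ) < N := by exact_mod_cast hN0
  have hlist (r : Equiv.Perm (Fin n)) :
      (List.finRange n).reverse.map r = List.ofFn (r ∘ Fin.rev) := by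
    rw [List.finRange_reverse, List.map_map, List.ofFn_eq_map]
  have hU (r : Equiv.Perm (Fin n)) : errorPotential p θ k (stateAfter p r []) =
      ENNReal.ofReal (∑ j ∈ Finset.univ.filter fun j : Fin n => 1 ≤ (j : ℕ),
        searchError p (j + 1) (targetError n) k (uniformPrior (j + 1)) (insertionRank (θ ∘ (r ∘ Fin.rev)) j)) := by
    have hl : ((List.finRange n).reverse.map r).length = n := by simp
    have htake : (((List.finRange n).reverse.map r).take 1).length = 1 := by
      rw [List.length_take]; omega
    have hs : stateAfter p r [] = ⟨((List.finRange n).reverse.map r).take 1,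
        ((List.finRange n).reverse.map r).drop 1,
        uniformPrior ((((List.finRange n).reverse.map r).take 1).length + 1)⟩ := by
      rw [htake]; rfl
    obtain ⟨x, hx⟩ := List.length_eq_one_iff.1 htake
    have hsorted : IsSorted θ ⟨((List.finRange n).reverse.map r).take 1,
        ((List.finRange n).reverse.map r).drop 1,
        uniformPrior ((((List.finRange n).reverse.map r).take 1).length + 1)⟩ := by
      simp only [IsSorted, hx, List.pairwise_singleton]
    rw [hs, errorPotential_uniformPrior hsorted, insertionError_eq_sum
      (r.injective.comp Fin.rev_injective) ((List.take_append_drop _ _).trans (hlist r)), htake]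
  simp_rw [hU]
  rw [← Finset.mul_sum, ← ENNReal.ofReal_sum_of_nonneg, ← ENNReal.ofReal_natCast,
    ← ENNReal.ofReal_inv_of_pos hN0', ← ENNReal.ofReal_mul (by positivity)]
  swap
  · exact fun r _ => Finset.sum_nonneg fun j _ => searchError_nonneg h0 h1 (Nat.succ_pos _) _ _
      (isPosterior_uniformPrior (Nat.succ_pos _)) _
  apply ENNReal.ofReal_le_ofReal
  rw [inv_mul_le_iff₀ hN0', Finset.sum_comm]
  -- The rank at `j` is uniform on `j + 1` values, so the average over renamings is the mean of the
  -- search error under the uniform prior. The reversal of the order of insertion only reindexes the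
  -- renamings.
  have hj (j : Fin n) (hj : j ∈ Finset.univ.filter fun j : Fin n => 1 ≤ (j : ℕ)) :
      ∑ r : Equiv.Perm (Fin n), searchError p (j + 1) (targetError n) k
        (uniformPrior (j + 1)) (insertionRank (θ ∘ (r ∘ Fin.rev)) j) ≤ N * targetError n := by
    have hj1 : 1 ≤ (j : ℕ) := (Finset.mem_filter.1 hj).2
    have e1 := sum_perm_insertionRank hθ j fun g =>
      searchError p (j + 1) (targetError n) k (uniformPrior (j + 1)) g
    have e2 := (isPosterior_uniformPrior (Nat.succ_pos j)).sum_mul_searchError_le h0 h1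
      (by omega) hε k
    simp only [uniformPrior] at e2
    rw [← Finset.mul_sum] at e2
    have e3 : ∑ r : Equiv.Perm (Fin n), searchError p (j + 1) (targetError n) k
        (uniformPrior (j + 1)) (insertionRank (θ ∘ (r ∘ Fin.rev)) j) =
        ∑ v : Equiv.Perm (Fin n), searchError p (j + 1) (targetError n) k
        (uniformPrior (j + 1)) (insertionRank (θ ∘ v) j) :=
      Equiv.sum_comp (Equiv.mulRight Fin.revPerm) fun v : Equiv.Perm (Fin n) =>
        searchError p (j + 1) (targetError n) k (uniformPrior (j + 1)) (insertionRank (θ ∘ v) j)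
    rw [e3]
    have hjp : (0 : ℝ) < j + 1 := by positivity
    have e4 : ∑ v : Equiv.Perm (Fin n), searchError p (j + 1) (targetError n) k
        (uniformPrior (j + 1)) (insertionRank (θ ∘ v) j) =
        N * (1 / (j + 1 : ℝ) * ∑ g ∈ Finset.range (j + 1), searchError p (j + 1) (targetError n) k
          (uniformPrior (j + 1)) g) := by
      rw [← mul_right_inj' hjp.ne', e1]
      field_simp
      exact mul_comm _ _
    rw [e4]
    refine mul_le_mul_of_nonneg_left ?_ hN0'.le
    simpa [uniformPrior] using e2
  refine (Finset.sum_le_sum hj).trans ?_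
  rw [Finset.sum_const, nsmul_eq_mul]
  have hcard : ((Finset.univ.filter fun j : Fin n => 1 ≤ (j : ℕ)).card : ℝ) ≤ n := by
    exact_mod_cast (Finset.card_le_univ _).trans_eq (Fintype.card_fin n)
  have hnε : n * targetError n = 1 / Real.logb 2 n := by
    have : (n : ℝ) ≠ 0 := by positivity
    rw [targetError]
    field_simp
  calc _ ≤ (n : ℝ) * (N * targetError n) := by gcongr
    _ = N * (1 / Real.logb 2 n) := by rw [← hnε]; ring

/-- A complete list is always a permutation, so the default value of `toPerm` is never used. Hence
an unsorted list cannot yield the right output by accident. -/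
lemma InsertionState.Valid.ofFn_toPerm {ε : ℝ} {S : InsertionState n} (hS : S.Valid ε)
    (hp : S.pending = []) : List.ofFn S.toPerm = S.sorted := by
  have hlen : S.sorted.length = n := by simpa [hp] using hS.length_add
  have hinj : Function.Injective fun i : Fin n => S.sorted[(i : ℕ)]'(by omega) := by
    intro i j hij
    exact Fin.ext (hS.nodup_sorted.getElem_inj_iff.1 hij)
  have h : ∃ e : Equiv.Perm (Fin n), List.ofFn e = S.sorted := by
    refine ⟨Equiv.ofBijective _ (Finite.injective_iff_bijective.1 hinj), ?_⟩
    apply List.ext_getElem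
    · simp [hlen]
    · intro i h1 h2
      simp
  rw [InsertionState.toPerm, dif_pos h]
  exact h.choose_spec

/-- The state of the algorithm at time `k`. -/
noncomputable def stateAt (p : ℝ) (θ : Fin n → ℝ)
    (ω : (Equiv.Perm (Fin n) × (ℕ → unitInterval)) × (ℕ → Bool)) (k : ℕ) : InsertionState n :=
  stateAfter p ω.1.1 (runHistory p θ ω.1.1 k (ω.1.2, ω.2))

lemma isSorted_stateAt_of_succ (h0 : 0 < (p : ℝ)) (h1 : (p : ℝ) < 1 / 2) (hn : 2 ≤ n)
    {ω : (Equiv.Perm (Fin n) × (ℕ → unitInterval)) × (ℕ → Bool)} {k : ℕ}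
    (h : IsSorted θ (stateAt p θ ω (k + 1))) : IsSorted θ (stateAt p θ ω k) := by
  by_contra hc
  rw [stateAt, runHistory_succ h0 h1 hn] at h
  exact not_isSorted_extendHistory hc _ _ h

lemma isSorted_stateAt_of_le (h0 : 0 < (p : ℝ)) (h1 : (p : ℝ) < 1 / 2) (hn : 2 ≤ n)
    {ω : (Equiv.Perm (Fin n) × (ℕ → unitInterval)) × (ℕ → Bool)} {j k : ℕ} (hjk : j ≤ k)
    (h : IsSorted θ (stateAt p θ ω k)) : IsSorted θ (stateAt p θ ω j) := by
  induction k, hjk using Nat.le_induction with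
  | base => exact h
  | succ k _ ih => exact ih (isSorted_stateAt_of_succ h0 h1 hn h)

/-- The algorithm outputs the right order iff it stops and never makes an error. -/
lemma mem_outputs_iff (h0 : 0 < (p : ℝ)) (h1 : (p : ℝ) < 1 / 2) (hn : 2 ≤ n)
    {π : Equiv.Perm (Fin n)} (hπ : StrictMono (θ ∘ π))
    (ω : (Equiv.Perm (Fin n) × (ℕ → unitInterval)) × (ℕ → Bool)) :
    ω ∈ (vlbzSort p n).outputs θ π ↔
      (∃ k, (stateAt p θ ω k).pending = []) ∧ ∀ k, IsSorted θ (stateAt p θ ω k) := by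
  have hst (k : ℕ) : (vlbzSort p n).StoppedAt θ ω k ↔ (stateAt p θ ω k).pending = [] :=
    stoppedAt_iff h0 h1 hn k (ω.1.2, ω.2)
  have hv (k : ℕ) : (stateAt p θ ω k).Valid (targetError n) := valid_stateAfter h0 h1 hn _ _
  constructor
  · rintro ⟨k, hk, he⟩
    have hk' := (hst k).1 hk
    have he' : (stateAt p θ ω k).toPerm = π := he
    refine ⟨⟨k, hk'⟩, fun j => ?_⟩
    have hsk : IsSorted θ (stateAt p θ ω k) := by
      rw [IsSorted, ← (hv k).ofFn_toPerm hk', he', List.pairwise_ofFn]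
      exact fun i j hij => hπ hij
    rcases le_total j k with hjk | hkj
    · exact isSorted_stateAt_of_le h0 h1 hn hjk hsk
    · have : stateAt p θ ω j = stateAt p θ ω k := by
        rw [stateAt, stateAt]
        congr 1
        exact SortingCode.history_of_stoppedAt (c := vlbzSort p n) (ω := ω) hk hkj
      rwa [this]
  · rintro ⟨⟨k, hk⟩, hs⟩
    exact ⟨k, (hst k).2 hk, (hv k).toPerm_eq hk (hs k) hπ⟩

lemma measurable_stateAt {α : Type*} [MeasurableSpace α] (f : InsertionState n → α) (k : ℕ) :
    Measurable fun ω : (Equiv.Perm (Fin n) × (ℕ → unitInterval)) × (ℕ → Bool) =>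
      f (stateAt p θ ω k) := by
  have h1 : Measurable fun ω : (Equiv.Perm (Fin n) × (ℕ → unitInterval)) × (ℕ → Bool) =>
      (vlbzSort p n).history θ ω.1 ω.2 k :=
    SortingCode.measurable_history (c := vlbzSort p n) (θ := θ) k
  have h2 : Measurable fun x : Equiv.Perm (Fin n) × History n => f (stateAfter p x.1 x.2) :=
    measurable_of_countable _
  exact h2.comp ((measurable_fst.comp measurable_fst).prodMk h1)

open Classical in
/-- The number of queries that are made before the first error. -/
noncomputable def liveTime (p : ℝ) (θ : Fin n → ℝ)
    (ω : (Equiv.Perm (Fin n) × (ℕ → unitInterval)) × (ℕ → Bool)) : ℝ≥0∞ :=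
  ∑' k, if IsSorted θ (stateAt p θ ω k) ∧ (stateAt p θ ω k).pending ≠ [] then 1 else 0

lemma measurable_liveTime : Measurable (liveTime (n := n) p θ) := by
  classical
  exact Measurable.tsum fun k => measurable_stateAt
    (fun S => if IsSorted θ S ∧ S.pending ≠ [] then (1 : ℝ≥0∞) else 0) k

lemma sum_card_inv_mul_le {f : Equiv.Perm (Fin n) → ℝ≥0∞} {c : ℝ≥0∞} (h : ∀ r, f r ≤ c) :
    ∑ r : Equiv.Perm (Fin n), ((Fintype.card (Equiv.Perm (Fin n)) : ℝ≥0∞)⁻¹ * f r) ≤ c := by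
  calc _ ≤ ∑ r : Equiv.Perm (Fin n), ((Fintype.card (Equiv.Perm (Fin n)) : ℝ≥0∞)⁻¹ * c) := by
        gcongr with r
        exact h r
    _ = c := by
        rw [Finset.sum_const, Finset.card_univ, nsmul_eq_mul, ← mul_assoc,
          ENNReal.mul_inv_cancel (by simp) (ENNReal.natCast_ne_top _), one_mul]

lemma lintegral_liveTime_le (h0 : 0 < (p : ℝ)) (h1 : (p : ℝ) < 1 / 2) (hn : 2 ≤ n) :
    ∫⁻ ω, liveTime (n := n) p θ ω ∂((vlbzSort p n).runLaw p) ≤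
      ENNReal.ofReal (n * searchLength p n) := by
  classical
  refine (lintegral_runLaw_vlbzSort p (f := liveTime p θ) measurable_liveTime).trans_le ?_
  refine sum_card_inv_mul_le fun r => ?_
  refine le_trans (le_of_eq ?_) (tsum_measure_sorted_le (θ := θ) (r := r) h0 h1 hn)
  refine lintegral_tsum fun k => Measurable.aemeasurable ?_
  exact (measurable_of_countable fun h : History n =>
    if IsSorted θ (stateAfter p r h) ∧ (stateAfter p r h).pending ≠ [] then (1 : ℝ≥0∞) else 0).comp
    (measurable_runHistory k)

/-- The mean number of queries on the event that the output is right. -/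
theorem lintegral_outputs_queryCount_le (h0 : 0 < (p : ℝ)) (h1 : (p : ℝ) < 1 / 2) (hn : 2 ≤ n)
    {π : Equiv.Perm (Fin n)} (hπ : StrictMono (θ ∘ π)) :
    ∫⁻ ω in (vlbzSort p n).outputs θ π, ((vlbzSort p n).queryCount θ ω : ℝ≥0∞)
      ∂((vlbzSort p n).runLaw p) ≤ ENNReal.ofReal (n * searchLength p n) := by
  classical
  refine le_trans ?_ (lintegral_liveTime_le (θ := θ) h0 h1 hn)
  rw [← lintegral_indicator (SortingCode.measurableSet_outputs π)]
  refine lintegral_mono fun ω => ?_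
  refine Set.indicator_apply_le fun hω => ?_
  have hs := (mem_outputs_iff h0 h1 hn hπ ω).1 hω
  rw [SortingCode.queryCount_eq_tsum]
  refine ENNReal.tsum_le_tsum fun k => ?_
  have hst : (vlbzSort p n).StoppedAt θ ω k ↔ (stateAt p θ ω k).pending = [] :=
    stoppedAt_iff h0 h1 hn k (ω.1.2, ω.2)
  by_cases h : (vlbzSort p n).StoppedAt θ ω k
  · rw [if_pos h]; exact zero_le
  · rw [if_neg h, if_pos ⟨hs.2 k, fun h' => h (hst.2 h')⟩]

/-- The probability that the output is wrong. -/
theorem runLaw_outputs_compl_le (h0 : 0 < (p : ℝ)) (h1 : (p : ℝ) < 1 / 2) (hn : 2 ≤ n)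
    {π : Equiv.Perm (Fin n)} (hπ : StrictMono (θ ∘ π)) :
    (vlbzSort p n).runLaw p ((vlbzSort p n).outputs θ π)ᶜ ≤
      ENNReal.ofReal (1 / Real.logb 2 n) := by
  classical
  have hθ : Function.Injective θ := by
    have := hπ.injective.comp π.symm.injective
    simpa [Function.comp_assoc] using this
  -- A failure means either a wrong list at some time or a run that stays sorted forever without
  -- stopping. The latter has `liveTime = ∞`, a null event because the mean of `liveTime` is finite.
  set bad : ℕ → Set ((vlbzSort p n).Seed × (ℕ → Bool)) :=
    fun k => {ω | ¬ IsSorted θ (stateAt p θ ω k)} with hbad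
  have hbadm (k : ℕ) : MeasurableSet (bad k) :=
    measurable_stateAt (p := p) (θ := θ) (fun S => ¬ IsSorted θ S) k (MeasurableSet.singleton True)
      |>.congr (by ext; simp only [Set.mem_preimage, Set.mem_singleton_iff, eq_iff_iff, iff_true]; rfl)
  have hsub : ((vlbzSort p n).outputs θ π)ᶜ ⊆
      (⋃ k, bad k) ∪ {ω | ¬ liveTime (n := n) p θ ω < ⊤} := by
    intro ω hω
    by_cases hb : ω ∈ ⋃ k, bad k
    · exact Or.inl hb
    · refine Or.inr ?_
      have hs : ∀ k, IsSorted θ (stateAt p θ ω k) := by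
        intro k
        by_contra hk
        exact hb (Set.mem_iUnion.2 ⟨k, hk⟩)
      have hp : ∀ k, (stateAt p θ ω k).pending ≠ [] := fun k hk =>
        hω ((mem_outputs_iff h0 h1 hn hπ ω).2 ⟨⟨k, hk⟩, hs⟩)
      change ¬ liveTime (n := n) p θ ω < ⊤
      simp only [liveTime]
      simp [hs, hp]
  have hlive : (vlbzSort p n).runLaw p {ω | ¬ liveTime (n := n) p θ ω < ⊤} = 0 :=
    ae_lt_top (measurable_liveTime (n := n) (p := p) (θ := θ))
      ((lintegral_liveTime_le (θ := θ) h0 h1 hn).trans_lt ENNReal.ofReal_lt_top).ne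
  refine (measure_mono hsub).trans ((measure_union_le _ _).trans ?_)
  rw [hlive, add_zero]
  -- A wrong list is never repaired, so the events increase and a bound uniform in `k` suffices.
  have hmono : Monotone bad := fun j k hjk ω hω h => hω (isSorted_stateAt_of_le h0 h1 hn hjk h)
  rw [hmono.measure_iUnion]
  refine iSup_le fun k => ?_
  rw [← lintegral_indicator_one (hbadm k)]
  -- At horizon `0` the potential still dominates the indicator of a wrong list; going back `k`
  -- steps raises the horizon to `k`.
  calc _ ≤ ∫⁻ ω, errorPotential p θ 0 (stateAt p θ ω k) ∂((vlbzSort p n).runLaw p) := by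
        refine lintegral_mono fun ω => ?_
        by_cases hω : ω ∈ bad k
        · rw [Set.indicator_of_mem hω, errorPotential_of_not hω]
          exact le_rfl
        · rw [Set.indicator_of_notMem hω]
          exact zero_le
    _ = ∑ r : Equiv.Perm (Fin n), ((Fintype.card (Equiv.Perm (Fin n)) : ℝ≥0∞)⁻¹ *
        ∫⁻ x, errorPotential p θ 0 (stateAfter p r (runHistory p θ r k x)) ∂(pathLaw p)) :=
        lintegral_runLaw_vlbzSort p (f := fun ω => errorPotential p θ 0 (stateAt p θ ω k))
          (measurable_stateAt _ k)
    _ ≤ ∑ r : Equiv.Perm (Fin n), ((Fintype.card (Equiv.Perm (Fin n)) : ℝ≥0∞)⁻¹ *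
        errorPotential p θ k (stateAfter p r [])) := by
        gcongr with r
        have := lintegral_le_of_stepMean_le (θ := θ) (r := r) h0 h1 hn
          (U := fun k h => errorPotential p θ k (stateAfter p r h))
          (stepMean_errorPotential h0 h1 hn hθ) k 0
        simpa using this
    _ ≤ _ := sum_errorPotential_le h0 h1 hn hθ k

end Bounds

/-! ### Truncated codes -/

namespace SortingCode

variable {n : ℕ} {c : SortingCode n} {θ : Fin n → ℝ} {N : ℕ}

lemma history_truncate {s : c.Seed} {z : ℕ → Bool} {k : ℕ} (hk : k ≤ N) :
    (c.truncate N).history θ s z k = c.history θ s z k := by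
  induction k with
  | zero => rfl
  | succ k ih =>
    have hlt : (c.history θ s z k).length < N := (length_history_le s z k).trans_lt hk
    have hnext : (c.truncate N).next s ((c.truncate N).history θ s z k) =
        c.next s (c.history θ s z k) := by
      rw [ih (by omega)]
      exact if_pos hlt
    rcases hq : c.next s (c.history θ s z k) with _ | q
    · rw [history_succ_of_none hq, history_succ_of_none (hnext.trans hq), ih (by omega)]
    · rw [history_succ_of_some hq, history_succ_of_some (hnext.trans hq), ih (by omega)]

lemma stoppedAt_truncate {ω : c.Seed × (ℕ → Bool)} {k : ℕ} (hk : k ≤ N) (h : c.StoppedAt θ ω k) :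
    (c.truncate N).StoppedAt θ ω k := by
  have : (c.truncate N).next ω.1 ((c.truncate N).history θ ω.1 ω.2 k) = none := by
    rw [history_truncate hk]
    change (if _ then _ else _) = _
    split_ifs
    · exact h
    · rfl
  exact this

lemma stoppedAt_truncate_self (ω : c.Seed × (ℕ → Bool)) : (c.truncate N).StoppedAt θ ω N := by
  by_cases h : c.StoppedAt θ ω N
  · exact stoppedAt_truncate le_rfl h
  · have hlen := length_history_of_not_stoppedAt h
    have : (c.truncate N).next ω.1 ((c.truncate N).history θ ω.1 ω.2 N) = none := by
      rw [history_truncate le_rfl]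
      exact if_neg (by omega)
    exact this

lemma queryCount_truncate_le (ω : c.Seed × (ℕ → Bool)) :
    (c.truncate N).queryCount θ ω ≤ N :=
  queryCount_le_of_stoppedAt (c := c.truncate N) (stoppedAt_truncate_self ω)

lemma queryCount_truncate_le_queryCount (ω : c.Seed × (ℕ → Bool)) :
    (c.truncate N).queryCount θ ω ≤ c.queryCount θ ω := by
  refine le_iInf₂ fun k hk => ?_
  rcases le_total k N with h | h
  · exact queryCount_le_of_stoppedAt (c := c.truncate N) (stoppedAt_truncate h hk)
  · exact (queryCount_truncate_le ω).trans (by exact_mod_cast h)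

lemma mem_outputs_truncate {ω : c.Seed × (ℕ → Bool)} {π : Equiv.Perm (Fin n)}
    (h : ω ∈ c.outputs θ π) (hN : c.queryCount θ ω ≤ N) : ω ∈ (c.truncate N).outputs θ π := by
  obtain ⟨k, hk, he⟩ := h
  obtain ⟨j, hjN, hj⟩ : ∃ j ≤ N, c.StoppedAt θ ω j := by
    by_contra hc
    push Not at hc
    have : ((N + 1 : ℕ) : ℕ∞) ≤ c.queryCount θ ω := by
      refine le_iInf₂ fun j hj => ?_
      have : N < j := by
        by_contra h'
        exact hc j (not_lt.1 h') hj
      exact_mod_cast this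
    have := this.trans hN
    norm_cast at this
    omega
  have hjk : c.history θ ω.1 ω.2 j = c.history θ ω.1 ω.2 k := by
    rcases le_total j k with h | h
    · exact (history_of_stoppedAt hj h).symm
    · exact history_of_stoppedAt hk h
  refine ⟨j, stoppedAt_truncate hjN hj, ?_⟩
  change c.estimate ω.1 ((c.truncate N).history θ ω.1 ω.2 j) = π
  rw [history_truncate hjN, hjk, he]

/-- Truncation spoils a right output only if more than `N` queries were needed. Markov's inequality
is applied on the event of a right output only, as `M` has no controlled mean elsewhere. -/
lemma runLaw_outputs_truncate_compl_le {p : unitInterval} (hN : 0 < N) (π : Equiv.Perm (Fin n)) :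
    (c.truncate N).runLaw p ((c.truncate N).outputs θ π)ᶜ ≤
      c.runLaw p (c.outputs θ π)ᶜ +
        (∫⁻ ω in c.outputs θ π, (c.queryCount θ ω : ℝ≥0∞) ∂(c.runLaw p)) / N := by
  have hsub : ((c.truncate N).outputs θ π)ᶜ ⊆
      (c.outputs θ π)ᶜ ∪ ({ω | (N : ℝ≥0∞) ≤ c.queryCount θ ω} ∩ c.outputs θ π) := by
    intro ω hω
    by_cases h : ω ∈ c.outputs θ π
    · refine Or.inr ⟨?_, h⟩
      have : (N : ℕ∞) ≤ c.queryCount θ ω := by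
        by_contra hc
        exact hω (mem_outputs_truncate h (not_le.1 hc).le)
      change (N : ℝ≥0∞) ≤ (c.queryCount θ ω : ℝ≥0∞)
      exact_mod_cast this
    · exact Or.inl h
  have hmarkov : c.runLaw p ({ω | (N : ℝ≥0∞) ≤ c.queryCount θ ω} ∩ c.outputs θ π) ≤
      (∫⁻ ω in c.outputs θ π, (c.queryCount θ ω : ℝ≥0∞) ∂(c.runLaw p)) / N := by
    rw [← Measure.restrict_apply (measurableSet_le measurable_const measurable_queryCount)]
    exact meas_ge_le_lintegral_div measurable_queryCount.aemeasurable (by simpa using hN.ne')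
      (ENNReal.natCast_ne_top N)
  have h := (measure_mono (μ := c.runLaw p) hsub).trans (measure_union_le _ _)
  exact h.trans (add_le_add le_rfl hmarkov)

/-- On the event of a right output truncation does not increase the count; on its complement the
count is at most `N`. -/
lemma expectedQueries_truncate_le {p : unitInterval} (π : Equiv.Perm (Fin n)) :
    (c.truncate N).expectedQueries p θ ≤
      (∫⁻ ω in c.outputs θ π, (c.queryCount θ ω : ℝ≥0∞) ∂(c.runLaw p)) +
        N * c.runLaw p (c.outputs θ π)ᶜ := by
  have hlaw : (c.truncate N).expectedQueries p θ =
      ∫⁻ ω, ((c.truncate N).queryCount θ ω : ℝ≥0∞) ∂(c.runLaw p) := rfl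
  rw [hlaw, ← lintegral_add_compl _ (measurableSet_outputs (c := c) (θ := θ) π)]
  refine add_le_add (lintegral_mono fun ω => ?_) ?_
  · exact ENat.toENNReal_mono (queryCount_truncate_le_queryCount ω)
  · rw [← setLIntegral_const]
    refine lintegral_mono fun ω => ?_
    exact (ENat.toENNReal_mono (queryCount_truncate_le ω)).trans_eq (ENat.toENNReal_coe N)

end SortingCode

/-! ### Asymptotics -/

/-- The cap on the number of queries. -/
noncomputable def queryCap (n : ℕ) : ℕ := ⌈n * Real.logb 2 n * √(Real.logb 2 n)⌉₊

lemma tendsto_logb_natCast : Tendsto (fun n : ℕ => Real.logb 2 n) atTop atTop :=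
  (Real.tendsto_logb_atTop one_lt_two).comp tendsto_natCast_atTop_atTop

lemma searchLength_eq {p : ℝ} {n : ℕ} (hn : 2 ≤ n) :
    searchLength p n = (2 * Real.logb 2 n + Real.logb 2 (Real.logb 2 n) +
      Real.logb 2 ((1 - p) / p)) / (1 - entropy p) := by
  have h1 := one_le_logb hn
  rw [searchLength, oddsBound, targetError, one_div, Real.logb_inv,
    Real.logb_mul (by positivity) (by linarith)]
  ring

/-- The `2` is one `log₂ n` from the initial log-odds and one from `log₂ (1/ε) = log₂ n + log₂ log₂
n`. -/
lemma tendsto_searchLength_div {p : ℝ} :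
    Tendsto (fun n : ℕ => searchLength p n / Real.logb 2 n) atTop (𝓝 (2 / (1 - entropy p))) := by
  have hlog : Tendsto (fun x : ℝ => Real.logb 2 x / x) atTop (𝓝 0) := by
    have := (Real.tendsto_pow_log_div_mul_add_atTop 1 0 1 one_ne_zero).div_const (Real.log 2)
    simp only [pow_one, one_mul, add_zero, zero_div] at this
    refine this.congr fun x => ?_
    rw [Real.logb, div_right_comm]
  have hconst : Tendsto (fun x : ℝ => Real.logb 2 ((1 - p) / p) / x) atTop (𝓝 0) :=
    tendsto_const_nhds.div_atTop tendsto_id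
  have h := (((hlog.comp tendsto_logb_natCast).add (hconst.comp tendsto_logb_natCast)).const_add
    2).div_const (1 - entropy p)
  simp only [add_zero] at h
  refine h.congr' ?_
  filter_upwards [eventually_ge_atTop 2] with n hn
  have h1 := one_le_logb hn
  have h2 : Real.logb 2 n ≠ 0 := by linarith
  rw [searchLength_eq hn]
  simp only [Function.comp_apply]
  rw [div_right_comm]
  congr 1
  field_simp
  ring

lemma queryCap_pos {n : ℕ} (hn : 2 ≤ n) : 0 < queryCap n := by
  have h1 := one_le_logb hn
  rw [queryCap, Nat.ceil_pos]
  positivity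

/-- The bound on the expected number of queries of the truncated algorithm. -/
lemma eventually_query_bound_le {p : ℝ} (h1 : p < 1 / 2) {R : ℝ} (hR0 : 0 < R)
    (hR : R < (1 - entropy p) / 2) :
    ∀ᶠ n : ℕ in atTop, n * searchLength p n + queryCap n * (1 / Real.logb 2 n) ≤
      n * Real.logb 2 n / R := by
  have hC := one_sub_entropy_pos h1
  have hsqrt : Tendsto (fun n : ℕ => 1 / √(Real.logb 2 n)) atTop (𝓝 0) :=
    tendsto_const_nhds.div_atTop (Real.tendsto_sqrt_atTop.comp tendsto_logb_natCast)
  have hinv : Tendsto (fun n : ℕ => 1 / Real.logb 2 n) atTop (𝓝 0) :=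
    tendsto_const_nhds.div_atTop tendsto_logb_natCast
  have h := (tendsto_searchLength_div (p := p)).add (hsqrt.add hinv)
  have hlt : 2 / (1 - entropy p) + (0 + 0) < 1 / R := by
    rw [add_zero, add_zero, div_lt_div_iff₀ hC hR0]
    linarith
  filter_upwards [h.eventually_le_const hlt, eventually_ge_atTop 2] with n hb hn
  have hl := one_le_logb hn
  have hl0 : 0 < Real.logb 2 n := by linarith
  have hn1 : (1 : ℝ) ≤ n := by exact_mod_cast (by omega : 1 ≤ n)
  have hs0 : 0 < √(Real.logb 2 n) := Real.sqrt_pos.2 hl0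
  have hss := Real.mul_self_sqrt hl0.le
  have hcap : (queryCap n : ℝ) ≤ n * Real.logb 2 n * √(Real.logb 2 n) + 1 :=
    (Nat.ceil_lt_add_one (by positivity)).le
  -- The capped runs that fail contribute a vanishing fraction of `n log₂ n`; the summand `1 / log₂
  -- n` absorbs the rounding up in the cap.
  have e1 : queryCap n * (1 / Real.logb 2 n) ≤
      n * Real.logb 2 n * (1 / √(Real.logb 2 n) + 1 / Real.logb 2 n) := by
    rw [mul_one_div, div_le_iff₀ hl0]
    have : n * Real.logb 2 n * (1 / √(Real.logb 2 n) + 1 / Real.logb 2 n) * Real.logb 2 n =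
        n * Real.logb 2 n * √(Real.logb 2 n) + n * Real.logb 2 n := by
      have : 1 / √(Real.logb 2 n) * Real.logb 2 n = √(Real.logb 2 n) := by
        rw [one_div, inv_mul_eq_iff_eq_mul₀ hs0.ne', hss]
      have h2 : 1 / Real.logb 2 n * Real.logb 2 n = 1 := by
        rw [one_div, inv_mul_cancel₀ hl0.ne']
      rw [mul_assoc, add_mul, this, h2]
      ring
    rw [this]
    nlinarith
  have e2 : n * searchLength p n = n * Real.logb 2 n * (searchLength p n / Real.logb 2 n) := by
    field_simp
  have e3 := mul_le_mul_of_nonneg_left hb (by positivity : 0 ≤ n * Real.logb 2 n)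
  rw [mul_one_div] at e3
  rw [mul_add] at e3
  linarith

/-- The extra factor `√(log₂ n)` in the cap makes it dominate the mean, so truncation costs no
reliability in the limit. -/
lemma tendsto_query_bound_div_cap {p : ℝ} (h0 : 0 < p) (h1 : p < 1 / 2) :
    Tendsto (fun n : ℕ => n * searchLength p n / queryCap n) atTop (𝓝 0) := by
  have hsqrt : Tendsto (fun n : ℕ => 1 / √(Real.logb 2 n)) atTop (𝓝 0) :=
    tendsto_const_nhds.div_atTop (Real.tendsto_sqrt_atTop.comp tendsto_logb_natCast)
  have h := (tendsto_searchLength_div (p := p)).mul hsqrt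
  rw [mul_zero] at h
  refine squeeze_zero' ?_ ?_ h
  · filter_upwards [eventually_ge_atTop 2] with n hn
    have := searchLength_nonneg h0 h1 hn
    positivity
  · filter_upwards [eventually_ge_atTop 2] with n hn
    have hD := searchLength_nonneg h0 h1 hn
    have hl := one_le_logb hn
    have hl0 : 0 < Real.logb 2 n := by linarith
    have hs0 : 0 < √(Real.logb 2 n) := Real.sqrt_pos.2 hl0
    have hn0 : (0 : ℝ) < n := by exact_mod_cast (by omega : 0 < n)
    have hcap : n * Real.logb 2 n * √(Real.logb 2 n) ≤ queryCap n := Nat.le_ceil _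
    calc n * searchLength p n / queryCap n ≤
        n * searchLength p n / (n * Real.logb 2 n * √(Real.logb 2 n)) := by gcongr
      _ = _ := by field_simp

/-! ### The insertion sort attains the rate -/

section Main

variable {p : unitInterval}

lemma exists_strictMono_comp {n : ℕ} {θ : Fin n → ℝ} (hθ : Function.Injective θ) :
    ∃ π : Equiv.Perm (Fin n), StrictMono (θ ∘ π) :=
  ⟨Tuple.sort θ, (Tuple.monotone_sort θ).strictMono_of_injective
    (hθ.comp (Tuple.sort θ).injective)⟩

lemma tendsto_zero_of_eventually_le {f : ℕ → ℝ≥0∞} {g : ℕ → ℝ} (hg : Tendsto g atTop (𝓝 0))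
    (h : ∀ᶠ n in atTop, f n ≤ ENNReal.ofReal (g n)) : Tendsto f atTop (𝓝 0) := by
  have h0 : Tendsto (fun n => ENNReal.ofReal (g n)) atTop (𝓝 0) := by
    simpa using ENNReal.tendsto_ofReal hg
  exact tendsto_of_tendsto_of_tendsto_of_le_of_le' tendsto_const_nhds h0
    (Eventually.of_forall fun _ => zero_le) h

lemma tendsto_one_div_logb : Tendsto (fun n : ℕ => 1 / Real.logb 2 n) atTop (𝓝 0) :=
  tendsto_const_nhds.div_atTop tendsto_logb_natCast

theorem tendsto_maxError_vlbzSort (h0 : 0 < (p : ℝ)) (h1 : (p : ℝ) < 1 / 2) :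
    Tendsto (fun n => (vlbzSort p n).maxError p) atTop (𝓝 0) := by
  refine tendsto_zero_of_eventually_le tendsto_one_div_logb ?_
  filter_upwards [eventually_ge_atTop 2] with n hn
  exact iSup_le fun θ => iSup_le fun π => iSup_le fun hπ => runLaw_outputs_compl_le h0 h1 hn hπ

theorem tendsto_maxError_truncate (h0 : 0 < (p : ℝ)) (h1 : (p : ℝ) < 1 / 2) :
    Tendsto (fun n => ((vlbzSort p n).truncate (queryCap n)).maxError p) atTop (𝓝 0) := by
  have hg := tendsto_one_div_logb.add (tendsto_query_bound_div_cap h0 h1)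
  rw [add_zero] at hg
  refine tendsto_zero_of_eventually_le hg ?_
  filter_upwards [eventually_ge_atTop 2] with n hn
  have hl := one_le_logb hn
  have hD := searchLength_nonneg h0 h1 hn
  have hcap : (0 : ℝ) < queryCap n := by exact_mod_cast queryCap_pos hn
  refine iSup_le fun θ => iSup_le fun π => iSup_le fun hπ => ?_
  refine (SortingCode.runLaw_outputs_truncate_compl_le (queryCap_pos hn) π).trans ?_
  rw [ENNReal.ofReal_add (by positivity) (by positivity), ENNReal.ofReal_div_of_pos hcap,
    ENNReal.ofReal_natCast]
  gcongr
  · exact runLaw_outputs_compl_le h0 h1 hn hπ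
  · exact lintegral_outputs_queryCount_le h0 h1 hn hπ

theorem eventually_expectedQueries_truncate_le (h0 : 0 < (p : ℝ)) (h1 : (p : ℝ) < 1 / 2) {R : ℝ}
    (hR0 : 0 < R) (hR : R < (1 - entropy p) / 2) :
    ∀ᶠ n : ℕ in atTop, ∀ θ : Fin n → ℝ, Function.Injective θ →
      ((vlbzSort p n).truncate (queryCap n)).expectedQueries p θ ≤
        ENNReal.ofReal (n * Real.logb 2 n / R) := by
  filter_upwards [eventually_ge_atTop 2, eventually_query_bound_le h1 hR0 hR] with n hn hb θ hθ
  obtain ⟨π, hπ⟩ := exists_strictMono_comp hθ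
  have hl := one_le_logb hn
  have hD := searchLength_nonneg h0 h1 hn
  refine (SortingCode.expectedQueries_truncate_le π).trans ?_
  refine le_trans ?_ (ENNReal.ofReal_le_ofReal hb)
  rw [ENNReal.ofReal_add (by positivity) (by positivity), ENNReal.ofReal_mul (Nat.cast_nonneg _),
    ENNReal.ofReal_mul (Nat.cast_nonneg _), ENNReal.ofReal_natCast, ENNReal.ofReal_natCast]
  gcongr
  · refine (lintegral_outputs_queryCount_le h0 h1 hn hπ).trans_eq ?_
    rw [ENNReal.ofReal_mul (Nat.cast_nonneg _), ENNReal.ofReal_natCast]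
  · exact runLaw_outputs_compl_le h0 h1 hn hπ

theorem eventually_lintegral_outputs_le (h0 : 0 < (p : ℝ)) (h1 : (p : ℝ) < 1 / 2) {R : ℝ}
    (hR0 : 0 < R) (hR : R < (1 - entropy p) / 2) :
    ∀ᶠ n : ℕ in atTop, ∀ (θ : Fin n → ℝ) (π : Equiv.Perm (Fin n)), StrictMono (θ ∘ π) →
      ∫⁻ ω in (vlbzSort p n).outputs θ π, ((vlbzSort p n).queryCount θ ω : ℝ≥0∞)
        ∂((vlbzSort p n).runLaw p) ≤ ENNReal.ofReal (n * Real.logb 2 n / R) := by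
  filter_upwards [eventually_ge_atTop 2, eventually_query_bound_le h1 hR0 hR] with n hn hb θ π hπ
  have hl := one_le_logb hn
  refine (lintegral_outputs_queryCount_le h0 h1 hn hπ).trans (ENNReal.ofReal_le_ofReal ?_)
  have : 0 ≤ queryCap n * (1 / Real.logb 2 n) := by positivity
  linarith

end Main

/-! ### Codes that simulate another code -/

section Simulate

variable {n : ℕ}

/-- The query with renamed items. -/
def renameQuery (σ : Equiv.Perm (Fin n)) (q : Query n) : Query n :=
  ⟨(σ q.1.1, σ q.1.2), σ.injective.ne q.2⟩

/-- The history with items renamed by `σ⁻¹` and the responses flipped according to `w`. -/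
def decodeHistory (σ : Equiv.Perm (Fin n)) (w : ℕ → Bool) : History n → History n
  | [] => []
  | o :: h => (renameQuery σ⁻¹ o.1, xor o.2 (w h.length)) :: decodeHistory σ w h

@[simp] lemma length_decodeHistory (σ : Equiv.Perm (Fin n)) (w : ℕ → Bool) (h : History n) :
    (decodeHistory σ w h).length = h.length := by
  induction h with
  | nil => rfl
  | cons o h ih => simp [decodeHistory, ih]

lemma renameQuery_inv_renameQuery (σ : Equiv.Perm (Fin n)) (q : Query n) :
    renameQuery σ⁻¹ (renameQuery σ q) = q := by
  simp [renameQuery]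

lemma measurable_decodeHistory (σ : Equiv.Perm (Fin n)) (h : History n) :
    Measurable fun w : ℕ → Bool => decodeHistory σ w h := by
  induction h with
  | nil => exact measurable_const
  | cons o h ih =>
    have : Measurable fun x : Bool × History n => (renameQuery σ⁻¹ o.1, xor o.2 x.1) :: x.2 :=
      measurable_of_countable _
    exact this.comp ((measurable_pi_apply h.length).prodMk ih)

/-- The noise that a simulated code sees: the first `K` bits are skipped, and the others are
combined with `w`. -/
def shiftNoise (K : ℕ) (w z : ℕ → Bool) : ℕ → Bool := fun k => xor (z (k + K)) (w k)

lemma measurable_shiftNoise (K : ℕ) :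
    Measurable fun x : (ℕ → Bool) × (ℕ → Bool) => shiftNoise K x.1 x.2 := by
  refine measurable_pi_lambda _ fun k => ?_
  have h1 : Measurable fun x : Bool × Bool => xor x.1 x.2 := measurable_of_countable _
  have h2 : Measurable fun x : (ℕ → Bool) × (ℕ → Bool) => (x.2 (k + K), x.1 k) :=
    ((measurable_pi_apply (k + K)).comp measurable_snd).prodMk
      ((measurable_pi_apply k).comp measurable_fst)
  exact h1.comp h2

namespace SortingCode

/-- The code that repeats the query `q₀` for a random time of law `κ`, and then runs `c` with items
renamed by a uniformly random permutation and responses flipped by additional noise of law `ν`. -/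
noncomputable def simulate (c : SortingCode n) (q₀ : Query n) (κ : Measure ℕ)
    [IsProbabilityMeasure κ] (ν : Measure (ℕ → Bool)) [IsProbabilityMeasure ν] :
    SortingCode n where
  Seed := (c.Seed × (ℕ → Bool)) × (ℕ × Equiv.Perm (Fin n))
  law := (c.law.prod ν).prod (κ.prod (PMF.uniformOfFintype (Equiv.Perm (Fin n))).toMeasure)
  -- Histories list the latest query first, so `take` discards exactly the initial dummy queries.
  next s h := if h.length < s.2.1 then some q₀ else
    (c.next s.1.1 (decodeHistory s.2.2 s.1.2 (h.take (h.length - s.2.1)))).map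
      (renameQuery s.2.2)
  estimate s h := s.2.2 * c.estimate s.1.1
    (decodeHistory s.2.2 s.1.2 (h.take (h.length - s.2.1)))
  measurableSet_next h a := by
    suffices H : Measurable fun s : (c.Seed × (ℕ → Bool)) × (ℕ × Equiv.Perm (Fin n)) =>
        if h.length < s.2.1 then some q₀ else
        (c.next s.1.1 (decodeHistory s.2.2 s.1.2 (h.take (h.length - s.2.1)))).map
          (renameQuery s.2.2) from H (measurableSet_singleton a)
    refine measurable_from_prod_countable_left fun x => ?_
    by_cases hx : h.length < x.1
    · simp only [hx, if_true]
      exact measurable_const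
    · simp only [hx, if_false]
      exact (measurable_of_countable (Option.map (renameQuery x.2))).comp
        (c.measurable_next.comp
          (measurable_fst.prodMk ((measurable_decodeHistory x.2 _).comp measurable_snd)))
  measurableSet_estimate h e := by
    suffices H : Measurable fun s : (c.Seed × (ℕ → Bool)) × (ℕ × Equiv.Perm (Fin n)) =>
        s.2.2 * c.estimate s.1.1 (decodeHistory s.2.2 s.1.2 (h.take (h.length - s.2.1))) from
      H (measurableSet_singleton e)
    refine measurable_from_prod_countable_left fun x => ?_
    have h1 : Measurable fun y : c.Seed × (ℕ → Bool) =>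
        (y.1, decodeHistory x.2 y.2 (h.take (h.length - x.1))) :=
      measurable_fst.prodMk ((measurable_decodeHistory x.2 _).comp measurable_snd)
    have h2 : Measurable fun e : Equiv.Perm (Fin n) => x.2 * e := measurable_of_countable _
    exact h2.comp (c.measurable_estimate.comp h1)

variable {c : SortingCode n} {q₀ : Query n} {κ : Measure ℕ} [IsProbabilityMeasure κ]
  {ν : Measure (ℕ → Bool)} [IsProbabilityMeasure ν] {θ : Fin n → ℝ}

/-- The run of `c` that is simulated. -/
def innerRun (c : SortingCode n)
    (ω : ((c.Seed × (ℕ → Bool)) × (ℕ × Equiv.Perm (Fin n))) × (ℕ → Bool)) :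
    c.Seed × (ℕ → Bool) :=
  (ω.1.1.1, shiftNoise ω.1.2.1 ω.1.1.2 ω.2)

lemma simulate_next (s : (c.Seed × (ℕ → Bool)) × (ℕ × Equiv.Perm (Fin n))) (h : History n) :
    (c.simulate q₀ κ ν).next s h = if h.length < s.2.1 then some q₀ else
    (c.next s.1.1 (decodeHistory s.2.2 s.1.2 (h.take (h.length - s.2.1)))).map
      (renameQuery s.2.2) := rfl

lemma length_history_simulate (s : (c.Seed × (ℕ → Bool)) × (ℕ × Equiv.Perm (Fin n)))
    (z : ℕ → Bool) {k : ℕ} (hk : k ≤ s.2.1) :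
    ((c.simulate q₀ κ ν).history θ s z k).length = k := by
  induction k with
  | zero => rfl
  | succ k ih =>
    have hn : (c.simulate q₀ κ ν).next s ((c.simulate q₀ κ ν).history θ s z k) = some q₀ := by
      rw [simulate_next, if_pos (by rw [ih (by omega)]; omega)]
    rw [history_succ_of_some hn, List.length_cons, ih (by omega)]

lemma simulate_next_append (s : (c.Seed × (ℕ → Bool)) × (ℕ × Equiv.Perm (Fin n)))
    {h h' : History n} (hh' : h'.length = s.2.1) :
    (c.simulate q₀ κ ν).next s (h ++ h') =
      (c.next s.1.1 (decodeHistory s.2.2 s.1.2 h)).map (renameQuery s.2.2) := by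
  rw [simulate_next, List.length_append, if_neg (by omega), hh', Nat.add_sub_cancel,
    List.take_left']
  rfl

/-- After the dummy phase, the decoded part of the history is the history of `c` for the renamed
items and the shifted noise. The artificial flip and the channel noise at a given time combine by
associativity of `xor`, once the length of the history is identified with the time. -/
lemma history_simulate (ω : ((c.Seed × (ℕ → Bool)) × (ℕ × Equiv.Perm (Fin n))) × (ℕ → Bool))
    (k : ℕ) : ∃ h : History n, (c.simulate q₀ κ ν).history θ ω.1 ω.2 (k + ω.1.2.1) =
        h ++ (c.simulate q₀ κ ν).history θ ω.1 ω.2 ω.1.2.1 ∧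
      decodeHistory ω.1.2.2 ω.1.1.2 h =
        c.history (θ ∘ ω.1.2.2) (innerRun c ω).1 (innerRun c ω).2 k := by
  have hlen := length_history_simulate (q₀ := q₀) (κ := κ) (ν := ν) (θ := θ) ω.1 ω.2 le_rfl
  induction k with
  | zero => exact ⟨[], by simp, rfl⟩
  | succ k ih =>
    obtain ⟨h, h1, h2⟩ := ih
    have hnext : (c.simulate q₀ κ ν).next ω.1
        ((c.simulate q₀ κ ν).history θ ω.1 ω.2 (k + ω.1.2.1)) =
        (c.next (innerRun c ω).1 (c.history (θ ∘ ω.1.2.2) (innerRun c ω).1 (innerRun c ω).2 k)).map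
          (renameQuery ω.1.2.2) := by
      rw [h1, simulate_next_append _ hlen, h2]
      rfl
    rw [show k + 1 + ω.1.2.1 = k + ω.1.2.1 + 1 by omega]
    rcases hq : c.next (innerRun c ω).1
      (c.history (θ ∘ ω.1.2.2) (innerRun c ω).1 (innerRun c ω).2 k) with _ | q
    · rw [hq] at hnext
      exact ⟨h, by rw [history_succ_of_none hnext, h1], by rw [history_succ_of_none hq, h2]⟩
    · have hk : h.length = k := by
        rw [← length_decodeHistory ω.1.2.2 ω.1.1.2 h, h2]
        refine length_history_of_not_stoppedAt (c := c) (ω := innerRun c ω) fun hs => ?_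
        rw [StoppedAt, hq] at hs
        exact Option.some_ne_none _ hs
      rw [hq] at hnext
      refine ⟨(renameQuery ω.1.2.2 q, _) :: h, by rw [history_succ_of_some hnext, h1]; rfl, ?_⟩
      rw [history_succ_of_some hq, decodeHistory, h2, renameQuery_inv_renameQuery, hk]
      simp only [innerRun, shiftNoise, renameQuery, Function.comp_apply, Bool.xor_assoc]
      rfl

lemma stoppedAt_simulate (ω : ((c.Seed × (ℕ → Bool)) × (ℕ × Equiv.Perm (Fin n))) × (ℕ → Bool))
    (k : ℕ) : (c.simulate q₀ κ ν).StoppedAt θ ω (k + ω.1.2.1) ↔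
      c.StoppedAt (θ ∘ ω.1.2.2) (innerRun c ω) k := by
  have hlen := length_history_simulate (q₀ := q₀) (κ := κ) (ν := ν) (θ := θ) ω.1 ω.2 le_rfl
  obtain ⟨h, h1, h2⟩ := history_simulate (q₀ := q₀) (κ := κ) (ν := ν) (θ := θ) ω k
  change (c.simulate q₀ κ ν).next ω.1 ((c.simulate q₀ κ ν).history θ ω.1 ω.2 (k + ω.1.2.1)) =
    none ↔ _
  rw [h1, simulate_next_append _ hlen, Option.map_eq_none_iff, h2]
  rfl

lemma not_stoppedAt_simulate
    (ω : ((c.Seed × (ℕ → Bool)) × (ℕ × Equiv.Perm (Fin n))) × (ℕ → Bool)) {k : ℕ}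
    (hk : k < ω.1.2.1) : ¬ (c.simulate q₀ κ ν).StoppedAt θ ω k := by
  have hlen := length_history_simulate (q₀ := q₀) (κ := κ) (ν := ν) (θ := θ) ω.1 ω.2 hk.le
  change ¬ (c.simulate q₀ κ ν).next ω.1 ((c.simulate q₀ κ ν).history θ ω.1 ω.2 k) = none
  rw [simulate_next, if_pos (by omega)]
  exact Option.some_ne_none _

lemma queryCount_simulate
    (ω : ((c.Seed × (ℕ → Bool)) × (ℕ × Equiv.Perm (Fin n))) × (ℕ → Bool)) :
    ((c.simulate q₀ κ ν).queryCount θ ω : ℝ≥0∞) =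
      ω.1.2.1 + c.queryCount (θ ∘ ω.1.2.2) (innerRun c ω) := by
  classical
  refine (queryCount_eq_tsum (c := c.simulate q₀ κ ν) (θ := θ) ω).trans
    ((ENNReal.summable.sum_add_tsum_nat_add' (k := ω.1.2.1)).symm.trans ?_)
  rw [queryCount_eq_tsum]
  congr 1
  · rw [Finset.sum_congr rfl fun k hk =>
      if_neg (not_stoppedAt_simulate (q₀ := q₀) (κ := κ) (ν := ν) (θ := θ) ω
        (Finset.mem_range.1 hk))]
    simp
  · exact tsum_congr fun k => if_congr (stoppedAt_simulate ω k) rfl rfl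

lemma mem_outputs_simulate
    {ω : ((c.Seed × (ℕ → Bool)) × (ℕ × Equiv.Perm (Fin n))) × (ℕ → Bool)}
    {π : Equiv.Perm (Fin n)}
    (h : innerRun c ω ∈ c.outputs (θ ∘ ω.1.2.2) (ω.1.2.2⁻¹ * π)) :
    ω ∈ (c.simulate q₀ κ ν).outputs θ π := by
  obtain ⟨k, hk, he⟩ := h
  have hlen := length_history_simulate (q₀ := q₀) (κ := κ) (ν := ν) (θ := θ) ω.1 ω.2 le_rfl
  refine ⟨k + ω.1.2.1, (stoppedAt_simulate ω k).2 hk, ?_⟩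
  obtain ⟨h, h1, h2⟩ := history_simulate (q₀ := q₀) (κ := κ) (ν := ν) (θ := θ) ω k
  have : (c.simulate q₀ κ ν).estimate ω.1 (h ++ (c.simulate q₀ κ ν).history θ ω.1 ω.2 ω.1.2.1) =
      ω.1.2.2 * c.estimate (innerRun c ω).1 (decodeHistory ω.1.2.2 ω.1.1.2 h) := by
    change ω.1.2.2 * c.estimate ω.1.1.1 (decodeHistory ω.1.2.2 ω.1.1.2 (List.take _ _)) = _
    rw [List.length_append, hlen, Nat.add_sub_cancel, List.take_left']
    · rfl
    · rfl
  rw [h1, this, h2, he, mul_inv_cancel_left]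

/-- The law of the simulated run. -/
lemma lintegral_simulate {p p' : unitInterval}
    (hT : ∀ K, (ν.prod (noiseLaw p)).map (fun x => shiftNoise K x.1 x.2) = noiseLaw p')
    {F : ℕ × Equiv.Perm (Fin n) → c.Seed × (ℕ → Bool) → ℝ≥0∞} (hF : ∀ x, Measurable (F x)) :
    ∫⁻ ω : ((c.Seed × (ℕ → Bool)) × (ℕ × Equiv.Perm (Fin n))) × (ℕ → Bool),
      F ω.1.2 (innerRun c ω) ∂((c.simulate q₀ κ ν).runLaw p) =
      ∫⁻ x, ∫⁻ y, F x y ∂(c.runLaw p')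
        ∂(κ.prod (PMF.uniformOfFintype (Equiv.Perm (Fin n))).toMeasure) := by
  have hinner (x : ℕ × Equiv.Perm (Fin n)) :
      Measurable fun y : (c.Seed × (ℕ → Bool)) × (ℕ → Bool) =>
        F x (y.1.1, shiftNoise x.1 y.1.2 y.2) :=
    (hF x).comp ((measurable_fst.comp measurable_fst).prodMk ((measurable_shiftNoise x.1).comp
      ((measurable_snd.comp measurable_fst).prodMk measurable_snd)))
  have hG' : Measurable fun y : ((c.Seed × (ℕ → Bool)) × (ℕ → Bool)) × (ℕ × Equiv.Perm (Fin n)) =>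
      F y.2 (y.1.1.1, shiftNoise y.2.1 y.1.1.2 y.1.2) :=
    measurable_from_prod_countable_left hinner
  have hG : Measurable fun ω : ((c.Seed × (ℕ → Bool)) × (ℕ × Equiv.Perm (Fin n))) × (ℕ → Bool) =>
      F ω.1.2 (innerRun c ω) :=
    hG'.comp (((measurable_fst.comp measurable_fst).prodMk measurable_snd).prodMk
      (measurable_snd.comp measurable_fst))
  refine (lintegral_prod _ hG.aemeasurable).trans ?_
  have hG2 : Measurable fun s : (c.Seed × (ℕ → Bool)) × (ℕ × Equiv.Perm (Fin n)) =>
      ∫⁻ z, F s.2 (innerRun c (s, z)) ∂(noiseLaw p) := hG.lintegral_prod_right'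
  refine (lintegral_prod_symm _ hG2.aemeasurable).trans ?_
  refine lintegral_congr fun x => ?_
  have hG3 : Measurable fun s : c.Seed × (ℕ → Bool) =>
      ∫⁻ z, F x (innerRun c ((s, x), z)) ∂(noiseLaw p) := (hinner x).lintegral_prod_right'
  refine (lintegral_prod _ hG3.aemeasurable).trans ?_
  rw [runLaw, lintegral_prod _ (hF x).aemeasurable]
  refine lintegral_congr fun s => ?_
  have hFs : Measurable fun y : ℕ → Bool => F x (s, y) := (hF x).comp measurable_prodMk_left
  rw [← hT x.1, lintegral_map hFs (measurable_shiftNoise x.1)]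
  exact (lintegral_prod (fun y : (ℕ → Bool) × (ℕ → Bool) => F x (s, shiftNoise x.1 y.1 y.2))
    (hFs.comp (measurable_shiftNoise x.1)).aemeasurable).symm

lemma expectedQueries_simulate {p p' : unitInterval}
    (hT : ∀ K, (ν.prod (noiseLaw p)).map (fun x => shiftNoise K x.1 x.2) = noiseLaw p') :
    (c.simulate q₀ κ ν).expectedQueries p θ =
      ∫⁻ K, (K : ℝ≥0∞) ∂κ + ∑ σ : Equiv.Perm (Fin n),
        (Fintype.card (Equiv.Perm (Fin n)) : ℝ≥0∞)⁻¹ * c.expectedQueries p' (θ ∘ σ) := by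
  have h := lintegral_simulate (c := c) (q₀ := q₀) (κ := κ) hT
    (F := fun x y => (x.1 : ℝ≥0∞) + c.queryCount (θ ∘ x.2) y)
    (fun x => measurable_const.add measurable_queryCount)
  have he : (c.simulate q₀ κ ν).expectedQueries p θ = _ :=
    (lintegral_congr fun ω => queryCount_simulate ω).trans h
  rw [he]
  have h2 (x : ℕ × Equiv.Perm (Fin n)) : ∫⁻ y, (x.1 : ℝ≥0∞) + c.queryCount (θ ∘ x.2) y
      ∂(c.runLaw p') = x.1 + c.expectedQueries p' (θ ∘ x.2) := by
    rw [lintegral_add_left measurable_const, lintegral_const, measure_univ, mul_one]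
    rfl
  simp_rw [h2]
  rw [lintegral_prod _ (measurable_of_countable _).aemeasurable]
  have h3 (K : ℕ) : ∫⁻ σ, ((K : ℝ≥0∞) + c.expectedQueries p' (θ ∘ σ))
      ∂((PMF.uniformOfFintype (Equiv.Perm (Fin n))).toMeasure) =
      K + ∑ σ : Equiv.Perm (Fin n),
        (Fintype.card (Equiv.Perm (Fin n)) : ℝ≥0∞)⁻¹ * c.expectedQueries p' (θ ∘ σ) := by
    rw [lintegral_add_left measurable_const, lintegral_const, measure_univ, mul_one,
      lintegral_fintype]
    congr 1
    refine Finset.sum_congr rfl fun σ _ => ?_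
    rw [PMF.toMeasure_apply_singleton _ _ (measurableSet_singleton σ),
      PMF.uniformOfFintype_apply, mul_comm]
  simp_rw [h3]
  rw [lintegral_add_left (measurable_of_countable _), lintegral_const, measure_univ, mul_one]

lemma maxError_simulate_le {p p' : unitInterval}
    (hT : ∀ K, (ν.prod (noiseLaw p)).map (fun x => shiftNoise K x.1 x.2) = noiseLaw p') :
    (c.simulate q₀ κ ν).maxError p ≤ c.maxError p' := by
  refine iSup_le fun θ => iSup_le fun π => iSup_le fun hπ => ?_
  set F : ℕ × Equiv.Perm (Fin n) → c.Seed × (ℕ → Bool) → ℝ≥0∞ :=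
    fun x => (c.outputs (θ ∘ x.2) (x.2⁻¹ * π))ᶜ.indicator 1 with hFdef
  have hF (x) : Measurable (F x) := measurable_one.indicator (measurableSet_outputs _).compl
  have h := lintegral_simulate (c := c) (q₀ := q₀) (κ := κ) hT hF
  rw [← lintegral_indicator_one (measurableSet_outputs (c := c.simulate q₀ κ ν) π).compl]
  refine le_trans (lintegral_mono fun ω => ?_) (h.trans_le ?_)
  · by_cases hω : ω ∈ (c.simulate q₀ κ ν).outputs θ π
    · rw [Set.indicator_of_notMem (by simpa using hω)]
      exact zero_le
    · have : innerRun c ω ∈ (c.outputs (θ ∘ ω.1.2.2) (ω.1.2.2⁻¹ * π))ᶜ :=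
        fun h => hω (mem_outputs_simulate h)
      simp only [hFdef, Set.indicator_of_mem this]
      rw [Set.indicator_of_mem (by simpa using hω)]
      exact le_rfl
  · refine (lintegral_mono (g := fun _ => c.maxError p') fun x => ?_).trans (by simp)
    simp only [hFdef]
    rw [lintegral_indicator_one (measurableSet_outputs _).compl]
    refine le_iSup_of_le (θ ∘ x.2) (le_iSup_of_le (x.2⁻¹ * π) (le_iSup_of_le ?_ le_rfl))
    intro i j hij
    simpa using hπ hij

lemma history_congr {θ' : Fin n → ℝ} (h : ∀ i j, θ i < θ j ↔ θ' i < θ' j) (s : c.Seed)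
    (z : ℕ → Bool) (k : ℕ) : c.history θ s z k = c.history θ' s z k := by
  induction k with
  | zero => rfl
  | succ k ih => simp only [history, ih, h]

lemma expectedQueries_congr {p : unitInterval} {θ' : Fin n → ℝ}
    (h : ∀ i j, θ i < θ j ↔ θ' i < θ' j) : c.expectedQueries p θ = c.expectedQueries p θ' := by
  simp only [expectedQueries, queryCount, history_congr h]

/-- Averaged over renamings, the expected number of queries does not depend on the order. -/
lemma sum_expectedQueries_comp {p : unitInterval} (hθ : Function.Injective θ) :
    ∑ σ : Equiv.Perm (Fin n), c.expectedQueries p (θ ∘ σ) =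
      ∑ σ : Equiv.Perm (Fin n), c.expectedQueries p ((fun i : Fin n => (i : ℝ)) ∘ σ) := by
  obtain ⟨π, hπ⟩ := exists_strictMono_comp hθ
  -- Replacing `σ` by `π * σ` compares `θ ∘ π ∘ σ`, which is ordered like `σ`; a code only sees the
  -- order.
  rw [← Equiv.sum_comp (Equiv.mulLeft π)]
  refine Finset.sum_congr rfl fun σ _ => expectedQueries_congr fun i j => ?_
  have := hπ.lt_iff_lt (a := σ i) (b := σ j)
  simp only [Function.comp_apply, Equiv.coe_mulLeft, Equiv.Perm.coe_mul] at this ⊢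
  rw [this]
  simp

end SortingCode

end Simulate

/-! ### Achievable rates -/

/-- No artificial noise: skipping the first `K` bits of i.i.d. noise does not change its law. -/
lemma map_shiftNoise_dirac_false (p : unitInterval) (K : ℕ) :
    ((Measure.dirac fun _ => false).prod (noiseLaw p)).map (fun x => shiftNoise K x.1 x.2) =
      noiseLaw p := by
  rw [Measure.dirac_prod, Measure.map_map (measurable_shiftNoise K) measurable_prodMk_left]
  have h : ((fun x : (ℕ → Bool) × (ℕ → Bool) => shiftNoise K x.1 x.2) ∘
      Prod.mk fun _ => false) = fun z k => z (k + K) := by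
    ext z k
    simp [shiftNoise]
  rw [h]
  exact Measure.map_infinitePi_infinitePi_of_inj (add_left_injective K)

/-- A noiseless channel contributes nothing, so all of the noise is artificial. -/
lemma map_shiftNoise_zero (p : unitInterval) (K : ℕ) :
    ((noiseLaw p).prod (noiseLaw 0)).map (fun x => shiftNoise K x.1 x.2) = noiseLaw p := by
  have h0 : noiseLaw 0 = Measure.dirac fun _ => false := by
    simp only [noiseLaw, bernoulliMeasure_zero, Measure.infinitePi_dirac]
  rw [h0, Measure.prod_dirac, Measure.map_map (measurable_shiftNoise K) measurable_prodMk_right]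
  have h : ((fun x : (ℕ → Bool) × (ℕ → Bool) => shiftNoise K x.1 x.2) ∘
      fun w => (w, fun _ => false)) = id := by
    ext w k
    simp [shiftNoise]
  rw [h, Measure.map_id]

/-- Every nonnegative real number is the mean of a law on `ℕ`. -/
lemma exists_lintegral_natCast_eq {x : ℝ} (hx : 0 ≤ x) :
    ∃ κ : Measure ℕ, IsProbabilityMeasure κ ∧ ∫⁻ K, (K : ℝ≥0∞) ∂κ = ENNReal.ofReal x := by
  have h0 := Int.fract_nonneg x
  have h1 := (Int.fract_lt_one x).le
  -- A two-point law on the neighbouring integers, weighted by the fractional part.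
  refine ⟨ENNReal.ofReal (1 - Int.fract x) • Measure.dirac ⌊x⌋₊ +
    ENNReal.ofReal (Int.fract x) • Measure.dirac (⌊x⌋₊ + 1), ⟨?_⟩, ?_⟩
  · simp only [Measure.coe_add, Measure.coe_smul, Pi.add_apply, Pi.smul_apply, measure_univ,
      smul_eq_mul, mul_one]
    rw [← ENNReal.ofReal_add (by linarith) h0]
    simp
  · rw [lintegral_add_measure, lintegral_smul_measure, lintegral_smul_measure, lintegral_dirac,
      lintegral_dirac, smul_eq_mul, smul_eq_mul, ← ENNReal.ofReal_natCast, ← ENNReal.ofReal_natCast,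
      ← ENNReal.ofReal_mul (by linarith), ← ENNReal.ofReal_mul h0,
      ← ENNReal.ofReal_add (by apply mul_nonneg <;> [linarith; positivity]) (by positivity)]
    congr 1
    have h := Int.floor_add_fract x
    rw [← natCast_floor_eq_intCast_floor hx] at h
    push_cast
    linear_combination h

namespace SortingCode

/-- A code that needs at most `L` queries on average can be turned into one that needs exactly
`L`. -/
lemma exists_expectedQueries_eq {n : ℕ} (hn : 2 ≤ n) {p p' : unitInterval}
    {ν : Measure (ℕ → Bool)} [IsProbabilityMeasure ν]
    (hT : ∀ K, (ν.prod (noiseLaw p)).map (fun x => shiftNoise K x.1 x.2) = noiseLaw p') {L : ℝ}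
    (c : SortingCode n)
    (hc : ∀ θ : Fin n → ℝ, Function.Injective θ → c.expectedQueries p' θ ≤ ENNReal.ofReal L)
    (hL : 0 ≤ L) :
    ∃ c' : SortingCode n, (∀ θ : Fin n → ℝ, Function.Injective θ →
      c'.expectedQueries p θ = ENNReal.ofReal L) ∧ c'.maxError p ≤ c.maxError p' := by
  have hinj : Function.Injective fun i : Fin n => (i : ℝ) :=
    Nat.cast_injective.comp Fin.val_injective
  -- The mean number of queries after random renaming, which is the same for every order; the dummy
  -- queries get mean `L - A`.
  set A : ℝ≥0∞ := ∑ σ : Equiv.Perm (Fin n), (Fintype.card (Equiv.Perm (Fin n)) : ℝ≥0∞)⁻¹ *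
    c.expectedQueries p' ((fun i : Fin n => (i : ℝ)) ∘ σ) with hA
  have hAL : A ≤ ENNReal.ofReal L :=
    sum_card_inv_mul_le fun σ => hc _ (hinj.comp σ.injective)
  have hAtop : A ≠ ∞ := ne_top_of_le_ne_top ENNReal.ofReal_ne_top hAL
  have hx : 0 ≤ L - A.toReal := sub_nonneg.2 (ENNReal.toReal_le_of_le_ofReal hL hAL)
  obtain ⟨κ, hκ, hmean⟩ := exists_lintegral_natCast_eq hx
  have h01 : (⟨0, by omega⟩ : Fin n) ≠ ⟨1, by omega⟩ := by simp
  refine ⟨c.simulate ⟨(⟨0, by omega⟩, ⟨1, by omega⟩), h01⟩ κ ν, fun θ hθ => ?_,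
    maxError_simulate_le hT⟩
  rw [expectedQueries_simulate hT, hmean, ← Finset.mul_sum, sum_expectedQueries_comp hθ,
    Finset.mul_sum, ← hA]
  nth_rw 2 [← ENNReal.ofReal_toReal hAtop]
  rw [← ENNReal.ofReal_add hx ENNReal.toReal_nonneg, sub_add_cancel]

/-- The code that makes no query. -/
noncomputable def idle (n : ℕ) : SortingCode n where
  Seed := Unit
  law := Measure.dirac ()
  next _ _ := none
  estimate _ _ := 1
  measurableSet_next _ _ := MeasurableSet.const _
  measurableSet_estimate _ _ := MeasurableSet.const _

lemma expectedQueries_idle (n : ℕ) (p : unitInterval) (θ : Fin n → ℝ) :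
    (idle n).expectedQueries p θ = 0 := by
  have h (ω) : (idle n).queryCount θ ω = 0 :=
    le_antisymm (queryCount_le_of_stoppedAt (k := 0) rfl) zero_le
  simp only [expectedQueries, h]
  simp

end SortingCode

/-- Only finitely many `n` violate the bound, and for them any code of the right mean will do
because the error matters only in the limit. -/
lemma achievable_of_eventually_le {p p' : unitInterval} {ν : Measure (ℕ → Bool)}
    [IsProbabilityMeasure ν]
    (hT : ∀ K, (ν.prod (noiseLaw p)).map (fun x => shiftNoise K x.1 x.2) = noiseLaw p') {R : ℝ}
    (hR : 0 < R) (c : (n : ℕ) → SortingCode n)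
    (hc : ∀ᶠ n : ℕ in atTop, ∀ θ : Fin n → ℝ, Function.Injective θ →
      (c n).expectedQueries p' θ ≤ ENNReal.ofReal (n * Real.logb 2 n / R))
    (he : Tendsto (fun n => (c n).maxError p') atTop (𝓝 0)) : Achievable p R := by
  have key (n : ℕ) : ∃ c' : SortingCode n, c'.HasRate p R ∧
      (2 ≤ n → (∀ θ : Fin n → ℝ, Function.Injective θ →
        (c n).expectedQueries p' θ ≤ ENNReal.ofReal (n * Real.logb 2 n / R)) →
      c'.maxError p ≤ (c n).maxError p') := by
    rcases lt_or_ge n 2 with hn | hn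
    -- With fewer than two items there are no queries, and `n log₂ n = 0`.
    · refine ⟨.idle n, fun θ _ => ?_, fun h => absurd h (by omega)⟩
      rw [SortingCode.expectedQueries_idle]
      interval_cases n <;> simp
    · have hL : 0 ≤ n * Real.logb 2 n / R := by
        have := one_le_logb hn
        positivity
      by_cases h : ∀ θ : Fin n → ℝ, Function.Injective θ →
        (c n).expectedQueries p' θ ≤ ENNReal.ofReal (n * Real.logb 2 n / R)
      · obtain ⟨c', h1, h2⟩ := SortingCode.exists_expectedQueries_eq hn hT (c n) h hL
        exact ⟨c', h1, fun _ _ => h2⟩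
      -- The given code is too slow for this `n`; pad the code without queries instead.
      · obtain ⟨c', h1, -⟩ := SortingCode.exists_expectedQueries_eq hn hT (.idle n)
          (fun θ _ => by rw [SortingCode.expectedQueries_idle]; exact zero_le) hL
        exact ⟨c', h1, fun _ h' => absurd h' h⟩
  choose c' h1 h2 using key
  refine ⟨hR, c', h1, tendsto_of_tendsto_of_tendsto_of_le_of_le' tendsto_const_nhds he
    (Eventually.of_forall fun _ => zero_le) ?_⟩
  filter_upwards [hc, eventually_ge_atTop 2] with n hn hn2 using h2 n hn2 hn

lemma exists_unitInterval_lt_one_sub_entropy {R : ℝ} (hR : R < (1 - entropy 0) / 2) :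
    ∃ p : unitInterval, 0 < (p : ℝ) ∧ (p : ℝ) < 1 / 2 ∧ R < (1 - entropy p) / 2 := by
  have hcont : Continuous fun x : ℝ => (1 - entropy x) / 2 := by
    unfold entropy
    have := Real.binEntropy_continuous
    fun_prop
  have h1 : ∀ᶠ x in 𝓝[>] (0 : ℝ), R < (1 - entropy x) / 2 :=
    (hcont.tendsto 0).mono_left nhdsWithin_le_nhds |>.eventually (lt_mem_nhds hR)
  have h2 : ∀ᶠ x in 𝓝[>] (0 : ℝ), x ∈ Set.Ioo (0 : ℝ) (1 / 2) :=
    Ioo_mem_nhdsGT (by norm_num)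
  obtain ⟨x, hx, h0, h3⟩ := (h1.and h2).exists
  exact ⟨⟨x, h0.le, by linarith⟩, h0, h3, hx⟩

/-- For `p = 0` the algorithm itself is not covered by the drift argument, so it is run on a
simulated channel with small positive noise and still sufficient capacity. -/
theorem achievable_of_lt {p : unitInterval} (hp : (p : ℝ) < 1 / 2) {R : ℝ} (hR0 : 0 < R)
    (hR : R < (1 - entropy p) / 2) : Achievable p R := by
  rcases (unitInterval.nonneg p).eq_or_lt with h0 | h0
  · obtain rfl : p = 0 := Subtype.ext h0.symm
    obtain ⟨p', h1, h2, h3⟩ := exists_unitInterval_lt_one_sub_entropy hR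
    exact achievable_of_eventually_le (map_shiftNoise_zero p') hR0 _
      (eventually_expectedQueries_truncate_le h1 h2 hR0 h3) (tendsto_maxError_truncate h1 h2)
  · exact achievable_of_eventually_le (map_shiftNoise_dirac_false p) hR0 _
      (eventually_expectedQueries_truncate_le h0 hp hR0 hR) (tendsto_maxError_truncate h0 hp)

theorem le_capacity {p : unitInterval} (hp : (p : ℝ) < 1 / 2) :
    (((1 - entropy p) / 2 : ℝ) : EReal) ≤ capacity p := by
  refine EReal.ge_of_forall_gt_iff_ge.1 fun x hx => ?_
  -- The maximum with `0` ensures that the rate is positive.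
  obtain ⟨R, hR, hR'⟩ := exists_between (max_lt (EReal.coe_lt_coe_iff.1 hx)
    (half_pos (one_sub_entropy_pos hp)))
  refine (EReal.coe_le_coe_iff.2 ((le_max_left _ _).trans hR.le)).trans ?_
  exact le_iSup₂_of_le R (achievable_of_lt hp ((le_max_right _ _).trans_lt hR) hR') le_rfl

end NoisySorting

theorem theorem1 (p : unitInterval) (hp : (p : ℝ) < 1 / 2) :
    (∀ R : ℝ, 0 < R → R < (1 - NoisySorting.entropy p) / 2 → NoisySorting.Achievable p R) ∧
    (((1 - NoisySorting.entropy p) / 2 : ℝ) : EReal) ≤ NoisySorting.capacity p ∧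
    (0 < (p : ℝ) →
      Tendsto (fun n => (NoisySorting.vlbzSort p n).maxError p) atTop (𝓝 0) ∧
      (∀ R : ℝ, 0 < R → R < (1 - NoisySorting.entropy p) / 2 →
        ∀ᶠ n : ℕ in atTop, ∀ (θ : Fin n → ℝ) (π : Equiv.Perm (Fin n)), StrictMono (θ ∘ π) →
          ∫⁻ ω in (NoisySorting.vlbzSort p n).outputs θ π,
              ((NoisySorting.vlbzSort p n).queryCount θ ω : ℝ≥0∞)
              ∂((NoisySorting.vlbzSort p n).runLaw p) ≤
            ENNReal.ofReal (n * Real.logb 2 n / R)) ∧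
      ∃ N : ℕ → ℕ,
        Tendsto (fun n => ((NoisySorting.vlbzSort p n).truncate (N n)).maxError p) atTop (𝓝 0) ∧
        ∀ R : ℝ, 0 < R → R < (1 - NoisySorting.entropy p) / 2 →
          ∀ᶠ n : ℕ in atTop, ∀ θ : Fin n → ℝ, Function.Injective θ →
            ((NoisySorting.vlbzSort p n).truncate (N n)).expectedQueries p θ ≤
              ENNReal.ofReal (n * Real.logb 2 n / R)) := by
  exact ⟨fun R hR0 hR => NoisySorting.achievable_of_lt hp hR0 hR, NoisySorting.le_capacity hp,
    fun h0 => ⟨NoisySorting.tendsto_maxError_vlbzSort h0 hp,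
      fun R hR0 hR => NoisySorting.eventually_lintegral_outputs_le h0 hp hR0 hR,
      NoisySorting.queryCap, NoisySorting.tendsto_maxError_truncate h0 hp,
      fun R hR0 hR => NoisySorting.eventually_expectedQueries_truncate_le h0 hp hR0 hR⟩⟩
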